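/- Let $\mathbb{T}=\mathbb{R}/2\pi\mathbb{Z}$, with $\int_{\mathbb{T}}f\,dx=\frac1{2\pi}\int_0^{2\pi}f(x)\,dx$ and $\|f\|_{L^2}^2=\int_{\mathbb{T}}|f|^2dx$, let $\widehat f(n)=\int_{\mathbb T}f(x)e^{-inx}dx$, and let $\langle n\rangle=(1+n^2)^{1/2}$. Let $(g_n)_{n\in\mathbb{Z}}$ be i.i.d. complex Gaussian random variables of mean $0$ and variance $1$ (so $g_n=a_n+ib_n$ with $a_n,b_n$ independent and $N(0,\frac12)$ distributed), and let $\mu$ be the law on $H^{1/2-}(\mathbb{T})=\bigcap_{s<1/2}H^s(\mathbb{T})$ of the random function $\sum_{n\in\mathbb{Z}}\frac{g_n}{\langle n\rangle}e^{inx}$. For $c:\mathbb{Z}\to\mathbb{R}$, $u\in H^{1/2-}(\mathbb{T})$ and $N\ge 0$ put $\tilde u=\sum_n c(n)\widehat u(n)e^{inx}$ and $\tilde u_N=\sum_{|n|\le N}c(n)\widehat u(n)e^{inx}$; for $Q\subseteq\mathbb{Z}$ let $P_Qf=\sum_{n\in Q}\widehat f(n)e^{inx}$. A set $Q\subseteq\mathbb{Z}$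 is called even if $Q=-Q$. For all real $\mathcal{M}$ and $p\ge 1$ there are $m_0=m_0(\mathcal{M},p)>0$ and $C=C(\mathcal{M},p)$ such that for every $0<m_{\mathcal{M},p}\le m_0$, every $c:\mathbb{Z}\to\mathbb{R}$ with $|c(n)|\le\mathcal{M}$ and $c(n)=c(-n)$ for all $n$, all even sets $Q_1,Q_2,Q_3,Q_4\subseteq\mathbb{Z}$, and every $N$ that is $0$ or a dyadic integer ($N=2^k$, $k\ge0$), the function of $u$ inside the modulus bars below is $\mu$-integrable and $$\int_{H^{1/2-}(\mathbb{T})}\Big|\,1_{\|u\|_{L^2}^2<m_{\mathcal{M},p}}\;\exp\Big(p\cdot\tfrac{-3i}{2}\int_{\mathbb{T}}\partial_x(P_{Q_1}\tilde u_N)\cdot P_{Q_2}\tilde u_N\cdot P_{Q_3}\overline{\tilde u_N}\cdot P_{Q_4}\overline{\tilde u_N}\,dx\Big)\Big|\,d\mu(u)\le C .$$ In particular $m_0$ and $C$ do not depend on $c$, $N$ or the sets $Q_i$. -/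

import Mathlib

open MeasureTheory ProbabilityTheory
open scoped Real ENNReal

noncomputable section

namespace DNLS

instance factTwoPiPos : Fact (0 < 2 * π) := ⟨Real.two_pi_pos⟩

/-- The torus `𝕋 = ℝ / 2πℤ`. -/
abbrev Torus : Type := AddCircle (2 * π)

/-- The measure `dx / 2π` on the torus (total mass one). -/
abbrev torusMeasure : Measure Torus := AddCircle.haarAddCircle

/-- `L²(𝕋)`, for the normalized measure. The monomial `fourier n` is `x ↦ e^{inx}`, and
`fourierLp 2 n` is its class in `L²(𝕋)`. -/
abbrev L2 : Type := Lp ℂ 2 torusMeasure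

/-- The bracket `⟨n⟩ = (1 + n²)^{1/2}`. -/
def bracket (n : ℤ) : ℝ := Real.sqrt (1 + (n : ℝ) ^ 2)

/-- Membership in `H^s(𝕋)` for all `s < 1/2` (an element of this intersection is in `L²(𝕋)`). -/
def MemHalfMinus (u : L2) : Prop :=
  ∀ s : ℝ, s < 1 / 2 → Summable fun n : ℤ => bracket n ^ (2 * s) * ‖fourierCoeff u n‖ ^ 2

/-- The space `H^{1/2-}(𝕋)`, the intersection of the spaces `H^s(𝕋)` over `s < 1/2`. -/
def HalfMinus : Type := {u : L2 // MemHalfMinus u}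

/-- The `σ`-algebra on `H^{1/2-}(𝕋)` generated by the Fourier coefficients. The space is a
separable Fréchet space whose norms are countable suprema of functions of finitely many Fourier
coefficients, so that this is its Borel `σ`-algebra. -/
instance : MeasurableSpace HalfMinus :=
  MeasurableSpace.comap (fun u (n : ℤ) => fourierCoeff u.1 n) MeasurableSpace.pi

theorem memHalfMinus_zero : MemHalfMinus 0 := by
  intro s _
  have h : ∀ n : ℤ, fourierCoeff (0 : L2) n = 0 := fun n => by
    rw [← fourierBasis_repr]; simp
  simp only [h, norm_zero]
  simp

/-- The law of a complex Gaussian `a + ib` of mean `0` and variance `1`: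
`a` and `b` are independent and `N(0, 1/2)` distributed. -/
def stdComplexGaussian : Measure ℂ :=
  ((gaussianReal 0 (1 / 2)).prod (gaussianReal 0 (1 / 2))).map fun z : ℝ × ℝ => (⟨z.1, z.2⟩ : ℂ)

/-- `g` is a family, indexed by `ℤ`, of i.i.d. complex Gaussian random variables of mean `0` and
variance `1`. -/
structure IsGaussianFamily {Ω : Type*} [MeasurableSpace Ω] (P : Measure Ω) (g : ℤ → Ω → ℂ) :
    Prop where
  measurable : ∀ n, Measurable (g n)
  law : ∀ n, P.map (g n) = stdComplexGaussian
  indep : iIndepFun g P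

open Classical in
/-- The random function `φ(ω) = ∑ₙ (gₙ(ω) / ⟨n⟩) e^{inx}`, with the value `0` on the null set of
those `ω` for which the series does not define an element of `H^{1/2-}(𝕋)`. -/
def randomSeries {Ω : Type*} (g : ℤ → Ω → ℂ) (ω : Ω) : HalfMinus :=
  if h : MemHalfMinus (∑' n : ℤ, (g n ω / (bracket n : ℂ)) • (fourierLp 2 n : L2)) then ⟨_, h⟩
  else ⟨0, memHalfMinus_zero⟩

/-- The measure `μ = P ∘ φ⁻¹` on `H^{1/2-}(𝕋)`. -/
def mu {Ω : Type*} [MeasurableSpace Ω] (P : Measure Ω) (g : ℤ → Ω → ℂ) : Measure HalfMinus :=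
  P.map (randomSeries g)

/-- `ũ = ∑ₙ c(n) û(n) e^{inx}`, the function `u` with its Fourier coefficients scaled by `c`. -/
def scaled (c : ℤ → ℝ) (u : L2) : L2 :=
  ∑' n : ℤ, ((c n : ℂ) * fourierCoeff u n) • (fourierLp 2 n : L2)

/-- `P_{≤ N} f = ∑_{|n| ≤ N} f̂(n) e^{inx}`. -/
def lowFreq (N : ℕ) (f : Torus → ℂ) (x : Torus) : ℂ :=
  ∑ n ∈ Finset.Icc (-(N : ℤ)) N, fourierCoeff f n * fourier n x

/-- `P_Q f = ∑_{n ∈ Q} f̂(n) e^{inx}`, for trigonometric polynomials `f` (the sum is finite). -/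
def freqProj (Q : Set ℤ) (f : Torus → ℂ) (x : Torus) : ℂ :=
  ∑' n : ℤ, Q.indicator (fun n => fourierCoeff f n * fourier n x) n

/-- A set of integers is even when it is invariant under `n ↦ -n`. -/
def IsEvenSet (Q : Set ℤ) : Prop := ∀ n : ℤ, n ∈ Q ↔ -n ∈ Q

/-- The derivative `∂ₓ f` of a function on the torus. -/
def torusDeriv (f : Torus → ℂ) (x : Torus) : ℂ := deriv (fun t : ℝ => f (x + (t : Torus))) 0

/-- `∫ ∂ₓ(P_{Q₁} v) · P_{Q₂} v · P_{Q₃} v̄ · P_{Q₄} v̄ dx` over the torus. -/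
def quarticIntegral (Q₁ Q₂ Q₃ Q₄ : Set ℤ) (v : Torus → ℂ) : ℂ :=
  ∫ x, torusDeriv (freqProj Q₁ v) x * freqProj Q₂ v x
    * freqProj Q₃ (fun y => (starRingEnd ℂ) (v y)) x
    * freqProj Q₄ (fun y => (starRingEnd ℂ) (v y)) x ∂torusMeasure

open Classical in
/-- The function `1_{‖u‖² < m} exp(p (-3i/2) ∫ ∂ₓ(P_{Q₁} ũ_N) P_{Q₂} ũ_N P_{Q₃} ũ̄_N P_{Q₄} ũ̄_N dx)`
on `H^{1/2-}(𝕋)`. -/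
def truncatedWeight (p m : ℝ) (c : ℤ → ℝ) (Q₁ Q₂ Q₃ Q₄ : Set ℤ) (N : ℕ) (u : HalfMinus) : ℂ :=
  if ‖u.1‖ ^ 2 < m then
    Complex.exp (p * (-3 * Complex.I / 2) *
      quarticIntegral Q₁ Q₂ Q₃ Q₄ (lowFreq N (scaled c u.1)))
  else 0

/-! The random function is measurable, so that `mu` is a genuine push-forward. -/

theorem fourierCoeff_tsum (a : ℤ → ℂ) (k : ℤ) [Decidable (Summable fun n => ‖a n‖ ^ 2)] :
    fourierCoeff (∑' n : ℤ, a n • (fourierLp 2 n : L2) : L2) k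
      = if Summable (fun n => ‖a n‖ ^ 2) then a k else 0 := by
  have key : ∀ v : L2, HasSum (fun n : ℤ => a n • (fourierLp 2 n : L2)) v →
      ∀ k, fourierCoeff v k = a k := by
    intro v hv k
    rw [← fourierBasis_repr]
    have h := hv.mapL (innerSL ℂ (fourierLp 2 k : L2))
    have h2 := h.unique (hasSum_single k (fun j hj => ?_))
    · rw [HilbertBasis.repr_apply_apply, coe_fourierBasis]
      simp only [innerSL_apply_apply, inner_smul_right] at h2
      rw [h2, inner_self_eq_norm_sq_to_K, orthonormal_fourier.1 k]
      simp
    · simp only [innerSL_apply_apply, inner_smul_right]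
      rw [orthonormal_fourier.2 hj.symm, mul_zero]
  split_ifs with h
  · have hm : Memℓp a 2 := by
      rw [memℓp_gen_iff (by norm_num)]
      simpa using h
    have hs := (fourierBasis (T := 2 * π)).hasSum_repr_symm ⟨a, hm⟩
    rw [coe_fourierBasis] at hs
    exact key _ hs.summable.hasSum k
  · have hn : ¬ Summable fun n : ℤ => a n • (fourierLp 2 n : L2) := by
      intro hs
      apply h
      have h1 := hasSum_sq_fourierCoeff (∑' n : ℤ, a n • (fourierLp 2 n : L2) : L2)
      simpa [key _ hs.hasSum] using h1.summable
    rw [tsum_eq_zero_of_not_summable hn, ← fourierBasis_repr]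
    simp

theorem measurableSet_summable {Ω : Type*} [MeasurableSpace Ω] {f : ℤ → Ω → ℝ}
    (hf : ∀ n, Measurable (f n)) (h0 : ∀ n ω, 0 ≤ f n ω) :
    MeasurableSet {ω | Summable fun n => f n ω} := by
  have h : {ω | Summable fun n => f n ω} = {ω | ∑' n, ENNReal.ofReal (f n ω) < ∞} := by
    ext ω
    simp only [Set.mem_ofPred_eq]
    constructor
    · intro hs
      rw [← ENNReal.ofReal_tsum_of_nonneg (h0 · ω) hs]
      exact ENNReal.ofReal_lt_top
    · intro hs
      have := ENNReal.summable_toReal hs.ne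
      simpa [ENNReal.toReal_ofReal (h0 _ ω)] using this
  rw [h]
  exact measurableSet_lt (Measurable.tsum fun n => (hf n).ennreal_ofReal) measurable_const

theorem one_le_bracket (n : ℤ) : 1 ≤ bracket n := by
  unfold bracket
  rw [Real.one_le_sqrt]
  nlinarith [sq_nonneg (n : ℝ)]

theorem memHalfMinus_iff_rat (u : L2) : MemHalfMinus u ↔
    ∀ q : ℚ, (q : ℝ) < 1 / 2 →
      Summable fun n : ℤ => bracket n ^ (2 * (q : ℝ)) * ‖fourierCoeff u n‖ ^ 2 := by
  refine ⟨fun h q hq => h q hq, fun h s hs => ?_⟩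
  obtain ⟨q, hsq, hq⟩ := exists_rat_btwn hs
  refine Summable.of_nonneg_of_le (fun n => ?_) (fun n => ?_) (h q hq)
  · have := one_le_bracket n
    positivity
  · gcongr
    exact one_le_bracket n

theorem measurable_randomSeries {Ω : Type*} [MeasurableSpace Ω] {g : ℤ → Ω → ℂ}
    (hg : ∀ n, Measurable (g n)) : Measurable (randomSeries g) := by
  classical
  set S : Ω → L2 := fun ω => ∑' n : ℤ, (g n ω / (bracket n : ℂ)) • (fourierLp 2 n : L2) with hS
  have hcoef : ∀ k, Measurable fun ω => fourierCoeff (S ω) k := by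
    intro k
    simp only [hS, fourierCoeff_tsum]
    refine Measurable.ite (measurableSet_summable (fun n => ?_) fun n ω => by positivity) ?_
      measurable_const
    · exact (((hg n).div_const _).norm).pow_const 2
    · exact (hg k).div_const _
  have hmem : MeasurableSet {ω | MemHalfMinus (S ω)} := by
    have : {ω | MemHalfMinus (S ω)} = ⋂ q : ℚ, ⋂ _ : (q : ℝ) < 1 / 2,
        {ω | Summable fun n : ℤ => bracket n ^ (2 * (q : ℝ)) * ‖fourierCoeff (S ω) n‖ ^ 2} := by
      ext ω
      simp [memHalfMinus_iff_rat]
    rw [this]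
    refine MeasurableSet.iInter fun q => MeasurableSet.iInter fun _ =>
      measurableSet_summable (fun n => ?_) fun n ω => ?_
    · exact (((hcoef n).norm).pow_const 2).const_mul _
    · have := one_le_bracket n
      positivity
  rw [measurable_comap_iff, measurable_pi_iff]
  intro k
  have h : (fun ω => fourierCoeff (randomSeries g ω).1 k)
      = fun ω => if MemHalfMinus (S ω) then fourierCoeff (S ω) k else 0 := by
    funext ω
    by_cases h : MemHalfMinus (S ω)
    · rw [if_pos h]
      have h' : randomSeries g ω = ⟨S ω, h⟩ := dif_pos h
      rw [h']
    · rw [if_neg h]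
      have h' : randomSeries g ω = ⟨0, memHalfMinus_zero⟩ := dif_neg h
      rw [h', ← fourierBasis_repr]
      simp
  change Measurable fun ω => fourierCoeff (randomSeries g ω).1 k
  rw [h]
  exact Measurable.ite hmem (hcoef k) measurable_const

end DNLS

end

namespace DNLS

/-! ### The Prékopa–Leindler inequality on the line and transport of Gaussian measures -/

/-! The modulus of the weight is at most `exp ((3p/2) |Q(x)|)`, where `Q` is the quartic form
`quadForm` at the normalized coefficients `x n = ⟨n⟩ û(n)`, `|n| ≤ N`. Under `mu` these are standard
complex Gaussians (or all zero), so the task is a bound for a finite dimensional Gaussian integral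
that is uniform in `N`.

The tool is Maurey's property (τ): if `φ x * ψ y ≤ exp (‖x - y‖² / 2)` for all `x` and `y`, then `∫
φ dγ * ∫ ψ dγ ≤ 1`. On the line this is the Prékopa–Leindler inequality
(`transportBound_gaussianReal`), and it tensorizes (`transportBound_pi`). Let `φ` be the majorant of
the weight, truncated to the small `L²` ball, and `ψ` the indicator of an event `A` of probability
at least `1/2`. If `(3p/2) |Q(x)| ≤ ‖x - y‖² / 2 + c` for all `x` in the ball and `y` in `A`, the
integral is at most `2 e^c`. No exponential moment has to be computed.

For that pointwise bound, `û` is split into `Y + w`, where `Y` is the part `|n| ≥ K` of the random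
series built from `y`. The `H¹` norm of `w` is at most `t`, with `t² = ‖x - y‖² + (1 + K²) q²`. Its
`L²` norm is at most `2q`, since both `u` and `Y` lie in the ball of radius `q`; for `Y` this holds
with large probability once `K` is large. The Carlson–Agmon inequality `sum_sq_le_l2_mul_l2` then
bounds the `ℓ¹` norm of `w` by a multiple of `√t`. The form is expanded into sixteen terms
(`norm_quadForm_add_le`). Terms with at most two factors `w` are tested against products of Gaussian
series and are bounded by multiples of `1`, `t`, `t^{3/2}`. Terms with three or four factors `w` are
bounded by a multiple of `q t²`, and `q` is chosen small. Young's inequality absorbs everything into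
`t² / 2`; the radius `q` determines `m₀ = q²`.

It remains to bound the products of Gaussian series with large probability. By Markov's inequality,
second moments suffice for the parts without resonances. There, monomials are orthogonal unless they
agree up to a permutation (`integral_norm_chaos_sq_le`), and a product containing the differentiated
factor is measured in `H⁻¹`. Resonant sums without a derivative are bounded by the `L²` norm of `Y`.
Those with a derivative, of the form `∑ n a(n) b(n) |y n|²` with `a, b` of size `1/⟨n⟩`, need not
converge absolutely as `N` grows. They have mean zero because `c` and the sets `Q_i` are even, and
their variance is bounded (`integral_pairing_sq_le`). -/

theorem volume_add_volume_le_of_isCompact {A B C : Set ℝ} (hA : IsCompact A) (hB : IsCompact B)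
    (hA0 : A.Nonempty) (hB0 : B.Nonempty) (h : ∀ a ∈ A, ∀ b ∈ B, (a + b) / 2 ∈ C) :
    volume A + volume B ≤ 2 * volume C := by
  obtain ⟨α, hα, hα'⟩ := hA.exists_isGreatest hA0
  obtain ⟨β, hβ, hβ'⟩ := hB.exists_isLeast hB0
  -- The translate of `A` by the least point of `B` and the translate of `B` by the greatest point
  -- of `A` meet at most in `α + β`, and both lie in `2C`.
  have hAB : volume ((fun a => a + β) '' A ∪ (fun b => b + α) '' B) = volume A + volume B := by
    have hB' : IsCompact ((fun b => b + α) '' B) := hB.image (by fun_prop)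
    rw [measure_union₀ hB'.measurableSet.nullMeasurableSet]
    · simp
    · refine measure_mono_null (t := {α + β}) ?_ (by simp)
      rintro x ⟨⟨a, ha, rfl⟩, ⟨b, hb, hx⟩⟩
      have h1 := hα' ha
      have h2 := hβ' hb
      simp only [Set.mem_singleton_iff] at *
      linarith
  rw [← hAB]
  have hsub : (fun a => a + β) '' A ∪ (fun b => b + α) '' B ⊆ (fun c : ℝ => (2 : ℝ) * c) '' C := by
    rintro x (⟨a, ha, rfl⟩ | ⟨b, hb, rfl⟩)
    · exact ⟨_, h a ha β hβ, by ring⟩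
    · exact ⟨_, h α hα b hb, by ring⟩
  refine (measure_mono hsub).trans ?_
  have := Measure.addHaar_image_homothety (volume : Measure ℝ) 0 2 C
  have e : ⇑(AffineMap.homothety (0 : ℝ) (2 : ℝ)) = fun c : ℝ => 2 * c := by
    ext c
    simp [AffineMap.homothety_apply]
  rw [e] at this
  rw [this]
  norm_num

theorem volume_add_volume_le {A B C : Set ℝ} (hA : MeasurableSet A) (hB : MeasurableSet B)
    (hA0 : A.Nonempty) (hB0 : B.Nonempty) (h : ∀ a ∈ A, ∀ b ∈ B, (a + b) / 2 ∈ C) :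
    volume A + volume B ≤ 2 * volume C := by
  obtain ⟨a₀, ha₀⟩ := hA0
  obtain ⟨b₀, hb₀⟩ := hB0
  rw [hA.measure_eq_iSup_isCompact, hB.measure_eq_iSup_isCompact]
  simp only [iSup_and']
  refine ENNReal.biSup_add_biSup_le' (p := fun K => K ⊆ A ∧ IsCompact K)
    (q := fun K => K ⊆ B ∧ IsCompact K) ⟨∅, by simp⟩ ⟨∅, by simp⟩ ?_
  rintro K ⟨hKA, hK⟩ K' ⟨hKB, hK'⟩
  -- The compact subsets may be empty, in which case there are no midpoints. Inserting one fixed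
  -- point of `A` and of `B` repairs this.
  refine le_trans (add_le_add (measure_mono (Set.subset_insert a₀ K))
    (measure_mono (Set.subset_insert b₀ K'))) ?_
  refine volume_add_volume_le_of_isCompact (hK.insert a₀) (hK'.insert b₀)
    (Set.insert_nonempty _ _) (Set.insert_nonempty _ _) ?_
  intro a ha b hb
  refine h a (Set.insert_subset ha₀ hKA ha) b (Set.insert_subset hb₀ hKB hb)

/-- The normalized case of the Prékopa–Leindler inequality: both suprema equal `1`. -/
theorem lintegral_add_lintegral_le {f g h : ℝ → ℝ} (hf : Measurable f) (hg : Measurable g)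
    (hh : Measurable h) (hf0 : ∀ x, 0 ≤ f x) (hg0 : ∀ x, 0 ≤ g x) (hh0 : ∀ x, 0 ≤ h x)
    (hf1 : ∀ x, f x ≤ 1) (hg1 : ∀ x, g x ≤ 1) (hfs : ∀ t < 1, ∃ x, t < f x)
    (hgs : ∀ t < 1, ∃ x, t < g x)
    (H : ∀ x y, f x * g y ≤ h ((x + y) / 2) ^ 2) :
    (∫⁻ x, ENNReal.ofReal (f x)) + ∫⁻ x, ENNReal.ofReal (g x)
      ≤ 2 * ∫⁻ x, ENNReal.ofReal (h x) := by
  -- Layer cake formula: for `t < 1` the superlevel sets of `f` and `g` are nonempty and their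
  -- midpoints lie in that of `h`; for `t ≥ 1` the superlevel sets of `f` and `g` are empty.
  rw [lintegral_eq_lintegral_meas_lt volume (.of_forall hf0) hf.aemeasurable,
    lintegral_eq_lintegral_meas_lt volume (.of_forall hg0) hg.aemeasurable,
    lintegral_eq_lintegral_meas_lt volume (.of_forall hh0) hh.aemeasurable,
    ← lintegral_const_mul' _ _ (by simp), ← lintegral_add_left]
  · refine setLIntegral_mono' measurableSet_Ioi ?_
    intro t ht
    have ht0 : (0 : ℝ) < t := ht
    by_cases ht1 : t < 1
    · refine volume_add_volume_le (measurableSet_lt measurable_const hf)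
        (measurableSet_lt measurable_const hg) (hfs t ht1) (hgs t ht1) ?_
      intro a ha b hb
      have ha' : t < f a := ha
      have hb' : t < g b := hb
      have h1 := H a b
      change t < h ((a + b) / 2)
      have h2 : t ^ 2 < h ((a + b) / 2) ^ 2 := by
        nlinarith
      exact lt_of_pow_lt_pow_left₀ 2 (hh0 _) h2
    · have e1 : {a | t < f a} = ∅ := by
        ext a; simp only [Set.mem_ofPred_eq, Set.mem_empty_iff_false, iff_false, not_lt]
        linarith [hf1 a]
      have e2 : {a | t < g a} = ∅ := by
        ext a; simp only [Set.mem_ofPred_eq, Set.mem_empty_iff_false, iff_false, not_lt]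
        linarith [hg1 a]
      rw [e1, e2]
      simp
  · refine Antitone.measurable ?_
    intro s t hst
    exact measure_mono fun x hx => lt_of_le_of_lt hst hx

/-- Dividing `f`, `g` by their suprema `F`, `G`, and `h` by `√(FG)`, preserves the hypothesis and
leads to the normalized case. The sum of integrals obtained there is turned into a product by the
arithmetic–geometric mean inequality. -/
theorem prekopa_leindler_bounded {f g h : ℝ → ℝ} (hf : Measurable f) (hg : Measurable g)
    (hh : Measurable h) (hf0 : ∀ x, 0 ≤ f x) (hg0 : ∀ x, 0 ≤ g x) (hh0 : ∀ x, 0 ≤ h x)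
    {b : ℝ} (hf1 : ∀ x, f x ≤ b) (hg1 : ∀ x, g x ≤ b)
    (H : ∀ x y, f x * g y ≤ h ((x + y) / 2) ^ 2) :
    (∫⁻ x, ENNReal.ofReal (f x)) * ∫⁻ x, ENNReal.ofReal (g x)
      ≤ (∫⁻ x, ENNReal.ofReal (h x)) ^ 2 := by
  have bf : BddAbove (Set.range f) := ⟨b, by rintro _ ⟨x, rfl⟩; exact hf1 x⟩
  have bg : BddAbove (Set.range g) := ⟨b, by rintro _ ⟨x, rfl⟩; exact hg1 x⟩
  set F := ⨆ x, f x with hF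
  set G := ⨆ x, g x with hG
  have hfF : ∀ x, f x ≤ F := fun x => le_ciSup bf x
  have hgG : ∀ x, g x ≤ G := fun x => le_ciSup bg x
  have hF0 : 0 ≤ F := (hf0 0).trans (hfF 0)
  have hG0 : 0 ≤ G := (hg0 0).trans (hgG 0)
  rcases hF0.eq_or_lt with hF1 | hF1
  · have : ∀ x, f x = 0 := fun x => le_antisymm (hF1 ▸ hfF x) (hf0 x)
    simp [this]
  rcases hG0.eq_or_lt with hG1 | hG1
  · have : ∀ x, g x = 0 := fun x => le_antisymm (hG1 ▸ hgG x) (hg0 x)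
    simp [this]
  set s := Real.sqrt (F * G) with hs
  have hs0 : 0 < s := Real.sqrt_pos.2 (mul_pos hF1 hG1)
  have hs2 : s ^ 2 = F * G := Real.sq_sqrt (mul_pos hF1 hG1).le
  have key := lintegral_add_lintegral_le (f := fun x => F⁻¹ * f x) (g := fun x => G⁻¹ * g x)
    (h := fun x => s⁻¹ * h x) (hf.const_mul _) (hg.const_mul _) (hh.const_mul _)
    (fun x => mul_nonneg (inv_nonneg.2 hF0) (hf0 x))
    (fun x => mul_nonneg (inv_nonneg.2 hG0) (hg0 x))
    (fun x => mul_nonneg (inv_nonneg.2 hs0.le) (hh0 x))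
    (fun x => by rw [inv_mul_le_iff₀ hF1]; simpa using hfF x)
    (fun x => by rw [inv_mul_le_iff₀ hG1]; simpa using hgG x)
    (fun t ht => by
      obtain ⟨x, hx⟩ := exists_lt_of_lt_ciSup (show F * t < ⨆ x, f x by rw [← hF]; nlinarith)
      exact ⟨x, by rwa [lt_inv_mul_iff₀ hF1]⟩)
    (fun t ht => by
      obtain ⟨x, hx⟩ := exists_lt_of_lt_ciSup (show G * t < ⨆ x, g x by rw [← hG]; nlinarith)
      exact ⟨x, by rwa [lt_inv_mul_iff₀ hG1]⟩)
    (fun x y => by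
      have := H x y
      rw [mul_pow, inv_pow, hs2]
      calc F⁻¹ * f x * (G⁻¹ * g y) = (F * G)⁻¹ * (f x * g y) := by rw [mul_inv]; ring
        _ ≤ _ := by gcongr)
  simp only [ENNReal.ofReal_mul (inv_nonneg.2 hF0), ENNReal.ofReal_mul (inv_nonneg.2 hG0),
    ENNReal.ofReal_mul (inv_nonneg.2 hs0.le)] at key
  rw [lintegral_const_mul' _ _ ENNReal.ofReal_ne_top, lintegral_const_mul' _ _ ENNReal.ofReal_ne_top,
    lintegral_const_mul' _ _ ENNReal.ofReal_ne_top] at key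
  generalize (∫⁻ x, ENNReal.ofReal (f x)) = a at key ⊢
  generalize (∫⁻ x, ENNReal.ofReal (g x)) = c at key ⊢
  generalize (∫⁻ x, ENNReal.ofReal (h x)) = d at key ⊢
  by_cases hd : d = ∞
  · rw [hd]; simp
  have hfin : 2 * (ENNReal.ofReal s⁻¹ * d) < ∞ := by
    refine ENNReal.mul_lt_top (by simp) (ENNReal.mul_lt_top (by simp) (lt_top_iff_ne_top.2 hd))
  have ha : a ≠ ∞ := by
    rintro rfl
    have h1 : ENNReal.ofReal F⁻¹ * ∞ = ∞ := ENNReal.mul_top (by simpa using hF1)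
    rw [h1, top_add] at key
    exact absurd key (not_le.2 hfin)
  have hc : c ≠ ∞ := by
    rintro rfl
    have h1 : ENNReal.ofReal G⁻¹ * ∞ = ∞ := ENNReal.mul_top (by simpa using hG1)
    rw [h1, add_top] at key
    exact absurd key (not_le.2 hfin)
  lift a to NNReal using ha
  lift c to NNReal using hc
  lift d to NNReal using hd
  have key' := ENNReal.toReal_mono hfin.ne key
  rw [ENNReal.toReal_add (ENNReal.mul_ne_top (by simp) (by simp))
    (ENNReal.mul_ne_top (by simp) (by simp))] at key'
  simp only [ENNReal.toReal_mul, ENNReal.toReal_ofReal (inv_nonneg.2 hF0),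
    ENNReal.toReal_ofReal (inv_nonneg.2 hG0), ENNReal.toReal_ofReal (inv_nonneg.2 hs0.le),
    ENNReal.coe_toReal, ENNReal.toReal_ofNat] at key'
  have : (a : ℝ) * c ≤ (d : ℝ) ^ 2 := by
    have h1 : (F⁻¹ * a) * (G⁻¹ * c) ≤ (s⁻¹ * d) ^ 2 := by
      have h2 : 0 ≤ F⁻¹ * a := by positivity
      have h3 : 0 ≤ G⁻¹ * c := by positivity
      have h4 : 0 ≤ s⁻¹ * d := by positivity
      nlinarith [sq_nonneg (F⁻¹ * a - G⁻¹ * c)]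
    rw [mul_pow, inv_pow, hs2] at h1
    have h5 : (F⁻¹ * a) * (G⁻¹ * c) = (F * G)⁻¹ * (a * c) := by rw [mul_inv]; ring
    rw [h5] at h1
    exact le_of_mul_le_mul_left h1 (by positivity)
  exact_mod_cast this

/-- The inequality `∫ u dμ · ∫ v dμ ≤ 1` for all `u, v` with `u x * v y ≤ c x y`. -/
def TransportBound {α : Type*} [MeasurableSpace α] (μ : Measure α) (c : α → α → ℝ≥0∞) : Prop :=
  ∀ u v : α → ℝ≥0∞, Measurable u → Measurable v → (∀ x y, u x * v y ≤ c x y) →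
    (∫⁻ x, u x ∂μ) * ∫⁻ y, v y ∂μ ≤ 1

/-- Homogeneity in `u`. In the tensorization, the cost of the frozen variables plays the role of
`K`. -/
theorem TransportBound.le {α : Type*} [MeasurableSpace α] {μ : Measure α} {c : α → α → ℝ≥0∞}
    (h : TransportBound μ c) {K : ℝ≥0∞} (hK0 : K ≠ 0) (hK : K ≠ ∞) {u v : α → ℝ≥0∞}
    (hu : Measurable u) (hv : Measurable v) (huv : ∀ x y, u x * v y ≤ K * c x y) :
    (∫⁻ x, u x ∂μ) * ∫⁻ y, v y ∂μ ≤ K := by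
  have h1 := h (fun x => K⁻¹ * u x) v (hu.const_mul _) hv (fun x y => by
    rw [mul_assoc]
    calc K⁻¹ * (u x * v y) ≤ K⁻¹ * (K * c x y) := mul_le_mul' le_rfl (huv x y)
      _ = c x y := by rw [← mul_assoc, ENNReal.inv_mul_cancel hK0 hK, one_mul])
  rw [lintegral_const_mul _ hu, mul_assoc] at h1
  calc (∫⁻ x, u x ∂μ) * ∫⁻ y, v y ∂μ
      = K * (K⁻¹ * ((∫⁻ x, u x ∂μ) * ∫⁻ y, v y ∂μ)) := by
        rw [← mul_assoc, ENNReal.mul_inv_cancel hK0 hK, one_mul]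
    _ ≤ K * 1 := by gcongr
    _ = K := mul_one K

/-- With the second variables `x₂`, `y₂` frozen, the bound for `μ` shows that the partial integrals
of `u` and `v` have product at most `d x₂ y₂`. The bound for `ν` then applies to these partial
integrals. -/
theorem TransportBound.prod {α β : Type*} [MeasurableSpace α] [MeasurableSpace β]
    {μ : Measure α} {ν : Measure β} [SFinite μ] [SFinite ν]
    {c : α → α → ℝ≥0∞} {d : β → β → ℝ≥0∞} (h : TransportBound μ c) (h' : TransportBound ν d)
    (hd0 : ∀ x y, d x y ≠ 0) (hd : ∀ x y, d x y ≠ ∞) :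
    TransportBound (μ.prod ν) fun x y => c x.1 y.1 * d x.2 y.2 := by
  intro u v hu hv huv
  rw [lintegral_prod_symm' _ hu, lintegral_prod_symm' _ hv]
  refine h' _ _ hu.lintegral_prod_left' hv.lintegral_prod_left' ?_
  intro x₂ y₂
  refine h.le (hd0 x₂ y₂) (hd x₂ y₂) (hu.comp (by fun_prop)) (hv.comp (by fun_prop)) ?_
  intro x y
  rw [mul_comm (d x₂ y₂)]
  exact huv (x, x₂) (y, y₂)

theorem TransportBound.map {α β : Type*} [MeasurableSpace α] [MeasurableSpace β]
    {μ : Measure α} {c : α → α → ℝ≥0∞} {d : β → β → ℝ≥0∞} (h : TransportBound μ c) {f : α → β}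
    (hf : Measurable f) (hcd : ∀ x y, d (f x) (f y) ≤ c x y) : TransportBound (μ.map f) d := by
  intro u v hu hv huv
  rw [lintegral_map hu hf, lintegral_map hv hf]
  exact h _ _ (hu.comp hf) (hv.comp hf) fun x y => (huv _ _).trans (hcd x y)

/-- The density is a multiple of `exp (-x²)`, and `x² + y² - (x - y)² / 2 = 2 ((x + y) / 2)²`. Hence
the densities multiplied by `u`, by `v` and by `1` satisfy the hypothesis of the Prékopa–Leindler
inequality. -/
theorem transportBound_gaussianReal :
    TransportBound (gaussianReal 0 (1 / 2))
      fun x y => ENNReal.ofReal (Real.exp ((x - y) ^ 2 / 2)) := by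
  intro u v hu hv huv
  have hφ : ∀ x, gaussianPDFReal 0 (1 / 2) x = (Real.sqrt π)⁻¹ * Real.exp (-x ^ 2) := by
    intro x
    rw [gaussianPDFReal]
    have : 2 * π * ((1 / 2 : NNReal) : ℝ) = π := by push_cast; ring
    rw [this]
    norm_num
  -- Truncation at height `k` supplies the boundedness that the Prékopa–Leindler inequality needs;
  -- monotone convergence removes it at the end.
  have trunc : ∀ k : ℕ, (∫⁻ x, min (u x) k ∂(gaussianReal 0 (1 / 2)))
      * ∫⁻ x, min (v x) k ∂(gaussianReal 0 (1 / 2)) ≤ 1 := by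
    intro k
    have hne : ∀ a : ℝ≥0∞, min a k ≠ ∞ := fun a =>
      (lt_of_le_of_lt (min_le_right _ _) (ENNReal.natCast_lt_top k)).ne
    have conv : ∀ w : ℝ → ℝ≥0∞, Measurable w → ∫⁻ x, min (w x) k ∂(gaussianReal 0 (1 / 2))
        = ∫⁻ x, ENNReal.ofReal (gaussianPDFReal 0 (1 / 2) x * (min (w x) k).toReal) := by
      intro w hw
      rw [gaussianReal_of_var_ne_zero _ (by norm_num),
        lintegral_withDensity_eq_lintegral_mul _ (measurable_gaussianPDF _ _)
          (hw.min measurable_const)]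
      refine lintegral_congr fun x => ?_
      rw [ENNReal.ofReal_mul (gaussianPDFReal_nonneg _ _ _), ENNReal.ofReal_toReal (hne _)]
      rfl
    rw [conv u hu, conv v hv]
    have hle : ∀ (w : ℝ → ℝ≥0∞) x, gaussianPDFReal 0 (1 / 2) x * (min (w x) k).toReal
        ≤ (Real.sqrt π)⁻¹ * k := by
      intro w x
      rw [hφ]
      have h1 : (min (w x) k).toReal ≤ k := by
        have := ENNReal.toReal_mono (ENNReal.natCast_ne_top k) (min_le_right (w x) (k : ℝ≥0∞))
        simpa using this
      have h2 : Real.exp (-x ^ 2) ≤ 1 := Real.exp_le_one_iff.2 (by nlinarith [sq_nonneg x])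
      have h3 : 0 ≤ (Real.sqrt π)⁻¹ := by positivity
      have h4 : (0 : ℝ) ≤ (min (w x) k).toReal := ENNReal.toReal_nonneg
      calc (Real.sqrt π)⁻¹ * Real.exp (-x ^ 2) * (min (w x) k).toReal
          ≤ (Real.sqrt π)⁻¹ * 1 * k := by gcongr
        _ = _ := by ring
    have := prekopa_leindler_bounded
      (f := fun x => gaussianPDFReal 0 (1 / 2) x * (min (u x) k).toReal)
      (g := fun x => gaussianPDFReal 0 (1 / 2) x * (min (v x) k).toReal)
      (h := fun x => gaussianPDFReal 0 (1 / 2) x)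
      ((measurable_gaussianPDFReal _ _).mul (hu.min measurable_const).ennreal_toReal)
      ((measurable_gaussianPDFReal _ _).mul (hv.min measurable_const).ennreal_toReal)
      (measurable_gaussianPDFReal _ _)
      (fun x => mul_nonneg (gaussianPDFReal_nonneg _ _ _) ENNReal.toReal_nonneg)
      (fun x => mul_nonneg (gaussianPDFReal_nonneg _ _ _) ENNReal.toReal_nonneg)
      (fun x => gaussianPDFReal_nonneg _ _ _) (hle u) (hle v) ?_
    · rwa [lintegral_gaussianPDFReal_eq_one _ (by norm_num), one_pow] at this
    · intro x y
      have h1 : (min (u x) k).toReal * (min (v y) k).toReal ≤ Real.exp ((x - y) ^ 2 / 2) := by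
        rw [← ENNReal.toReal_mul]
        refine ENNReal.toReal_le_of_le_ofReal (Real.exp_pos _).le ?_
        exact (mul_le_mul' (min_le_left _ _) (min_le_left _ _)).trans (huv x y)
      simp only [hφ]
      have h2 : Real.exp (-x ^ 2) * Real.exp (-y ^ 2) * Real.exp ((x - y) ^ 2 / 2)
          = Real.exp (-((x + y) / 2) ^ 2) ^ 2 := by
        rw [← Real.exp_add, ← Real.exp_add, ← Real.exp_nat_mul]
        congr 1
        push_cast
        ring
      calc (Real.sqrt π)⁻¹ * Real.exp (-x ^ 2) * (min (u x) k).toReal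
            * ((Real.sqrt π)⁻¹ * Real.exp (-y ^ 2) * (min (v y) k).toReal)
          = (Real.sqrt π)⁻¹ ^ 2 * (Real.exp (-x ^ 2) * Real.exp (-y ^ 2)
            * ((min (u x) k).toReal * (min (v y) k).toReal)) := by ring
        _ ≤ (Real.sqrt π)⁻¹ ^ 2 * (Real.exp (-x ^ 2) * Real.exp (-y ^ 2)
            * Real.exp ((x - y) ^ 2 / 2)) := by gcongr
        _ = _ := by rw [h2, mul_pow]
  have mono : ∀ w : ℝ → ℝ≥0∞, Measurable w → ∫⁻ x, w x ∂(gaussianReal 0 (1 / 2))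
      = ⨆ k : ℕ, ∫⁻ x, min (w x) k ∂(gaussianReal 0 (1 / 2)) := by
    intro w hw
    rw [← lintegral_iSup (fun k => hw.min measurable_const)]
    · refine lintegral_congr fun x => ?_
      rw [← inf_iSup_eq, ENNReal.iSup_natCast, inf_top_eq]
    · intro i j hij x
      exact min_le_min le_rfl (by exact_mod_cast hij)
  rw [mono u hu, mono v hv]
  rw [ENNReal.iSup_mul]
  refine iSup_le fun i => ?_
  rw [ENNReal.mul_iSup]
  refine iSup_le fun j => le_trans ?_ (trunc (max i j))
  gcongr
  · exact le_max_left i j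
  · exact le_max_right i j

theorem transportBound_stdComplexGaussian :
    TransportBound stdComplexGaussian fun x y => ENNReal.ofReal (Real.exp (‖x - y‖ ^ 2 / 2)) := by
  refine (transportBound_gaussianReal.prod transportBound_gaussianReal (fun x y => ?_)
    (fun x y => by simp)).map ?_ ?_
  · simp only [ne_eq, ENNReal.ofReal_eq_zero, not_le]
    positivity
  · exact Complex.measurableEquivRealProd.symm.measurable
  · intro x y
    rw [← ENNReal.ofReal_mul (Real.exp_pos _).le, ← Real.exp_add]
    refine le_of_eq ?_
    congr 2
    rw [Complex.sq_norm, Complex.normSq_apply]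
    simp
    ring

instance : IsProbabilityMeasure stdComplexGaussian := by
  unfold stdComplexGaussian
  exact Measure.isProbabilityMeasure_map Complex.measurableEquivRealProd.symm.measurable.aemeasurable

theorem transportBound_pi_fin (n : ℕ) :
    TransportBound (Measure.pi fun _ : Fin n => stdComplexGaussian)
      fun x y => ENNReal.ofReal (Real.exp ((∑ i, ‖x i - y i‖ ^ 2) / 2)) := by
  induction n with
  | zero =>
    intro u v hu hv huv
    rw [lintegral_unique, lintegral_unique, measure_univ, mul_one, mul_one]
    calc _ ≤ _ := huv _ _
      _ = 1 := by simp
  | succ n ih =>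
    have h1 := transportBound_stdComplexGaussian.prod ih (fun x y => by
      simp only [ne_eq, ENNReal.ofReal_eq_zero, not_le]
      positivity) (fun x y => by simp)
    have h2 := (measurePreserving_piFinSuccAbove (fun _ : Fin (n + 1) => stdComplexGaussian) 0).symm
    rw [← h2.map_eq]
    refine h1.map h2.measurable ?_
    intro x y
    rw [← ENNReal.ofReal_mul (Real.exp_pos _).le, ← Real.exp_add]
    refine le_of_eq ?_
    congr 2
    rw [Fin.sum_univ_succ]
    simp [MeasurableEquiv.piFinSuccAbove, add_div]

theorem transportBound_pi {ι : Type*} [Fintype ι] :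
    TransportBound (Measure.pi fun _ : ι => stdComplexGaussian)
      fun x y => ENNReal.ofReal (Real.exp ((∑ i, ‖x i - y i‖ ^ 2) / 2)) := by
  have e := (Fintype.equivFin ι).symm
  have h := measurePreserving_piCongrLeft (fun _ : ι => stdComplexGaussian) e
  rw [← h.map_eq]
  refine (transportBound_pi_fin _).map h.measurable ?_
  intro x y
  refine le_of_eq ?_
  congr 3
  rw [← e.sum_comp]
  simp [MeasurableEquiv.coe_piCongrLeft, Equiv.piCongrLeft_apply_apply]

end DNLS

namespace DNLS

/-! ### Second moments of Gaussian chaoses without resonances -/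

theorem memLp_stdComplexGaussian (p : ℝ≥0∞) (hp : p ≠ ∞) : MemLp id p stdComplexGaussian := by
  have hm : Measurable fun z : ℝ × ℝ => (⟨z.1, z.2⟩ : ℂ) :=
    Complex.measurableEquivRealProd.symm.measurable
  unfold stdComplexGaussian
  rw [memLp_map_measure_iff aestronglyMeasurable_id hm.aemeasurable]
  have h1 : MemLp (fun z : ℝ × ℝ => ((z.1 : ℝ) : ℂ)) p
      ((gaussianReal 0 (1 / 2)).prod (gaussianReal 0 (1 / 2))) :=
    ((memLp_id_gaussianReal' p hp).ofReal (K := ℂ)).comp_fst _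
  have h2 : MemLp (fun z : ℝ × ℝ => ((z.2 : ℝ) : ℂ)) p
      ((gaussianReal 0 (1 / 2)).prod (gaussianReal 0 (1 / 2))) :=
    ((memLp_id_gaussianReal' p hp).ofReal (K := ℂ)).comp_snd _
  convert! h1.add (h2.const_mul Complex.I) using 1
  ext z
  simp [Complex.ext_iff]

theorem integrable_norm_pow (k : ℕ) :
    Integrable (fun z : ℂ => ‖z‖ ^ k) stdComplexGaussian := by
  rcases Nat.eq_zero_or_pos k with rfl | hk
  · simp
  · exact (memLp_stdComplexGaussian k (by simp)).integrable_norm_pow hk.ne'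

theorem charFun_stdComplexGaussian (t : ℂ) :
    charFun stdComplexGaussian t = Complex.exp (-(‖t‖ ^ 2 : ℝ) / 4) := by
  have hm : Measurable fun z : ℝ × ℝ => (⟨z.1, z.2⟩ : ℂ) :=
    Complex.measurableEquivRealProd.symm.measurable
  have h1 : charFun stdComplexGaussian t = charFun (gaussianReal 0 (1 / 2)) t.re
      * charFun (gaussianReal 0 (1 / 2)) t.im := by
    rw [charFun_apply, charFun_apply, charFun_apply, ← integral_prod_mul]
    unfold stdComplexGaussian
    rw [integral_map hm.aemeasurable (by fun_prop)]
    refine integral_congr_ae (.of_forall fun z => ?_)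
    simp only
    rw [← Complex.exp_add]
    congr 1
    rw [Complex.inner]
    simp
    ring
  rw [h1, charFun_gaussianReal, charFun_gaussianReal, ← Complex.exp_add, Complex.sq_norm,
    Complex.normSq_apply]
  congr 1
  push_cast
  ring

/-- The characteristic function depends only on `‖t‖`. This invariance under rotations is the source
of the orthogonality of monomials. -/
theorem stdComplexGaussian_map_mul {ζ : ℂ} (hζ : ‖ζ‖ = 1) :
    stdComplexGaussian.map (fun z => ζ * z) = stdComplexGaussian := by
  have : IsProbabilityMeasure (stdComplexGaussian.map (fun z => ζ * z)) :=
    Measure.isProbabilityMeasure_map (by fun_prop)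
  refine Measure.ext_of_charFun (funext fun t => ?_)
  have h1 : charFun (stdComplexGaussian.map (fun z => ζ * z)) t
      = charFun stdComplexGaussian (starRingEnd ℂ ζ * t) := by
    rw [charFun_apply, charFun_apply, integral_map (by fun_prop) (by fun_prop)]
    refine integral_congr_ae (.of_forall fun z => ?_)
    simp only [Complex.inner, map_mul]
    congr 3
    simp
    ring
  rw [h1, charFun_stdComplexGaussian, charFun_stdComplexGaussian]
  simp [hζ]

/-- The product of the standard complex Gaussian laws. -/
noncomputable abbrev gaussianPi (ι : Type*) [Fintype ι] : Measure (ι → ℂ) :=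
  Measure.pi fun _ : ι => stdComplexGaussian

section Chaos

variable {ι : Type*} {d : ℕ}

theorem measurePreserving_rotate [Fintype ι] {ζ : ι → ℂ} (hζ : ∀ i, ‖ζ i‖ = 1) :
    MeasurePreserving (fun (x : ι → ℂ) i => ζ i * x i) (gaussianPi ι) (gaussianPi ι) :=
  measurePreserving_pi _ _ fun i =>
    ⟨by fun_prop, stdComplexGaussian_map_mul (hζ i)⟩

theorem integrable_eval_norm_pow [Fintype ι] (i : ι) (k : ℕ) :
    Integrable (fun x : ι → ℂ => ‖x i‖ ^ k) (gaussianPi ι) :=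
  (measurePreserving_eval (fun _ : ι => stdComplexGaussian) i).integrable_comp_of_integrable
    (integrable_norm_pow k)

theorem integral_eval_norm_pow [Fintype ι] (i : ι) (k : ℕ) :
    ∫ x : ι → ℂ, ‖x i‖ ^ k ∂(gaussianPi ι) = ∫ z, ‖z‖ ^ k ∂stdComplexGaussian := by
  have h := measurePreserving_eval (fun _ : ι => stdComplexGaussian) i
  rw [← h.map_eq, integral_map h.measurable.aemeasurable (by fun_prop)]

/-- `z` or its conjugate. -/
def conjIf (b : Bool) (z : ℂ) : ℂ := if b then z else starRingEnd ℂ z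

theorem norm_conjIf (b : Bool) (z : ℂ) : ‖conjIf b z‖ = ‖z‖ := by
  cases b <;> simp [conjIf]

theorem measurable_conjIf (b : Bool) : Measurable (conjIf b) := by
  cases b
  · exact Complex.continuous_conj.measurable
  · exact measurable_id

/-- The monomial `∏ⱼ x_{n j}`, with conjugates at the places `j` where `σ j` is false. -/
def monomial (σ : Fin d → Bool) (n : Fin d → ι) (x : ι → ℂ) : ℂ :=
  ∏ j, conjIf (σ j) (x (n j))

/-- The charge of a monomial at the frequency `m`. -/
def charge [DecidableEq ι] (σ : Fin d → Bool) (n : Fin d → ι) (m : ι) : ℤ :=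
  ∑ j, if n j = m then (if σ j then 1 else -1) else 0

theorem measurable_monomial (σ : Fin d → Bool) (n : Fin d → ι) : Measurable (monomial σ n) := by
  unfold monomial
  exact Finset.measurable_prod _ fun j _ => (measurable_conjIf _).comp (measurable_pi_apply _)

theorem monomial_rotate [DecidableEq ι] (σ : Fin d → Bool) (n : Fin d → ι) (m : ι) (θ : ℝ) (x : ι → ℂ) :
    monomial σ n (fun i => (if i = m then Complex.exp (θ * Complex.I) else 1) * x i)
      = Complex.exp (charge σ n m * (θ * Complex.I)) * monomial σ n x := by
  unfold monomial charge
  push_cast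
  rw [Finset.sum_mul, Complex.exp_sum, ← Finset.prod_mul_distrib]
  refine Finset.prod_congr rfl fun j _ => ?_
  by_cases h : n j = m
  · cases hσ : σ j
    · simp [h, conjIf, ← Complex.exp_conj]
    · simp [h, conjIf]
  · simp [h]

theorem prod_le_sum_pow (hd : d ≠ 0) (r : Fin d → ℝ) (hr : ∀ j, 0 ≤ r j) :
    ∏ j, r j ≤ ∑ j, r j ^ d := by
  have : Nonempty (Fin d) := ⟨⟨0, Nat.pos_of_ne_zero hd⟩⟩
  obtain ⟨i, hi⟩ := Finite.exists_max r
  calc ∏ j, r j ≤ ∏ _j : Fin d, r i := Finset.prod_le_prod (fun j _ => hr j) fun j _ => hi j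
    _ = r i ^ d := by simp
    _ ≤ ∑ j, r j ^ d :=
      Finset.single_le_sum (f := fun j => r j ^ d) (fun j _ => pow_nonneg (hr j) d)
        (Finset.mem_univ i)

/-- Bounding the product by the power of its largest factor leaves moments of single coordinates, so
the second moment of a monomial is bounded no matter which frequencies coincide. -/
theorem norm_monomial_sq_le (hd : d ≠ 0) (σ : Fin d → Bool) (n : Fin d → ι) (x : ι → ℂ) :
    ‖monomial σ n x‖ ^ 2 ≤ ∑ j, ‖x (n j)‖ ^ (2 * d) := by
  unfold monomial
  rw [norm_prod, ← Finset.prod_pow]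
  refine (prod_le_sum_pow hd _ fun j => by positivity).trans (le_of_eq ?_)
  simp [norm_conjIf, pow_mul]

theorem integrable_norm_monomial_sq [Fintype ι] (hd : d ≠ 0) (σ : Fin d → Bool) (n : Fin d → ι) :
    Integrable (fun x => ‖monomial σ n x‖ ^ 2) (gaussianPi ι) := by
  refine Integrable.mono' (integrable_finsetSum Finset.univ
    fun j _ => integrable_eval_norm_pow (n j) (2 * d)) ?_ (.of_forall fun x => ?_)
  · exact ((measurable_monomial σ n).norm.pow_const 2).aestronglyMeasurable
  · rw [Real.norm_of_nonneg (by positivity)]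
    exact norm_monomial_sq_le hd σ n x

/-- A bound for the second moment of a monomial of degree `d`. -/
noncomputable def monomialConst (d : ℕ) : ℝ := d * ∫ z, ‖z‖ ^ (2 * d) ∂stdComplexGaussian

theorem monomialConst_nonneg (d : ℕ) : 0 ≤ monomialConst d :=
  mul_nonneg (by positivity) (integral_nonneg fun z => by positivity)

theorem integral_norm_monomial_sq_le [Fintype ι] (hd : d ≠ 0) (σ : Fin d → Bool) (n : Fin d → ι) :
    ∫ x, ‖monomial σ n x‖ ^ 2 ∂(gaussianPi ι) ≤ monomialConst d := by
  calc ∫ x, ‖monomial σ n x‖ ^ 2 ∂(gaussianPi ι)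
      ≤ ∫ x, ∑ j, ‖x (n j)‖ ^ (2 * d) ∂(gaussianPi ι) :=
        integral_mono (integrable_norm_monomial_sq hd σ n)
          (integrable_finsetSum _ fun j _ => integrable_eval_norm_pow (n j) (2 * d))
          fun x => norm_monomial_sq_le hd σ n x
    _ = monomialConst d := by
        rw [integral_finsetSum _ fun j _ => integrable_eval_norm_pow (n j) (2 * d)]
        simp [integral_eval_norm_pow, monomialConst]

theorem integrable_monomial_mul [Fintype ι] (hd : d ≠ 0) (σ : Fin d → Bool) (n n' : Fin d → ι) :
    Integrable (fun x => monomial σ n x * starRingEnd ℂ (monomial σ n' x)) (gaussianPi ι) := by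
  refine Integrable.mono' ((integrable_norm_monomial_sq hd σ n).add
    (integrable_norm_monomial_sq hd σ n')) ?_ (.of_forall fun x => ?_)
  · exact ((measurable_monomial σ n).mul
      (Complex.continuous_conj.measurable.comp (measurable_monomial σ n'))).aestronglyMeasurable
  · simp only [norm_mul, RCLike.norm_conj, Pi.add_apply]
    nlinarith [sq_nonneg (‖monomial σ n x‖ - ‖monomial σ n' x‖), norm_nonneg (monomial σ n x),
      norm_nonneg (monomial σ n' x)]

theorem norm_integral_monomial_mul_le [Fintype ι] (hd : d ≠ 0) (σ : Fin d → Bool) (n n' : Fin d → ι) :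
    ‖∫ x, monomial σ n x * starRingEnd ℂ (monomial σ n' x) ∂(gaussianPi ι)‖
      ≤ monomialConst d := by
  have h1 := integrable_norm_monomial_sq hd σ n
  have h2 := integrable_norm_monomial_sq hd σ n'
  calc _ ≤ ∫ x, ‖monomial σ n x * starRingEnd ℂ (monomial σ n' x)‖ ∂(gaussianPi ι) :=
        norm_integral_le_integral_norm _
    _ ≤ ∫ x, (‖monomial σ n x‖ ^ 2 + ‖monomial σ n' x‖ ^ 2) / 2 ∂(gaussianPi ι) := by
        refine integral_mono (integrable_monomial_mul hd σ n n').norm ((h1.add h2).div_const 2) ?_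
        intro x
        simp only [norm_mul, RCLike.norm_conj]
        nlinarith [sq_nonneg (‖monomial σ n x‖ - ‖monomial σ n' x‖)]
    _ ≤ monomialConst d := by
        rw [integral_div, integral_add h1 h2]
        linarith [integral_norm_monomial_sq_le hd σ n, integral_norm_monomial_sq_le hd σ n']

/-- Rotating the coordinate `m` by the angle `π` over the difference of the charges preserves the
measure and changes the sign of the integrand. -/
theorem integral_monomial_mul_eq_zero [Fintype ι] [DecidableEq ι] (σ : Fin d → Bool) (n n' : Fin d → ι) (m : ι)
    (h : charge σ n m ≠ charge σ n' m) :
    ∫ x, monomial σ n x * starRingEnd ℂ (monomial σ n' x) ∂(gaussianPi ι) = 0 := by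
  have hne : ((charge σ n m : ℝ) - charge σ n' m) ≠ 0 := by
    rw [sub_ne_zero]; exact_mod_cast h
  set θ : ℝ := π / ((charge σ n m : ℝ) - charge σ n' m) with hθ
  have hr := measurePreserving_rotate (ι := ι)
    (ζ := fun i => if i = m then Complex.exp (θ * Complex.I) else 1) (fun i => by
      split_ifs
      · exact Complex.norm_exp_ofReal_mul_I θ
      · simp)
  have h1 : ∫ x, monomial σ n x * starRingEnd ℂ (monomial σ n' x) ∂(gaussianPi ι)
      = ∫ x, -(monomial σ n x * starRingEnd ℂ (monomial σ n' x)) ∂(gaussianPi ι) := by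
    conv_lhs => rw [← hr.map_eq]
    rw [integral_map hr.measurable.aemeasurable]
    · refine integral_congr_ae (.of_forall fun x => ?_)
      simp only [monomial_rotate, map_mul, ← Complex.exp_conj, Complex.conj_I, Complex.conj_ofReal,
        map_intCast]
      have : Complex.exp (charge σ n m * (θ * Complex.I))
          * Complex.exp (charge σ n' m * (θ * -Complex.I)) = -1 := by
        rw [← Complex.exp_add, ← Complex.exp_pi_mul_I]
        congr 1
        have e : ((charge σ n m : ℂ) - charge σ n' m) * θ = π := by
          rw [hθ]
          have : ((charge σ n m : ℂ) - charge σ n' m) ≠ 0 := by exact_mod_cast hne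
          push_cast
          field_simp
        rw [← e]
        ring
      linear_combination (monomial σ n x * starRingEnd ℂ (monomial σ n' x)) * this
    · exact ((measurable_monomial σ n).mul
        (Complex.continuous_conj.measurable.comp (measurable_monomial σ n'))).aestronglyMeasurable
  rw [integral_neg] at h1
  exact self_eq_neg.1 h1

/-- No frequency occurs in `n` both with and without conjugate. -/
def NonResonant (σ : Fin d → Bool) (n : Fin d → ι) : Prop :=
  ∀ i j, σ i = true → σ j = false → n i ≠ n j

/-- In the absence of resonances all occurrences of `m` carry the same sign, so nothing cancels in
the charge. -/
theorem natAbs_charge [DecidableEq ι] {σ : Fin d → Bool} {n : Fin d → ι} (h : NonResonant σ n) (m : ι) :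
    (charge σ n m).natAbs = Fintype.card {j // n j = m} := by
  rw [Fintype.card_subtype]
  by_cases hm : ∃ i, n i = m ∧ σ i = true
  · obtain ⟨i, hi, hσ⟩ := hm
    have : charge σ n m = ∑ j, if n j = m then 1 else 0 := by
      refine Finset.sum_congr rfl fun j _ => ?_
      by_cases hj : n j = m
      · cases hσj : σ j
        · exact absurd (hi.trans hj.symm) (h i j hσ hσj)
        · simp [hj]
      · simp [hj]
    rw [this]
    simp
  · have : charge σ n m = -∑ j, if n j = m then 1 else 0 := by
      unfold charge
      rw [← Finset.sum_neg_distrib]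
      refine Finset.sum_congr rfl fun j _ => ?_
      by_cases hj : n j = m
      · cases hσj : σ j
        · simp [hj]
        · exact absurd ⟨j, hj, hσj⟩ hm
      · simp [hj]
    rw [this]
    simp

/-- Equal charges give fibres of equal cardinality over every frequency; bijections between the
fibres are glued to a permutation. -/
theorem exists_perm_of_charge_eq [DecidableEq ι] {σ : Fin d → Bool} {n n' : Fin d → ι} (h : NonResonant σ n)
    (h' : NonResonant σ n') (hc : ∀ m, charge σ n m = charge σ n' m) :
    ∃ p : Equiv.Perm (Fin d), n' = n ∘ p := by
  have e : ∀ m, Nonempty ({j // n' j = m} ≃ {j // n j = m}) := fun m => by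
    rw [← Fintype.card_eq, ← natAbs_charge h, ← natAbs_charge h', hc]
  refine ⟨Equiv.ofFiberEquiv fun m => (e m).some, ?_⟩
  funext j
  exact (Equiv.ofFiberEquiv_map _ j).symm

/-- A bound for the second moment of a chaos of degree `d`. -/
noncomputable def chaosConst (d : ℕ) : ℝ := d.factorial * monomialConst d

theorem chaosConst_nonneg (d : ℕ) : 0 ≤ chaosConst d :=
  mul_nonneg (by positivity) (monomialConst_nonneg d)

theorem measurable_chaos {T : Type*} [Fintype T] (σ : Fin d → Bool) (n : T → Fin d → ι)
    (a : T → ℂ) : Measurable fun x => ∑ t, a t * monomial σ (n t) x :=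
  Finset.measurable_sum _ fun t _ => (measurable_monomial σ (n t)).const_mul (a t)

theorem integrable_norm_chaos_sq [Fintype ι] (hd : d ≠ 0) {T : Type*} [Fintype T] (σ : Fin d → Bool)
    (n : T → Fin d → ι) (a : T → ℂ) :
    Integrable (fun x => ‖∑ t, a t * monomial σ (n t) x‖ ^ 2) (gaussianPi ι) := by
  refine Integrable.mono' (g := fun x => (Fintype.card T : ℝ) *
    ∑ t, ‖a t‖ ^ 2 * ‖monomial σ (n t) x‖ ^ 2) ?_ ?_ (.of_forall fun x => ?_)
  · exact (integrable_finsetSum _ fun t _ =>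
      (integrable_norm_monomial_sq hd σ (n t)).const_mul _).const_mul _
  · exact ((measurable_chaos σ n a).norm.pow_const 2).aestronglyMeasurable
  · rw [Real.norm_of_nonneg (by positivity)]
    calc ‖∑ t, a t * monomial σ (n t) x‖ ^ 2 ≤ (∑ t, ‖a t * monomial σ (n t) x‖) ^ 2 := by
          gcongr; exact norm_sum_le _ _
      _ ≤ (Fintype.card T : ℝ) * ∑ t, ‖a t * monomial σ (n t) x‖ ^ 2 := by
          have := sq_sum_le_card_mul_sum_sq (s := (Finset.univ : Finset T))
            (f := fun t => ‖a t * monomial σ (n t) x‖)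
          simpa using this
      _ = _ := by simp [mul_pow]

/-- In the expanded square only pairs with `n t' = n t ∘ p` for some permutation `p` survive. For
each of the `d!` permutations, injectivity of `n` makes this relation a partial bijection between
`t` and `t'`, and `2 |a t| |a t'| ≤ |a t|² + |a t'|²` finishes. -/
theorem integral_norm_chaos_sq_le [Fintype ι] (hd : d ≠ 0) {T : Type*} [Fintype T] (σ : Fin d → Bool)
    (n : T → Fin d → ι) (hn : Function.Injective n) (a : T → ℂ)
    (ha : ∀ t, a t ≠ 0 → NonResonant σ (n t)) :
    ∫ x, ‖∑ t, a t * monomial σ (n t) x‖ ^ 2 ∂(gaussianPi ι)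
      ≤ chaosConst d * ∑ t, ‖a t‖ ^ 2 := by
  classical
  set I : T → T → ℂ := fun t t' =>
    ∫ x, monomial σ (n t) x * starRingEnd ℂ (monomial σ (n t') x) ∂(gaussianPi ι) with hI
  have expand : ((∫ x, ‖∑ t, a t * monomial σ (n t) x‖ ^ 2 ∂(gaussianPi ι) : ℝ) : ℂ)
      = ∑ t, ∑ t', a t * starRingEnd ℂ (a t') * I t t' := by
    rw [← integral_complex_ofReal]
    have : ∀ x, ((‖∑ t, a t * monomial σ (n t) x‖ ^ 2 : ℝ) : ℂ)
        = ∑ t, ∑ t', a t * starRingEnd ℂ (a t')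
          * (monomial σ (n t) x * starRingEnd ℂ (monomial σ (n t') x)) := by
      intro x
      rw [Complex.ofReal_pow, ← Complex.mul_conj', map_sum, Finset.sum_mul_sum]
      refine Finset.sum_congr rfl fun t _ => Finset.sum_congr rfl fun t' _ => ?_
      rw [map_mul]
      ring
    simp_rw [this]
    rw [integral_finsetSum _ fun t _ => integrable_finsetSum _ fun t' _ =>
      (integrable_monomial_mul hd σ (n t) (n t')).const_mul _]
    refine Finset.sum_congr rfl fun t _ => ?_
    rw [integral_finsetSum _ fun t' _ => (integrable_monomial_mul hd σ (n t) (n t')).const_mul _]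
    refine Finset.sum_congr rfl fun t' _ => ?_
    rw [integral_const_mul]
  have term : ∀ t t', ‖a t * starRingEnd ℂ (a t') * I t t'‖
      ≤ ∑ p : Equiv.Perm (Fin d), if n t' = n t ∘ p then
        (‖a t‖ ^ 2 + ‖a t'‖ ^ 2) / 2 * monomialConst d else 0 := by
    intro t t'
    have hpos : ∀ p : Equiv.Perm (Fin d), 0 ≤ if n t' = n t ∘ p then
        (‖a t‖ ^ 2 + ‖a t'‖ ^ 2) / 2 * monomialConst d else 0 := fun p => by
      have := monomialConst_nonneg d
      split_ifs <;> positivity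
    by_cases h0 : a t = 0
    · rw [h0]; simp only [zero_mul, norm_zero]
      simpa [h0] using Finset.sum_nonneg fun p _ => hpos p
    by_cases h0' : a t' = 0
    · rw [h0']; simp only [map_zero, zero_mul, mul_zero, norm_zero]
      simpa [h0'] using Finset.sum_nonneg fun p _ => hpos p
    by_cases hc : ∀ m, charge σ (n t) m = charge σ (n t') m
    · obtain ⟨p, hp⟩ := exists_perm_of_charge_eq (ha t h0) (ha t' h0') hc
      refine le_trans ?_ (Finset.single_le_sum (fun p _ => hpos p) (Finset.mem_univ p))
      rw [if_pos hp, norm_mul, norm_mul, RCLike.norm_conj]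
      refine mul_le_mul ?_ (norm_integral_monomial_mul_le hd σ (n t) (n t')) (norm_nonneg _)
        (by positivity)
      nlinarith [sq_nonneg (‖a t‖ - ‖a t'‖)]
    · push Not at hc
      obtain ⟨m, hm⟩ := hc
      have : I t t' = 0 := integral_monomial_mul_eq_zero σ (n t) (n t') m hm
      rw [this]
      simpa using Finset.sum_nonneg fun p _ => hpos p
  have hle : ∫ x, ‖∑ t, a t * monomial σ (n t) x‖ ^ 2 ∂(gaussianPi ι)
      ≤ ∑ t, ∑ t', ‖a t * starRingEnd ℂ (a t') * I t t'‖ := by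
    have h0 : 0 ≤ ∫ x, ‖∑ t, a t * monomial σ (n t) x‖ ^ 2 ∂(gaussianPi ι) :=
      integral_nonneg fun x => by positivity
    rw [← Real.norm_of_nonneg h0, ← Complex.norm_real, expand]
    exact (norm_sum_le _ _).trans (Finset.sum_le_sum fun t _ => norm_sum_le _ _)
  have hB := monomialConst_nonneg d
  have left : ∀ p : Equiv.Perm (Fin d),
      ∑ t, ∑ t', (if n t' = n t ∘ p then ‖a t‖ ^ 2 else 0) ≤ ∑ t, ‖a t‖ ^ 2 := by
    intro p
    refine Finset.sum_le_sum fun t _ => ?_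
    rw [← Finset.sum_filter, Finset.sum_const, nsmul_eq_mul]
    have : (Finset.univ.filter fun t' => n t' = n t ∘ p).card ≤ 1 := by
      rw [Finset.card_le_one]
      intro b hb c hc
      simp only [Finset.mem_filter, Finset.mem_univ, true_and] at hb hc
      exact hn (hb.trans hc.symm)
    have h1 : ((Finset.univ.filter fun t' => n t' = n t ∘ p).card : ℝ) ≤ 1 := by
      exact_mod_cast this
    nlinarith [sq_nonneg ‖a t‖]
  have right : ∀ p : Equiv.Perm (Fin d),
      ∑ t, ∑ t', (if n t' = n t ∘ p then ‖a t'‖ ^ 2 else 0) ≤ ∑ t, ‖a t‖ ^ 2 := by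
    intro p
    rw [Finset.sum_comm]
    refine Finset.sum_le_sum fun t _ => ?_
    rw [← Finset.sum_filter, Finset.sum_const, nsmul_eq_mul]
    have : (Finset.univ.filter fun t' => n t = n t' ∘ p).card ≤ 1 := by
      rw [Finset.card_le_one]
      intro b hb c hc
      simp only [Finset.mem_filter, Finset.mem_univ, true_and] at hb hc
      refine hn (funext fun j => ?_)
      have := congrFun (hb.symm.trans hc) (p.symm j)
      simpa using this
    have h1 : ((Finset.univ.filter fun t' => n t = n t' ∘ p).card : ℝ) ≤ 1 := by
      exact_mod_cast this
    nlinarith [sq_nonneg ‖a t‖]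
  calc _ ≤ ∑ t, ∑ t', ‖a t * starRingEnd ℂ (a t') * I t t'‖ := hle
    _ ≤ ∑ t, ∑ t', ∑ p : Equiv.Perm (Fin d), (if n t' = n t ∘ p then
        (‖a t‖ ^ 2 + ‖a t'‖ ^ 2) / 2 * monomialConst d else 0) :=
      Finset.sum_le_sum fun t _ => Finset.sum_le_sum fun t' _ => term t t'
    _ = ∑ p : Equiv.Perm (Fin d), ∑ t, ∑ t', (if n t' = n t ∘ p then
        (‖a t‖ ^ 2 + ‖a t'‖ ^ 2) / 2 * monomialConst d else 0) := by
      rw [Finset.sum_comm]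
      rw [Finset.sum_comm]
      simp_rw [Finset.sum_comm (γ := Equiv.Perm (Fin d))]
    _ ≤ ∑ _p : Equiv.Perm (Fin d), monomialConst d * ∑ t, ‖a t‖ ^ 2 := by
      refine Finset.sum_le_sum fun p _ => ?_
      have e : ∑ t, ∑ t', (if n t' = n t ∘ p then
          (‖a t‖ ^ 2 + ‖a t'‖ ^ 2) / 2 * monomialConst d else 0)
          = monomialConst d / 2 * (∑ t, ∑ t', (if n t' = n t ∘ p then ‖a t‖ ^ 2 else 0)
            + ∑ t, ∑ t', (if n t' = n t ∘ p then ‖a t'‖ ^ 2 else 0)) := by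
        rw [← Finset.sum_add_distrib, Finset.mul_sum]
        refine Finset.sum_congr rfl fun t _ => ?_
        rw [← Finset.sum_add_distrib, Finset.mul_sum]
        refine Finset.sum_congr rfl fun t' _ => ?_
        split_ifs <;> ring
      rw [e]
      nlinarith [left p, right p]
    _ = chaosConst d * ∑ t, ‖a t‖ ^ 2 := by
      rw [Finset.sum_const, Finset.card_univ, Fintype.card_perm, Fintype.card_fin, nsmul_eq_mul,
        chaosConst]
      ring

end Chaos

end DNLS

namespace DNLS

/-! ### Sequences indexed by finitely many frequencies -/

/-- The frequencies `|n| ≤ N`. -/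
abbrev Freq (N : ℕ) : Type := ↥(Finset.Icc (-(N : ℤ)) N)

theorem Freq.abs_le {N : ℕ} (n : Freq N) : |(n : ℤ)| ≤ N := by
  have := Finset.mem_Icc.1 n.2
  exact _root_.abs_le.2 this

theorem bracket_pos (n : ℤ) : 0 < bracket n := one_pos.trans_le (one_le_bracket n)

theorem bracket_sq (n : ℤ) : bracket n ^ 2 = 1 + (n : ℝ) ^ 2 :=
  Real.sq_sqrt (by positivity)

theorem abs_le_bracket (n : ℤ) : |(n : ℝ)| ≤ bracket n :=
  Real.abs_le_sqrt (by linarith)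

theorem bracket_add_le (n m : ℤ) : bracket (n + m) ≤ bracket n + bracket m := by
  refine abs_le_of_sq_le_sq' ?_ (add_pos (bracket_pos n) (bracket_pos m)).le |>.2
  have h1 := abs_le_bracket n
  have h2 := abs_le_bracket m
  have h3 : (n : ℝ) * m ≤ bracket n * bracket m := by
    calc (n : ℝ) * m ≤ |(n : ℝ) * m| := le_abs_self _
      _ = |(n : ℝ)| * |(m : ℝ)| := abs_mul _ _
      _ ≤ _ := mul_le_mul h1 h2 (abs_nonneg _) (bracket_pos n).le
  have h4 := bracket_sq n
  have h5 := bracket_sq m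
  have h6 := bracket_sq (n + m)
  push_cast at h6
  nlinarith

theorem bracket_neg (n : ℤ) : bracket (-n) = bracket n := by
  simp [bracket]

theorem bracket_sub_le (n m : ℤ) : bracket (n - m) ≤ bracket n + bracket m := by
  rw [sub_eq_add_neg, ← bracket_neg m]
  exact bracket_add_le n (-m)

/-- The summable weight `⟨n⟩⁻²`. -/
noncomputable def invSq (n : ℤ) : ℝ := (bracket n ^ 2)⁻¹

theorem invSq_pos (n : ℤ) : 0 < invSq n := inv_pos.2 (pow_pos (bracket_pos n) 2)

theorem invSq_le_one (n : ℤ) : invSq n ≤ 1 :=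
  inv_le_one_of_one_le₀ (one_le_pow₀ (one_le_bracket n))

theorem sq_mul_invSq_le_one (n : ℤ) : (n : ℝ) ^ 2 * invSq n ≤ 1 := by
  unfold invSq
  rw [← div_eq_mul_inv, div_le_one (pow_pos (bracket_pos n) 2), bracket_sq]
  linarith

theorem summable_invSq : Summable invSq := by
  have h : Summable fun n : ℤ => 2 * (1 / (|(n : ℝ)|) ^ (2 : ℝ)) :=
    ((Real.summable_one_div_int_add_rpow 0 2).2 (by norm_num)).mul_left 2 |>.congr
      (fun n => by simp)
  refine (summable_of_hasFiniteSupport (f := fun n : ℤ => if n = 0 then (1 : ℝ) else 0)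
    (Set.Finite.subset (Set.finite_singleton 0) (fun n hn => by
      simp only [Function.mem_support, ne_eq, ite_eq_right_iff, one_ne_zero, imp_false,
        not_not] at hn
      simpa using hn))).add h |>.of_nonneg_of_le (fun n => (invSq_pos n).le) fun n => ?_
  by_cases hn : n = 0
  · subst hn
    simp [invSq, bracket]
  · have hpos : 0 < (n : ℝ) ^ 2 := by positivity
    simp only [hn, if_false, zero_add, Real.rpow_ofNat, sq_abs, invSq, bracket_sq]
    rw [← one_div, mul_one_div, div_le_div_iff₀ (by positivity) hpos]
    nlinarith

/-- The sum of the weights `⟨n⟩⁻²`. -/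
noncomputable def sumInvSq : ℝ := ∑' n : ℤ, invSq n

theorem sumInvSq_nonneg : 0 ≤ sumInvSq := tsum_nonneg fun n => (invSq_pos n).le

theorem sum_invSq_le {T : Type*} [Fintype T] {f : T → ℤ} (hf : Function.Injective f) :
    ∑ t, invSq (f t) ≤ sumInvSq := by
  classical
  rw [← Finset.sum_image (s := Finset.univ) (g := f) (f := invSq) (fun a _ b _ h => hf h)]
  exact summable_invSq.sum_le_tsum _ fun n _ => (invSq_pos n).le

/-- The `ℓ²` norm. -/
noncomputable def l2 {T : Type*} [Fintype T] (α : T → ℝ) : ℝ := Real.sqrt (∑ t, α t ^ 2)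

section Norms

variable {T T' : Type*} [Fintype T] [Fintype T']

theorem l2_nonneg (α : T → ℝ) : 0 ≤ l2 α := Real.sqrt_nonneg _

theorem l2_sq (α : T → ℝ) : l2 α ^ 2 = ∑ t, α t ^ 2 :=
  Real.sq_sqrt (Finset.sum_nonneg fun _ _ => sq_nonneg _)

theorem l2_mono {α β : T → ℝ} (h0 : ∀ t, 0 ≤ α t) (h : ∀ t, α t ≤ β t) : l2 α ≤ l2 β :=
  Real.sqrt_le_sqrt (Finset.sum_le_sum fun t _ => pow_le_pow_left₀ (h0 t) (h t) 2)

theorem l2_const_mul {c : ℝ} (hc : 0 ≤ c) (α : T → ℝ) : l2 (fun t => c * α t) = c * l2 α := by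
  unfold l2
  simp_rw [mul_pow]
  rw [← Finset.mul_sum, Real.sqrt_mul (sq_nonneg c), Real.sqrt_sq hc]

theorem l2_le {α : T → ℝ} {r : ℝ} (hr : 0 ≤ r) (h : ∑ t, α t ^ 2 ≤ r ^ 2) : l2 α ≤ r :=
  Real.sqrt_le_iff.2 ⟨hr, h⟩

theorem sum_mul_le_l2 (α β : T → ℝ) : ∑ t, α t * β t ≤ l2 α * l2 β :=
  Real.sum_mul_le_sqrt_mul_sqrt _ _ _

theorem l2_sub_le (u v : T → ℂ) :
    l2 (fun t => ‖u t - v t‖) ≤ l2 (fun t => ‖u t‖) + l2 fun t => ‖v t‖ := by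
  refine l2_le (add_nonneg (l2_nonneg _) (l2_nonneg _)) ?_
  rw [add_sq, l2_sq, l2_sq]
  have h := sum_mul_le_l2 (fun t => ‖u t‖) fun t => ‖v t‖
  calc ∑ t, ‖u t - v t‖ ^ 2 ≤ ∑ t, (‖u t‖ ^ 2 + 2 * (‖u t‖ * ‖v t‖) + ‖v t‖ ^ 2) := by
        refine Finset.sum_le_sum fun t _ => ?_
        have := norm_sub_le (u t) (v t)
        nlinarith [norm_nonneg (u t - v t), norm_nonneg (u t), norm_nonneg (v t)]
    _ = ∑ t, ‖u t‖ ^ 2 + 2 * (∑ t, ‖u t‖ * ‖v t‖) + ∑ t, ‖v t‖ ^ 2 := by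
        rw [Finset.sum_add_distrib, Finset.sum_add_distrib, ← Finset.mul_sum]
    _ ≤ _ := by nlinarith

/-- The Cauchy–Schwarz inequality along a partial injection. -/
theorem sum_rel_le (r : T → T' → Prop) [∀ i j, Decidable (r i j)]
    (h : ∀ i j j', r i j → r i j' → j = j') (h' : ∀ i i' j, r i j → r i' j → i = i')
    (α : T → ℝ) (β : T' → ℝ) :
    ∑ i, ∑ j, (if r i j then α i * β j else 0) ≤ l2 α * l2 β := by
  have e : ∑ i, ∑ j, (if r i j then α i * β j else 0)
      = ∑ p : T × T', (if r p.1 p.2 then α p.1 else 0) * (if r p.1 p.2 then β p.2 else 0) := by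
    rw [Fintype.sum_prod_type]
    refine Finset.sum_congr rfl fun i _ => Finset.sum_congr rfl fun j _ => ?_
    split_ifs <;> simp
  rw [e]
  refine (sum_mul_le_l2 _ _).trans (mul_le_mul ?_ ?_ (l2_nonneg _) (l2_nonneg _))
  · refine Real.sqrt_le_sqrt ?_
    rw [Fintype.sum_prod_type]
    refine Finset.sum_le_sum fun i _ => ?_
    by_cases hi : ∃ j, r i j
    · obtain ⟨j, hj⟩ := hi
      rw [Finset.sum_eq_single j]
      · simp [hj]
      · intro j' _ hj'
        simp only [ite_pow, ne_eq, OfNat.ofNat_ne_zero, not_false_eq_true, zero_pow,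
          ite_eq_right_iff]
        intro hr
        exact absurd (h i j' j hr hj) hj'
      · simp
    · push Not at hi
      simp [hi, sq_nonneg]
  · refine Real.sqrt_le_sqrt ?_
    rw [Fintype.sum_prod_type, Finset.sum_comm]
    refine Finset.sum_le_sum fun j _ => ?_
    by_cases hj : ∃ i, r i j
    · obtain ⟨i, hi⟩ := hj
      rw [Finset.sum_eq_single i]
      · simp [hi]
      · intro i' _ hi'
        simp only [ite_pow, ne_eq, OfNat.ofNat_ne_zero, not_false_eq_true, zero_pow,
          ite_eq_right_iff]
        intro hr
        exact absurd (h' i' i j hr hi) hi'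
      · simp
    · push Not at hj
      simp [hj, sq_nonneg]

/-- A sequence is tested in `ℓ²` along an injection of its indices. -/
theorem sum_mul_comp_le {K : Finset ℤ} (α : T → ℝ) (ν : ℤ → ℝ) {l : T → ℤ}
    (hl : Function.Injective l) (hK : ∀ t, l t ∈ K) :
    ∑ t, α t * ν (l t) ≤ l2 α * Real.sqrt (∑ k ∈ K, ν k ^ 2) := by
  classical
  refine (sum_mul_le_l2 _ _).trans (mul_le_mul_of_nonneg_left ?_ (l2_nonneg _))
  refine Real.sqrt_le_sqrt ?_
  rw [← Finset.sum_image (s := Finset.univ) (g := l) (f := fun k => ν k ^ 2)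
    (fun a _ b _ h => hl h)]
  refine Finset.sum_le_sum_of_subset_of_nonneg ?_ fun k _ _ => sq_nonneg _
  intro k hk
  obtain ⟨t, _, rfl⟩ := Finset.mem_image.1 hk
  exact hK t

/-- Young's inequality in dual form. -/
theorem sum_sum_mul_comp_le {K : Finset ℤ} (α : T → ℝ) (β : T' → ℝ) (hβ : ∀ t, 0 ≤ β t)
    (ν : ℤ → ℝ) {l : T → T' → ℤ} (hl : ∀ t', Function.Injective fun t => l t t')
    (hK : ∀ t t', l t t' ∈ K) :
    ∑ t, ∑ t', α t * β t' * ν (l t t')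
      ≤ l2 α * (∑ t', β t') * Real.sqrt (∑ k ∈ K, ν k ^ 2) := by
  rw [Finset.sum_comm]
  calc ∑ t', ∑ t, α t * β t' * ν (l t t') = ∑ t', β t' * ∑ t, α t * ν (l t t') := by
        refine Finset.sum_congr rfl fun t' _ => ?_
        rw [Finset.mul_sum]
        exact Finset.sum_congr rfl fun t _ => by ring
    _ ≤ ∑ t', β t' * (l2 α * Real.sqrt (∑ k ∈ K, ν k ^ 2)) :=
        Finset.sum_le_sum fun t' _ =>
          mul_le_mul_of_nonneg_left (sum_mul_comp_le α ν (hl t') fun t => hK t t') (hβ t')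
    _ = _ := by rw [← Finset.sum_mul]; ring

end Norms

/-! ### Quadrilinear sums over the hyperplane `n₁ + n₂ = n₃ + n₄` -/

section Quadrilinear

variable {N : ℕ}

/-- For fixed `n₃` and `n₄` the constraint is a partial bijection between `n₁` and `n₂`, to which
Cauchy–Schwarz applies. The two fixed frequencies are summed in `ℓ¹`. -/
theorem quad_sum_le_one_two {α β γ δ : Freq N → ℝ} (hγ : ∀ n, 0 ≤ γ n) (hδ : ∀ n, 0 ≤ δ n) :
    ∑ n₁ : Freq N, ∑ n₂ : Freq N, ∑ n₃ : Freq N, ∑ n₄ : Freq N,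
      (if (n₁ : ℤ) + n₂ = n₃ + n₄ then α n₁ * β n₂ * γ n₃ * δ n₄ else 0)
      ≤ l2 α * l2 β * (∑ n, γ n) * ∑ n, δ n := by
  have e : ∑ n₁ : Freq N, ∑ n₂ : Freq N, ∑ n₃ : Freq N, ∑ n₄ : Freq N,
      (if (n₁ : ℤ) + n₂ = n₃ + n₄ then α n₁ * β n₂ * γ n₃ * δ n₄ else 0)
      = ∑ n₃ : Freq N, ∑ n₄ : Freq N, γ n₃ * δ n₄ * ∑ n₁ : Freq N, ∑ n₂ : Freq N,
        (if (n₁ : ℤ) + n₂ = n₃ + n₄ then α n₁ * β n₂ else 0) := by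
    simp_rw [Finset.mul_sum]
    rw [Finset.sum_congr rfl fun n₁ _ => Finset.sum_comm, Finset.sum_comm]
    refine Finset.sum_congr rfl fun n₃ _ => ?_
    rw [Finset.sum_congr rfl fun n₁ _ => Finset.sum_comm, Finset.sum_comm]
    refine Finset.sum_congr rfl fun n₄ _ => Finset.sum_congr rfl fun n₁ _ =>
      Finset.sum_congr rfl fun n₂ _ => ?_
    split_ifs <;> ring
  rw [e, mul_assoc, Finset.sum_mul_sum, Finset.mul_sum]
  refine Finset.sum_le_sum fun n₃ _ => ?_
  rw [Finset.mul_sum]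
  refine Finset.sum_le_sum fun n₄ _ => ?_
  rw [mul_comm (l2 α * l2 β)]
  refine mul_le_mul_of_nonneg_left ?_ (mul_nonneg (hγ _) (hδ _))
  refine sum_rel_le (fun n₁ n₂ : Freq N => (n₁ : ℤ) + n₂ = n₃ + n₄) ?_ ?_ α β
  · intro i j j' h h'
    exact Subtype.ext (by omega)
  · intro i j j' h h'
    exact Subtype.ext (by omega)

theorem quad_sum_le_one_three {α β γ δ : Freq N → ℝ} (hβ : ∀ n, 0 ≤ β n) (hδ : ∀ n, 0 ≤ δ n) :
    ∑ n₁ : Freq N, ∑ n₂ : Freq N, ∑ n₃ : Freq N, ∑ n₄ : Freq N,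
      (if (n₁ : ℤ) + n₂ = n₃ + n₄ then α n₁ * β n₂ * γ n₃ * δ n₄ else 0)
      ≤ l2 α * l2 γ * (∑ n, β n) * ∑ n, δ n := by
  have e : ∑ n₁ : Freq N, ∑ n₂ : Freq N, ∑ n₃ : Freq N, ∑ n₄ : Freq N,
      (if (n₁ : ℤ) + n₂ = n₃ + n₄ then α n₁ * β n₂ * γ n₃ * δ n₄ else 0)
      = ∑ n₂ : Freq N, ∑ n₄ : Freq N, β n₂ * δ n₄ * ∑ n₁ : Freq N, ∑ n₃ : Freq N,
        (if (n₁ : ℤ) + n₂ = n₃ + n₄ then α n₁ * γ n₃ else 0) := by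
    simp_rw [Finset.mul_sum]
    rw [Finset.sum_comm]
    refine Finset.sum_congr rfl fun n₂ _ => ?_
    rw [Finset.sum_congr rfl fun n₁ _ => Finset.sum_comm, Finset.sum_comm]
    refine Finset.sum_congr rfl fun n₄ _ => Finset.sum_congr rfl fun n₁ _ =>
      Finset.sum_congr rfl fun n₃ _ => ?_
    split_ifs <;> ring
  rw [e, mul_assoc, Finset.sum_mul_sum, Finset.mul_sum]
  refine Finset.sum_le_sum fun n₂ _ => ?_
  rw [Finset.mul_sum]
  refine Finset.sum_le_sum fun n₄ _ => ?_
  rw [mul_comm (l2 α * l2 γ)]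
  refine mul_le_mul_of_nonneg_left ?_ (mul_nonneg (hβ _) (hδ _))
  refine sum_rel_le (fun n₁ n₃ : Freq N => (n₁ : ℤ) + n₂ = n₃ + n₄) ?_ ?_ α γ
  · intro i j j' h h'
    exact Subtype.ext (by omega)
  · intro i j j' h h'
    exact Subtype.ext (by omega)

end Quadrilinear

/-! ### The Carlson–Agmon inequality -/

/-- Since `2 (A² + j²) ≥ (A + j)²`, the terms are dominated by differences of `1/s` at the points `s
= A + j ± 1/2`, and the sum telescopes. -/
theorem sum_inv_sq_add_sq_le {A : ℝ} (hA : 1 ≤ A) (N : ℕ) :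
    ∑ n ∈ Finset.Icc (-(N : ℤ)) N, (A ^ 2 + (n : ℝ) ^ 2)⁻¹ ≤ 8 / A := by
  have step : ∀ j : ℕ, (A ^ 2 + (j : ℝ) ^ 2)⁻¹
      ≤ 2 * ((A + j - 1 / 2)⁻¹ - (A + j + 1 / 2)⁻¹) := by
    intro j
    have hj : (0 : ℝ) ≤ j := Nat.cast_nonneg j
    have h1 : 0 < A + j - 1 / 2 := by linarith
    have h2 : 0 < A + j + 1 / 2 := by linarith
    rw [inv_sub_inv h1.ne' h2.ne', ← one_div, mul_div_assoc', div_le_div_iff₀ (by positivity)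
      (by positivity)]
    nlinarith [sq_nonneg (A - j)]
  have key : ∑ n ∈ Finset.Icc (-(N : ℤ)) N, (A ^ 2 + (n : ℝ) ^ 2)⁻¹
      ≤ 4 * ((A - 1 / 2)⁻¹ - (A + N + 1 / 2)⁻¹) := by
    induction N with
    | zero =>
      have h := step 0
      have h0 : 0 ≤ (A ^ 2 + ((0 : ℕ) : ℝ) ^ 2)⁻¹ := by positivity
      simp only [Nat.cast_zero, neg_zero, Finset.Icc_self, Finset.sum_singleton, Int.cast_zero,
        add_zero] at h h0 ⊢
      linarith
    | succ N ih =>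
      have e : Finset.Icc (-((N + 1 : ℕ) : ℤ)) (N + 1 : ℕ)
          = insert (-((N + 1 : ℕ) : ℤ)) (insert ((N + 1 : ℕ) : ℤ) (Finset.Icc (-(N : ℤ)) N)) := by
        ext k
        simp only [Finset.mem_Icc, Finset.mem_insert]
        push_cast
        omega
      rw [e, Finset.sum_insert, Finset.sum_insert]
      · have h := step (N + 1)
        push_cast at h ⊢
        have h' : A + (N + 1) - 1 / 2 = A + N + 1 / 2 := by ring
        rw [h'] at h
        rw [neg_add_rev, show (-1 + -(N : ℝ)) ^ 2 = ((N : ℝ) + 1) ^ 2 by ring]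
        linarith
      · simp
      · simp only [Finset.mem_insert, Finset.mem_Icc]
        push_cast
        omega
  refine key.trans ?_
  have h1 : 0 < A + N + 1 / 2 := by positivity
  have h2 : (A - 1 / 2)⁻¹ ≤ 2 / A := by
    rw [← one_div, div_le_div_iff₀ (by linarith) (by linarith)]
    linarith
  have h3 : 0 < (A + N + 1 / 2)⁻¹ := inv_pos.2 h1
  have h4 : 8 / A = 4 * (2 / A) := by ring
  rw [h4]
  linarith

/-- Cauchy–Schwarz with the weight `A² + n²`. The choice `A = t / s` balances the two norms; `A ≥ 1`
because `⟨n⟩ ≥ 1`. -/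
theorem sum_sq_le_l2_mul_l2 {N : ℕ} (α : Freq N → ℝ) (hα : ∀ n, 0 ≤ α n) :
    (∑ n, α n) ^ 2 ≤ 16 * l2 α * l2 fun n : Freq N => bracket n * α n := by
  set s := l2 α with hs
  set t := l2 fun n : Freq N => bracket n * α n with ht
  have hst : s ≤ t := l2_mono hα fun n => le_mul_of_one_le_left (hα n) (one_le_bracket n)
  rcases (l2_nonneg α).eq_or_lt with h0 | h0
  · have h1 : ∑ n, α n ^ 2 = 0 := by rw [← l2_sq, ← h0]; simp
    have h2 : ∀ n, α n = 0 := fun n => by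
      have := (Finset.sum_eq_zero_iff_of_nonneg fun n _ => sq_nonneg (α n)).1 h1 n
        (Finset.mem_univ n)
      exact pow_eq_zero_iff (two_ne_zero) |>.1 this
    simp only [h2, Finset.sum_const_zero, ne_eq, OfNat.ofNat_ne_zero, not_false_eq_true, zero_pow]
    have := l2_nonneg fun n : Freq N => bracket n * α n
    positivity
  · rw [← hs] at h0
    set A := t / s with hA
    have hA1 : 1 ≤ A := (one_le_div h0).2 hst
    have hA0 : 0 < A := by linarith
    have ht0 : 0 < t := by linarith
    have h1 : (∑ n, α n) ^ 2 ≤ (∑ n : Freq N, (A ^ 2 + ((n : ℤ) : ℝ) ^ 2)⁻¹)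
        * ∑ n : Freq N, (A ^ 2 + ((n : ℤ) : ℝ) ^ 2) * α n ^ 2 := by
      refine Finset.sum_sq_le_sum_mul_sum_of_sq_le_mul _ (fun n _ => by positivity)
        (fun n _ => by positivity) fun n _ => ?_
      have : A ^ 2 + ((n : ℤ) : ℝ) ^ 2 ≠ 0 := by positivity
      field_simp
      exact le_rfl
    have h2 : ∑ n : Freq N, (A ^ 2 + ((n : ℤ) : ℝ) ^ 2)⁻¹ ≤ 8 / A := by
      rw [Finset.sum_coe_sort (Finset.Icc (-(N : ℤ)) N) fun n => (A ^ 2 + (n : ℝ) ^ 2)⁻¹]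
      exact sum_inv_sq_add_sq_le hA1 N
    have h3 : ∑ n : Freq N, (A ^ 2 + ((n : ℤ) : ℝ) ^ 2) * α n ^ 2 ≤ 2 * t ^ 2 := by
      have e : ∑ n : Freq N, (A ^ 2 + ((n : ℤ) : ℝ) ^ 2) * α n ^ 2
          ≤ A ^ 2 * s ^ 2 + t ^ 2 := by
        rw [hs, ht, l2_sq, l2_sq, Finset.mul_sum, ← Finset.sum_add_distrib]
        refine Finset.sum_le_sum fun n _ => ?_
        rw [mul_pow, bracket_sq]
        nlinarith [sq_nonneg (α n)]
      have e2 : A ^ 2 * s ^ 2 = t ^ 2 := by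
        rw [hA]; field_simp
      linarith
    calc (∑ n, α n) ^ 2 ≤ 8 / A * (2 * t ^ 2) :=
          h1.trans (mul_le_mul h2 h3 (Finset.sum_nonneg fun n _ => by positivity) (by positivity))
      _ = 16 * s * t := by rw [hA]; field_simp; norm_num

end DNLS

namespace DNLS

/-! ### Convolutions of Gaussian sequences -/

section ChaosNorm

variable {d N : ℕ} {T : Type*} [Fintype T]

open Classical in
/-- The part at the frequency `k` of a chaos without resonances. -/
noncomputable def chaosAt (σ : Fin d → Bool) (n : T → Fin d → Freq N) (κ : T → ℤ) (a : T → ℝ)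
    (y : Freq N → ℂ) (k : ℤ) : ℂ :=
  ∑ t, if κ t = k ∧ NonResonant σ (n t) then (a t : ℂ) * monomial σ (n t) y else 0

/-- The squared weighted `ℓ²` norm of a chaos without resonances. -/
noncomputable def chaosNorm (σ : Fin d → Bool) (n : T → Fin d → Freq N) (κ : T → ℤ) (a : T → ℝ)
    (ω : ℤ → ℝ) (K : Finset ℤ) (y : Freq N → ℂ) : ℝ :=
  ∑ k ∈ K, ω k * ‖chaosAt σ n κ a y k‖ ^ 2

theorem chaosAt_eq (σ : Fin d → Bool) (n : T → Fin d → Freq N) (κ : T → ℤ) (a : T → ℝ)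
    (k : ℤ) [DecidablePred fun t => κ t = k ∧ NonResonant σ (n t)] (y : Freq N → ℂ) :
    chaosAt σ n κ a y k
      = ∑ t, (if κ t = k ∧ NonResonant σ (n t) then (a t : ℂ) else 0) * monomial σ (n t) y := by
  refine Finset.sum_congr rfl fun t _ => ?_
  by_cases h : κ t = k ∧ NonResonant σ (n t) <;> simp [h]

theorem chaosNorm_nonneg {σ : Fin d → Bool} {n : T → Fin d → Freq N} {κ : T → ℤ} {a : T → ℝ}
    {ω : ℤ → ℝ} {K : Finset ℤ} (hω : ∀ k, 0 ≤ ω k) (y : Freq N → ℂ) :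
    0 ≤ chaosNorm σ n κ a ω K y :=
  Finset.sum_nonneg fun k _ => mul_nonneg (hω k) (sq_nonneg _)

theorem integrable_chaosNorm (hd : d ≠ 0) (σ : Fin d → Bool) (n : T → Fin d → Freq N) (κ : T → ℤ)
    (a : T → ℝ) (ω : ℤ → ℝ) (K : Finset ℤ) :
    Integrable (chaosNorm σ n κ a ω K) (gaussianPi (Freq N)) := by
  classical
  refine integrable_finsetSum _ fun k _ => Integrable.const_mul ?_ _
  simp_rw [chaosAt_eq]
  exact integrable_norm_chaos_sq hd σ n _

/-- The second moment bound is applied at each frequency `k` separately. An index `t` contributes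
only to `k = κ t`, so the double sum collapses. -/
theorem integral_chaosNorm_le (hd : d ≠ 0) (σ : Fin d → Bool) {n : T → Fin d → Freq N}
    (hn : Function.Injective n) (κ : T → ℤ) (a : T → ℝ) {ω : ℤ → ℝ} (hω : ∀ k, 0 ≤ ω k)
    (K : Finset ℤ) :
    ∫ y, chaosNorm σ n κ a ω K y ∂(gaussianPi (Freq N))
      ≤ chaosConst d * ∑ t, ω (κ t) * a t ^ 2 := by
  classical
  have hC := chaosConst_nonneg d
  have hint : ∀ k, Integrable (fun y : Freq N → ℂ => ω k * ‖chaosAt σ n κ a y k‖ ^ 2)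
      (gaussianPi (Freq N)) := fun k => by
    simp_rw [chaosAt_eq]
    exact (integrable_norm_chaos_sq hd σ n _).const_mul _
  unfold chaosNorm
  rw [integral_finsetSum _ fun k _ => hint k]
  calc ∑ k ∈ K, ∫ y, ω k * ‖chaosAt σ n κ a y k‖ ^ 2 ∂(gaussianPi (Freq N))
      ≤ ∑ k ∈ K, chaosConst d * ∑ t, if κ t = k then ω k * a t ^ 2 else 0 := by
        refine Finset.sum_le_sum fun k _ => ?_
        rw [integral_const_mul]
        simp_rw [chaosAt_eq]
        have h1 := integral_norm_chaos_sq_le hd σ n hn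
          (fun t => if κ t = k ∧ NonResonant σ (n t) then (a t : ℂ) else 0)
          (fun t ht => by
            by_contra h
            exact ht (if_neg fun h' => h h'.2))
        refine (mul_le_mul_of_nonneg_left h1 (hω k)).trans ?_
        rw [mul_left_comm, Finset.mul_sum]
        refine mul_le_mul_of_nonneg_left (Finset.sum_le_sum fun t _ => ?_) hC
        by_cases h1 : κ t = k
        · by_cases h2 : NonResonant σ (n t)
          · simp [h1, h2]
          · simpa [h1, h2] using mul_nonneg (hω k) (sq_nonneg (a t))
        · simp [h1]
    _ = chaosConst d * ∑ t, ∑ k ∈ K, if κ t = k then ω k * a t ^ 2 else 0 := by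
        rw [← Finset.mul_sum, Finset.sum_comm]
    _ ≤ chaosConst d * ∑ t, ω (κ t) * a t ^ 2 := by
        refine mul_le_mul_of_nonneg_left (Finset.sum_le_sum fun t _ => ?_) hC
        rw [Finset.sum_ite_eq]
        split_ifs
        · exact le_rfl
        · exact mul_nonneg (hω _) (sq_nonneg _)

end ChaosNorm

section Convolution

variable {N : ℕ}

/-- The convolution `∑_{n₁ + n₂ = k} a(n₁) b(n₂) y(n₁) y(n₂)`. -/
noncomputable def convPP (a b : Freq N → ℝ) (y : Freq N → ℂ) (k : ℤ) : ℂ :=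
  ∑ n₁ : Freq N, ∑ n₂ : Freq N, if (n₁ : ℤ) + n₂ = k then
    ((a n₁ * b n₂ : ℝ) : ℂ) * (y n₁ * y n₂) else 0

/-- The convolution `∑_{n₁ - n₂ = k} a(n₁) b(n₂) y(n₁) ȳ(n₂)`. -/
noncomputable def convPM (a b : Freq N → ℝ) (y : Freq N → ℂ) (k : ℤ) : ℂ :=
  ∑ n₁ : Freq N, ∑ n₂ : Freq N, if (n₁ : ℤ) - n₂ = k then
    ((a n₁ * b n₂ : ℝ) : ℂ) * (y n₁ * starRingEnd ℂ (y n₂)) else 0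

/-- The convolution `∑_{n₁ + n₂ - n₃ = k} a(n₁) b(n₂) c(n₃) y(n₁) y(n₂) ȳ(n₃)`. -/
noncomputable def convPPM (a b c : Freq N → ℝ) (y : Freq N → ℂ) (k : ℤ) : ℂ :=
  ∑ n₁ : Freq N, ∑ n₂ : Freq N, ∑ n₃ : Freq N, if (n₁ : ℤ) + n₂ - n₃ = k then
    ((a n₁ * b n₂ * c n₃ : ℝ) : ℂ) * (y n₁ * y n₂ * starRingEnd ℂ (y n₃)) else 0

/-- The quartic sum over `n₁ + n₂ = n₃ + n₄`. -/
noncomputable def convPPMM (a b c d : Freq N → ℝ) (y : Freq N → ℂ) : ℂ :=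
  ∑ n₁ : Freq N, ∑ n₂ : Freq N, ∑ n₃ : Freq N, ∑ n₄ : Freq N,
    if (n₁ : ℤ) + n₂ = n₃ + n₄ then ((a n₁ * b n₂ * c n₃ * d n₄ : ℝ) : ℂ)
      * (y n₁ * y n₂ * starRingEnd ℂ (y n₃) * starRingEnd ℂ (y n₄)) else 0

/-- The resonant sum `∑ a(n) b(n) |y(n)|²`. -/
noncomputable def pairing (a b : Freq N → ℝ) (y : Freq N → ℂ) : ℝ :=
  ∑ n, a n * b n * ‖y n‖ ^ 2

/-- The part of `convPP` without resonances (all of it). -/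
noncomputable def normPP (a b : Freq N → ℝ) (ω : ℤ → ℝ) (K : Finset ℤ) (y : Freq N → ℂ) : ℝ :=
  chaosNorm ![true, true] (fun t : Freq N × Freq N => ![t.1, t.2])
    (fun t => (t.1 : ℤ) + t.2) (fun t => a t.1 * b t.2) ω K y

/-- The part of `convPM` without resonances. -/
noncomputable def normPM (a b : Freq N → ℝ) (ω : ℤ → ℝ) (K : Finset ℤ) (y : Freq N → ℂ) : ℝ :=
  chaosNorm ![true, false] (fun t : Freq N × Freq N => ![t.1, t.2])
    (fun t => (t.1 : ℤ) - t.2) (fun t => a t.1 * b t.2) ω K y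

/-- The part of `convPPM` without resonances. -/
noncomputable def normPPM (a b c : Freq N → ℝ) (ω : ℤ → ℝ) (K : Finset ℤ) (y : Freq N → ℂ) : ℝ :=
  chaosNorm ![true, true, false] (fun t : Freq N × Freq N × Freq N => ![t.1, t.2.1, t.2.2])
    (fun t => (t.1 : ℤ) + t.2.1 - t.2.2) (fun t => a t.1 * b t.2.1 * c t.2.2) ω K y

/-- The part of `convPPMM` without resonances. -/
noncomputable def normPPMM (a b c d : Freq N → ℝ) (y : Freq N → ℂ) : ℝ :=
  chaosNorm ![true, true, false, false]
    (fun t : Freq N × Freq N × Freq N × Freq N => ![t.1, t.2.1, t.2.2.1, t.2.2.2])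
    (fun t => (t.1 : ℤ) + t.2.1 - t.2.2.1 - t.2.2.2)
    (fun t => a t.1 * b t.2.1 * c t.2.2.1 * d t.2.2.2) (fun k => if k = 0 then 1 else 0) {0} y

theorem nonResonant_PP (n : Fin 2 → Freq N) : NonResonant ![true, true] n := by
  intro i j _ hj
  fin_cases j <;> simp at hj

theorem nonResonant_PM (n₁ n₂ : Freq N) : NonResonant ![true, false] ![n₁, n₂] ↔ n₁ ≠ n₂ := by
  simp [NonResonant, Fin.forall_fin_two]

theorem nonResonant_PPM (n₁ n₂ n₃ : Freq N) :
    NonResonant ![true, true, false] ![n₁, n₂, n₃] ↔ n₁ ≠ n₃ ∧ n₂ ≠ n₃ := by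
  simp [NonResonant, Fin.forall_fin_succ]

theorem nonResonant_PPMM (n₁ n₂ n₃ n₄ : Freq N) :
    NonResonant ![true, true, false, false] ![n₁, n₂, n₃, n₄]
      ↔ (n₁ ≠ n₃ ∧ n₁ ≠ n₄) ∧ n₂ ≠ n₃ ∧ n₂ ≠ n₄ := by
  simp [NonResonant, Fin.forall_fin_succ]

theorem sum_norm_convPP (a b : Freq N → ℝ) (ω : ℤ → ℝ) (K : Finset ℤ) (y : Freq N → ℂ) :
    ∑ k ∈ K, ω k * ‖convPP a b y k‖ ^ 2 = normPP a b ω K y := by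
  refine Finset.sum_congr rfl fun k _ => ?_
  congr 3
  unfold convPP chaosAt
  rw [Fintype.sum_prod_type]
  refine Finset.sum_congr rfl fun n₁ _ => Finset.sum_congr rfl fun n₂ _ => ?_
  simp [nonResonant_PP, monomial, Fin.prod_univ_succ, conjIf]

/-- The only resonance is `n₁ = n₂`. It is concentrated at `k = 0`, where it contributes the
pairing. -/
theorem sum_norm_convPM_le (a b : Freq N → ℝ) {ω : ℤ → ℝ} (hω : ∀ k, 0 ≤ ω k) (K : Finset ℤ)
    (y : Freq N → ℂ) :
    ∑ k ∈ K, ω k * ‖convPM a b y k‖ ^ 2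
      ≤ 2 * normPM a b ω K y + 2 * (ω 0 * pairing a b y ^ 2) := by
  have e : ∀ k, convPM a b y k = chaosAt ![true, false]
      (fun t : Freq N × Freq N => ![t.1, t.2]) (fun t => (t.1 : ℤ) - t.2)
      (fun t => a t.1 * b t.2) y k + if k = 0 then (pairing a b y : ℂ) else 0 := by
    intro k
    have e2 : (if k = 0 then (pairing a b y : ℂ) else 0) = ∑ n₁ : Freq N, ∑ n₂ : Freq N,
        if n₁ = n₂ then (if (n₁ : ℤ) - n₂ = k then
          ((a n₁ * b n₂ : ℝ) : ℂ) * (y n₁ * starRingEnd ℂ (y n₂)) else 0) else 0 := by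
      simp only [Finset.sum_ite_eq, Finset.mem_univ, if_true, sub_self, Complex.mul_conj']
      by_cases hk : k = 0
      · subst hk
        simp [pairing]
      · simp [hk, Ne.symm hk]
    rw [e2]
    unfold convPM chaosAt
    rw [Fintype.sum_prod_type, ← Finset.sum_add_distrib]
    refine Finset.sum_congr rfl fun n₁ _ => ?_
    rw [← Finset.sum_add_distrib]
    refine Finset.sum_congr rfl fun n₂ _ => ?_
    simp only [nonResonant_PM]
    by_cases h : n₁ = n₂
    · simp [h]
    · simp [h, monomial, Fin.prod_univ_succ, conjIf]
  have h2 : ∑ k ∈ K, ω k * ‖(if k = 0 then (pairing a b y : ℂ) else 0)‖ ^ 2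
      ≤ ω 0 * pairing a b y ^ 2 := by
    calc ∑ k ∈ K, ω k * ‖(if k = 0 then (pairing a b y : ℂ) else 0)‖ ^ 2
        = ∑ k ∈ K, if k = 0 then ω 0 * pairing a b y ^ 2 else 0 := by
          refine Finset.sum_congr rfl fun k _ => ?_
          split_ifs with hk
          · simp [hk]
          · simp
      _ ≤ _ := by
          rw [Finset.sum_ite_eq']
          split_ifs
          · exact le_rfl
          · exact mul_nonneg (hω 0) (sq_nonneg _)
  refine le_trans ?_ (add_le_add le_rfl (mul_le_mul_of_nonneg_left h2 zero_le_two))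
  unfold normPM chaosNorm
  rw [Finset.mul_sum, Finset.mul_sum, ← Finset.sum_add_distrib]
  refine Finset.sum_le_sum fun k _ => ?_
  rw [e k]
  set u := chaosAt ![true, false] (fun t : Freq N × Freq N => ![t.1, t.2])
    (fun t => (t.1 : ℤ) - t.2) (fun t => a t.1 * b t.2) y k
  set v := if k = 0 then (pairing a b y : ℂ) else 0
  have h3 : ‖u + v‖ ^ 2 ≤ 2 * ‖u‖ ^ 2 + 2 * ‖v‖ ^ 2 := by
    have := norm_add_le u v
    nlinarith [norm_nonneg (u + v), sq_nonneg (‖u‖ - ‖v‖)]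
  nlinarith [hω k]

/-- The value at `k` of a sequence, extended by zero. -/
noncomputable def valueAt (f : Freq N → ℂ) (k : ℤ) : ℂ :=
  ∑ n : Freq N, if (n : ℤ) = k then f n else 0

theorem sum_norm_valueAt_le (f : Freq N → ℂ) {ω : ℤ → ℝ} (hω : ∀ k, 0 ≤ ω k) (K : Finset ℤ) :
    ∑ k ∈ K, ω k * ‖valueAt f k‖ ^ 2 ≤ ∑ n : Freq N, ω n * ‖f n‖ ^ 2 := by
  have e : ∀ k, ‖valueAt f k‖ ^ 2 = ∑ n : Freq N, if (n : ℤ) = k then ‖f n‖ ^ 2 else 0 := by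
    intro k
    unfold valueAt
    by_cases h : ∃ n : Freq N, (n : ℤ) = k
    · obtain ⟨n, rfl⟩ := h
      simp
    · push Not at h
      simp [h]
  simp_rw [e, Finset.mul_sum]
  rw [Finset.sum_comm]
  refine Finset.sum_le_sum fun n _ => ?_
  simp only [mul_ite, mul_zero]
  rw [Finset.sum_ite_eq]
  split_ifs
  · exact le_rfl
  · exact mul_nonneg (hω _) (sq_nonneg _)

/-- Inclusion–exclusion over the resonances `n₁ = n₃` and `n₂ = n₃`. Each leaves a pairing times a
single Gaussian factor; the terms with all three frequencies equal are counted twice and subtracted.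
-/
theorem convPPM_eq (a b c : Freq N → ℝ) (y : Freq N → ℂ) (k : ℤ) :
    convPPM a b c y k = chaosAt ![true, true, false]
      (fun t : Freq N × Freq N × Freq N => ![t.1, t.2.1, t.2.2])
      (fun t => (t.1 : ℤ) + t.2.1 - t.2.2) (fun t => a t.1 * b t.2.1 * c t.2.2) y k
      + pairing a c y * valueAt (fun n => b n * y n) k
      + pairing b c y * valueAt (fun n => a n * y n) k
      - valueAt (fun n => ((a n * b n * c n * ‖y n‖ ^ 2 : ℝ) : ℂ) * y n) k := by
  set F : Freq N → Freq N → Freq N → ℂ := fun n₁ n₂ n₃ => ((a n₁ * b n₂ * c n₃ : ℝ) : ℂ)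
    * (y n₁ * y n₂ * starRingEnd ℂ (y n₃)) with hF
  have e13 : pairing a c y * valueAt (fun n => b n * y n) k
      = ∑ n₁ : Freq N, ∑ n₂ : Freq N, ∑ n₃ : Freq N,
        if n₁ = n₃ then (if (n₂ : ℤ) = k then F n₁ n₂ n₃ else 0) else 0 := by
    simp only [Finset.sum_ite_eq, Finset.mem_univ, if_true, hF]
    unfold pairing valueAt
    push_cast
    rw [Finset.sum_mul_sum]
    refine Finset.sum_congr rfl fun n₁ _ => Finset.sum_congr rfl fun n₂ _ => ?_
    split_ifs
    · rw [← Complex.mul_conj']; ring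
    · simp
  have e23 : pairing b c y * valueAt (fun n => a n * y n) k
      = ∑ n₁ : Freq N, ∑ n₂ : Freq N, ∑ n₃ : Freq N,
        if n₂ = n₃ then (if (n₁ : ℤ) = k then F n₁ n₂ n₃ else 0) else 0 := by
    simp only [Finset.sum_ite_eq, Finset.mem_univ, if_true, hF]
    unfold pairing valueAt
    push_cast
    rw [Finset.sum_mul_sum, Finset.sum_comm]
    refine Finset.sum_congr rfl fun n₁ _ => Finset.sum_congr rfl fun n₂ _ => ?_
    split_ifs
    · rw [← Complex.mul_conj']; ring
    · simp
  have e123 : valueAt (fun n => ((a n * b n * c n * ‖y n‖ ^ 2 : ℝ) : ℂ) * y n) k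
      = ∑ n₁ : Freq N, ∑ n₂ : Freq N, ∑ n₃ : Freq N,
        if n₂ = n₃ then (if n₁ = n₂ then (if (n₁ : ℤ) = k then F n₁ n₂ n₃ else 0) else 0)
          else 0 := by
    simp only [Finset.sum_ite_eq, Finset.mem_univ, if_true, hF]
    unfold valueAt
    refine Finset.sum_congr rfl fun n₁ _ => ?_
    split_ifs
    · push_cast
      rw [← Complex.mul_conj']; ring
    · rfl
  rw [e13, e23, e123]
  unfold convPPM chaosAt
  rw [Fintype.sum_prod_type]
  simp_rw [Fintype.sum_prod_type]
  rw [← Finset.sum_add_distrib, ← Finset.sum_add_distrib, ← Finset.sum_sub_distrib]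
  refine Finset.sum_congr rfl fun n₁ _ => ?_
  rw [← Finset.sum_add_distrib, ← Finset.sum_add_distrib, ← Finset.sum_sub_distrib]
  refine Finset.sum_congr rfl fun n₂ _ => ?_
  rw [← Finset.sum_add_distrib, ← Finset.sum_add_distrib, ← Finset.sum_sub_distrib]
  refine Finset.sum_congr rfl fun n₃ _ => ?_
  have hmon : monomial ![true, true, false] ![n₁, n₂, n₃] y
      = y n₁ * y n₂ * starRingEnd ℂ (y n₃) := by
    simp [monomial, Fin.prod_univ_succ, conjIf, mul_assoc]
  simp only [nonResonant_PPM, hmon]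
  change (if _ then F n₁ n₂ n₃ else 0) = (if _ then F n₁ n₂ n₃ else 0) + _ + _ - _
  by_cases h1 : n₁ = n₃
  · by_cases h2 : n₂ = n₃
    · subst h1; subst h2
      by_cases hk : (n₂ : ℤ) = k <;> simp [hk]
    · subst h1
      by_cases hk : (n₂ : ℤ) = k <;> simp [h2, hk]
  · by_cases h2 : n₂ = n₃
    · subst h2
      by_cases hk : (n₁ : ℤ) = k <;> simp [h1, hk]
    · simp [h1, h2]

theorem norm_sq_four_le (p q r s : ℂ) :
    ‖p + q + r - s‖ ^ 2 ≤ 4 * (‖p‖ ^ 2 + ‖q‖ ^ 2 + ‖r‖ ^ 2 + ‖s‖ ^ 2) := by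
  have h : ‖p + q + r - s‖ ≤ ‖p‖ + ‖q‖ + ‖r‖ + ‖s‖ :=
    (norm_sub_le _ _).trans (by gcongr; exact norm_add₃_le)
  nlinarith [norm_nonneg (p + q + r - s), sq_nonneg (‖p‖ - ‖q‖), sq_nonneg (‖p‖ - ‖r‖),
    sq_nonneg (‖p‖ - ‖s‖), sq_nonneg (‖q‖ - ‖r‖), sq_nonneg (‖q‖ - ‖s‖), sq_nonneg (‖r‖ - ‖s‖)]

theorem sum_norm_convPPM_le (a b c : Freq N → ℝ) {ω : ℤ → ℝ} (hω : ∀ k, 0 ≤ ω k) (K : Finset ℤ)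
    (y : Freq N → ℂ) :
    ∑ k ∈ K, ω k * ‖convPPM a b c y k‖ ^ 2
      ≤ 4 * (normPPM a b c ω K y
        + pairing a c y ^ 2 * ∑ n : Freq N, ω n * (b n ^ 2 * ‖y n‖ ^ 2)
        + pairing b c y ^ 2 * ∑ n : Freq N, ω n * (a n ^ 2 * ‖y n‖ ^ 2)
        + ∑ n : Freq N, ω n * (a n ^ 2 * b n ^ 2 * c n ^ 2 * ‖y n‖ ^ 6)) := by
  have hb := sum_norm_valueAt_le (fun n => (b n : ℂ) * y n) hω K
  have ha := sum_norm_valueAt_le (fun n => (a n : ℂ) * y n) hω K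
  have hc := sum_norm_valueAt_le (fun n => ((a n * b n * c n * ‖y n‖ ^ 2 : ℝ) : ℂ) * y n) hω K
  have ea : ∀ (a : Freq N → ℝ) n, ‖(a n : ℂ) * y n‖ ^ 2 = a n ^ 2 * ‖y n‖ ^ 2 := fun a n => by
    rw [norm_mul, mul_pow, Complex.norm_real, Real.norm_eq_abs, sq_abs]
  have ec : ∀ n, ‖((a n * b n * c n * ‖y n‖ ^ 2 : ℝ) : ℂ) * y n‖ ^ 2
      = a n ^ 2 * b n ^ 2 * c n ^ 2 * ‖y n‖ ^ 6 := fun n => by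
    rw [norm_mul, mul_pow, Complex.norm_real, Real.norm_eq_abs, sq_abs]
    ring
  simp only [ea, ec] at ha hb hc
  calc ∑ k ∈ K, ω k * ‖convPPM a b c y k‖ ^ 2
      ≤ ∑ k ∈ K, 4 * (ω k * ‖chaosAt ![true, true, false]
      (fun t : Freq N × Freq N × Freq N => ![t.1, t.2.1, t.2.2])
      (fun t => (t.1 : ℤ) + t.2.1 - t.2.2) (fun t => a t.1 * b t.2.1 * c t.2.2) y k‖ ^ 2
        + pairing a c y ^ 2 * (ω k * ‖valueAt (fun n => (b n : ℂ) * y n) k‖ ^ 2)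
        + pairing b c y ^ 2 * (ω k * ‖valueAt (fun n => (a n : ℂ) * y n) k‖ ^ 2)
        + ω k * ‖valueAt (fun n => ((a n * b n * c n * ‖y n‖ ^ 2 : ℝ) : ℂ) * y n) k‖ ^ 2) := by
        refine Finset.sum_le_sum fun k _ => ?_
        rw [convPPM_eq]
        refine (mul_le_mul_of_nonneg_left (norm_sq_four_le _ _ _ _) (hω k)).trans (le_of_eq ?_)
        rw [norm_mul, norm_mul, mul_pow, mul_pow, Complex.norm_real, Complex.norm_real,
          Real.norm_eq_abs, Real.norm_eq_abs, sq_abs, sq_abs]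
        ring
    _ ≤ _ := by
        rw [← Finset.mul_sum, Finset.sum_add_distrib, Finset.sum_add_distrib,
          Finset.sum_add_distrib, ← Finset.mul_sum, ← Finset.mul_sum]
        unfold normPPM chaosNorm
        gcongr

/-- On the hyperplane, `n₁ = n₃` forces `n₂ = n₄`, and `n₁ = n₄` forces `n₂ = n₃`. So there are only
two families of resonances, each a product of two pairings, which overlap where all four frequencies
agree. -/
theorem convPPMM_eq (a b c d : Freq N → ℝ) (y : Freq N → ℂ) :
    convPPMM a b c d y = chaosAt ![true, true, false, false]
      (fun t : Freq N × Freq N × Freq N × Freq N => ![t.1, t.2.1, t.2.2.1, t.2.2.2])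
      (fun t => (t.1 : ℤ) + t.2.1 - t.2.2.1 - t.2.2.2)
      (fun t => a t.1 * b t.2.1 * c t.2.2.1 * d t.2.2.2) y 0
      + pairing a c y * pairing b d y + pairing a d y * pairing b c y
      - ((∑ n, a n * b n * c n * d n * ‖y n‖ ^ 4 : ℝ) : ℂ) := by
  set F : Freq N → Freq N → Freq N → Freq N → ℂ := fun n₁ n₂ n₃ n₄ =>
    ((a n₁ * b n₂ * c n₃ * d n₄ : ℝ) : ℂ)
      * (y n₁ * y n₂ * starRingEnd ℂ (y n₃) * starRingEnd ℂ (y n₄)) with hF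
  have e13 : (pairing a c y : ℂ) * pairing b d y
      = ∑ n₁ : Freq N, ∑ n₂ : Freq N, ∑ n₃ : Freq N, ∑ n₄ : Freq N,
        if n₂ = n₄ then (if n₁ = n₃ then F n₁ n₂ n₃ n₄ else 0) else 0 := by
    simp only [Finset.sum_ite_eq, Finset.mem_univ, if_true, hF]
    unfold pairing
    push_cast
    rw [Finset.sum_mul_sum]
    refine Finset.sum_congr rfl fun n₁ _ => Finset.sum_congr rfl fun n₂ _ => ?_
    rw [← Complex.mul_conj', ← Complex.mul_conj']; ring
  have e14 : (pairing a d y : ℂ) * pairing b c y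
      = ∑ n₁ : Freq N, ∑ n₂ : Freq N, ∑ n₃ : Freq N, ∑ n₄ : Freq N,
        if n₁ = n₄ then (if n₂ = n₃ then F n₁ n₂ n₃ n₄ else 0) else 0 := by
    simp only [Finset.sum_ite_eq, Finset.mem_univ, if_true, hF]
    unfold pairing
    push_cast
    rw [Finset.sum_mul_sum]
    refine Finset.sum_congr rfl fun n₁ _ => Finset.sum_congr rfl fun n₂ _ => ?_
    rw [← Complex.mul_conj', ← Complex.mul_conj']; ring
  have e1234 : ((∑ n, a n * b n * c n * d n * ‖y n‖ ^ 4 : ℝ) : ℂ)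
      = ∑ n₁ : Freq N, ∑ n₂ : Freq N, ∑ n₃ : Freq N, ∑ n₄ : Freq N,
        if n₃ = n₄ then (if n₂ = n₃ then (if n₁ = n₂ then F n₁ n₂ n₃ n₄ else 0) else 0)
          else 0 := by
    simp only [Finset.sum_ite_eq, Finset.mem_univ, if_true, hF]
    push_cast
    refine Finset.sum_congr rfl fun n₁ _ => ?_
    have : (‖y n₁‖ : ℂ) ^ 4 = ((‖y n₁‖ : ℂ) ^ 2) ^ 2 := by ring
    rw [this, ← Complex.mul_conj']; ring
  rw [e13, e14, e1234]
  unfold convPPMM chaosAt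
  rw [Fintype.sum_prod_type]
  simp_rw [Fintype.sum_prod_type]
  rw [← Finset.sum_add_distrib, ← Finset.sum_add_distrib, ← Finset.sum_sub_distrib]
  refine Finset.sum_congr rfl fun n₁ _ => ?_
  rw [← Finset.sum_add_distrib, ← Finset.sum_add_distrib, ← Finset.sum_sub_distrib]
  refine Finset.sum_congr rfl fun n₂ _ => ?_
  rw [← Finset.sum_add_distrib, ← Finset.sum_add_distrib, ← Finset.sum_sub_distrib]
  refine Finset.sum_congr rfl fun n₃ _ => ?_
  rw [← Finset.sum_add_distrib, ← Finset.sum_add_distrib, ← Finset.sum_sub_distrib]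
  refine Finset.sum_congr rfl fun n₄ _ => ?_
  have hmon : monomial ![true, true, false, false] ![n₁, n₂, n₃, n₄] y
      = y n₁ * y n₂ * starRingEnd ℂ (y n₃) * starRingEnd ℂ (y n₄) := by
    simp [monomial, Fin.prod_univ_succ, conjIf, mul_assoc]
  simp only [nonResonant_PPMM, hmon]
  change (if _ then F n₁ n₂ n₃ n₄ else 0) = (if _ then F n₁ n₂ n₃ n₄ else 0) + _ + _ - _
  have hk : ((n₁ : ℤ) + n₂ - n₃ - n₄ = 0) ↔ ((n₁ : ℤ) + n₂ = n₃ + n₄) := by omega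
  simp only [hk, ne_eq, Subtype.ext_iff]
  generalize F n₁ n₂ n₃ n₄ = z
  by_cases hs : (n₁ : ℤ) + n₂ = n₃ + n₄
  · by_cases h13 : (n₁ : ℤ) = n₃
    · have h24 : (n₂ : ℤ) = n₄ := by omega
      by_cases h14 : (n₁ : ℤ) = n₄
      · have h23 : (n₂ : ℤ) = n₃ := by omega
        have h12 : (n₁ : ℤ) = n₂ := by omega
        have h34 : (n₃ : ℤ) = n₄ := by omega
        simp [h13, h24, h34]
      · have h34 : ¬ (n₃ : ℤ) = n₄ := by omega
        simp [h13, h24, h34]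
    · have h24 : ¬ (n₂ : ℤ) = n₄ := by omega
      by_cases h14 : (n₁ : ℤ) = n₄
      · have h23 : (n₂ : ℤ) = n₃ := by omega
        have h34 : ¬ (n₃ : ℤ) = n₄ := by omega
        simp [h14, h23, h34, add_comm]
      · have h23 : ¬ (n₂ : ℤ) = n₃ := by omega
        simp [hs, h13, h14, h23, h24]
  · by_cases h24 : (n₂ : ℤ) = n₄
    · have h13 : ¬ (n₁ : ℤ) = n₃ := by omega
      by_cases h14 : (n₁ : ℤ) = n₄
      · have h23 : ¬ (n₂ : ℤ) = n₃ := by omega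
        simp [hs, h13, h23]
      · by_cases h34 : (n₃ : ℤ) = n₄
        · have h12 : ¬ (n₁ : ℤ) = n₂ := by omega
          simp [hs, h13, h12, h14]
        · simp [hs, h13, h14, h34]
    · by_cases h14 : (n₁ : ℤ) = n₄
      · have h23 : ¬ (n₂ : ℤ) = n₃ := by omega
        simp [hs, h23, h24]
      · by_cases h34 : (n₃ : ℤ) = n₄
        · have h23 : ¬ (n₂ : ℤ) = n₃ := by omega
          simp [hs, h14, h23, h24]
        · simp [hs, h14, h24, h34]

end Convolution

end DNLS

namespace DNLS

/-! ### The quadrilinear form and its deterministic bounds -/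

section SumComm

variable {T X : Type*} [Fintype T] [AddCommMonoid X] (F : T → T → T → T → X)

theorem sum_comm_1324 :
    ∑ a, ∑ b, ∑ c, ∑ d, F a b c d = ∑ a, ∑ c, ∑ b, ∑ d, F a b c d :=
  Finset.sum_congr rfl fun _ _ => Finset.sum_comm

theorem sum_comm_2134 :
    ∑ a, ∑ b, ∑ c, ∑ d, F a b c d = ∑ b, ∑ a, ∑ c, ∑ d, F a b c d :=
  Finset.sum_comm

theorem sum_comm_1243 :
    ∑ a, ∑ b, ∑ c, ∑ d, F a b c d = ∑ a, ∑ b, ∑ d, ∑ c, F a b c d :=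
  Finset.sum_congr rfl fun _ _ => Finset.sum_congr rfl fun _ _ => Finset.sum_comm

theorem sum_comm_3124 :
    ∑ a, ∑ b, ∑ c, ∑ d, F a b c d = ∑ c, ∑ a, ∑ b, ∑ d, F a b c d := by
  rw [sum_comm_1324, sum_comm_2134 fun a c b d => F a b c d]

theorem sum_comm_1342 :
    ∑ a, ∑ b, ∑ c, ∑ d, F a b c d = ∑ a, ∑ c, ∑ d, ∑ b, F a b c d := by
  rw [sum_comm_1324, sum_comm_1243 fun a c b d => F a b c d]

theorem sum_comm_3412 :
    ∑ a, ∑ b, ∑ c, ∑ d, F a b c d = ∑ c, ∑ d, ∑ a, ∑ b, F a b c d := by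
  rw [sum_comm_3124, sum_comm_1342 fun c a b d => F a b c d,
    sum_comm_1342 fun c b d a => F a b c d]

theorem sum_comm_2341 :
    ∑ a, ∑ b, ∑ c, ∑ d, F a b c d = ∑ b, ∑ c, ∑ d, ∑ a, F a b c d := by
  rw [sum_comm_2134, sum_comm_1342 fun b a c d => F a b c d]

theorem sum_comm_2413 :
    ∑ a, ∑ b, ∑ c, ∑ d, F a b c d = ∑ b, ∑ d, ∑ a, ∑ c, F a b c d := by
  rw [sum_comm_2134, sum_comm_1342 fun b a c d => F a b c d,
    sum_comm_1342 fun b c d a => F a b c d]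

end SumComm

section QuadForm

variable {N : ℕ}

/-- The form `∑ n₁ A(n₁) B(n₂) C̄(n₃) D̄(n₄)` over `n₁ + n₂ = n₃ + n₄`. -/
noncomputable def quadForm (A B C D : Freq N → ℂ) : ℂ :=
  ∑ n₁ : Freq N, ∑ n₂ : Freq N, ∑ n₃ : Freq N, ∑ n₄ : Freq N,
    if (n₁ : ℤ) + n₂ = n₃ + n₄ then
      ((n₁ : ℤ) : ℂ) * (A n₁ * B n₂ * starRingEnd ℂ (C n₃) * starRingEnd ℂ (D n₄)) else 0

theorem quadForm_add_one (A A' B C D : Freq N → ℂ) :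
    quadForm (A + A') B C D = quadForm A B C D + quadForm A' B C D := by
  unfold quadForm
  simp only [← Finset.sum_add_distrib]
  refine Finset.sum_congr rfl fun _ _ => Finset.sum_congr rfl fun _ _ =>
    Finset.sum_congr rfl fun _ _ => Finset.sum_congr rfl fun _ _ => ?_
  split_ifs
  · simp only [Pi.add_apply]; ring
  · simp

theorem quadForm_add_two (A B B' C D : Freq N → ℂ) :
    quadForm A (B + B') C D = quadForm A B C D + quadForm A B' C D := by
  unfold quadForm
  simp only [← Finset.sum_add_distrib]
  refine Finset.sum_congr rfl fun _ _ => Finset.sum_congr rfl fun _ _ =>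
    Finset.sum_congr rfl fun _ _ => Finset.sum_congr rfl fun _ _ => ?_
  split_ifs
  · simp only [Pi.add_apply]; ring
  · simp

theorem quadForm_swap (A B C D : Freq N → ℂ) : quadForm A B C D = quadForm A B D C := by
  unfold quadForm
  rw [sum_comm_1243]
  refine Finset.sum_congr rfl fun _ _ => Finset.sum_congr rfl fun _ _ =>
    Finset.sum_congr rfl fun n₄ _ => Finset.sum_congr rfl fun n₃ _ => ?_
  rw [add_comm (n₃ : ℤ)]
  split_ifs
  · ring
  · rfl

theorem quadForm_add_three (A B C C' D : Freq N → ℂ) :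
    quadForm A B (C + C') D = quadForm A B C D + quadForm A B C' D := by
  unfold quadForm
  simp only [← Finset.sum_add_distrib]
  refine Finset.sum_congr rfl fun _ _ => Finset.sum_congr rfl fun _ _ =>
    Finset.sum_congr rfl fun _ _ => Finset.sum_congr rfl fun _ _ => ?_
  split_ifs
  · simp only [Pi.add_apply, map_add]; ring
  · simp

theorem quadForm_add_four (A B C D E : Freq N → ℂ) :
    quadForm A B C (D + E) = quadForm A B C D + quadForm A B C E := by
  rw [quadForm_swap, quadForm_add_three, quadForm_swap A B D, quadForm_swap A B E]

/-- The `ℓ²` norm of a complex sequence. -/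
noncomputable def normE (A : Freq N → ℂ) : ℝ := l2 fun n => ‖A n‖

/-- The `H¹` norm of a complex sequence. -/
noncomputable def normH (A : Freq N → ℂ) : ℝ := l2 fun n : Freq N => bracket n * ‖A n‖

/-- The `ℓ¹` norm of a complex sequence. -/
noncomputable def normL (A : Freq N → ℂ) : ℝ := ∑ n, ‖A n‖

theorem normE_nonneg (A : Freq N → ℂ) : 0 ≤ normE A := l2_nonneg _

theorem normH_nonneg (A : Freq N → ℂ) : 0 ≤ normH A := l2_nonneg _

theorem normL_nonneg (A : Freq N → ℂ) : 0 ≤ normL A := Finset.sum_nonneg fun _ _ => norm_nonneg _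

theorem norm_quadForm_le_sum (A B C D : Freq N → ℂ) :
    ‖quadForm A B C D‖ ≤ ∑ n₁ : Freq N, ∑ n₂ : Freq N, ∑ n₃ : Freq N, ∑ n₄ : Freq N,
      if (n₁ : ℤ) + n₂ = n₃ + n₄ then
        |((n₁ : ℤ) : ℝ)| * (‖A n₁‖ * ‖B n₂‖ * ‖C n₃‖ * ‖D n₄‖) else 0 := by
  refine (norm_sum_le _ _).trans (Finset.sum_le_sum fun n₁ _ => (norm_sum_le _ _).trans
    (Finset.sum_le_sum fun n₂ _ => (norm_sum_le _ _).trans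
      (Finset.sum_le_sum fun n₃ _ => (norm_sum_le _ _).trans
        (Finset.sum_le_sum fun n₄ _ => ?_))))
  split_ifs
  · simp
  · simp

theorem norm_quadForm_le_one_two (A B C D : Freq N → ℂ) :
    ‖quadForm A B C D‖ ≤ normH A * normE B * normL C * normL D := by
  refine (norm_quadForm_le_sum A B C D).trans (le_trans ?_
    (quad_sum_le_one_two (α := fun n : Freq N => bracket n * ‖A n‖) (β := fun n => ‖B n‖)
      (γ := fun n => ‖C n‖) (δ := fun n => ‖D n‖) (fun _ => norm_nonneg _) fun _ => norm_nonneg _))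
  refine Finset.sum_le_sum fun n₁ _ => Finset.sum_le_sum fun n₂ _ =>
    Finset.sum_le_sum fun n₃ _ => Finset.sum_le_sum fun n₄ _ => ?_
  split_ifs
  · calc |((n₁ : ℤ) : ℝ)| * (‖A n₁‖ * ‖B n₂‖ * ‖C n₃‖ * ‖D n₄‖)
        ≤ bracket n₁ * (‖A n₁‖ * ‖B n₂‖ * ‖C n₃‖ * ‖D n₄‖) :=
          mul_le_mul_of_nonneg_right (abs_le_bracket _) (by positivity)
      _ = _ := by ring
  · exact le_rfl

theorem norm_quadForm_le_one_three (A B C D : Freq N → ℂ) :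
    ‖quadForm A B C D‖ ≤ normH A * normE C * normL B * normL D := by
  refine (norm_quadForm_le_sum A B C D).trans (le_trans ?_
    (quad_sum_le_one_three (α := fun n : Freq N => bracket n * ‖A n‖) (β := fun n => ‖B n‖)
      (γ := fun n => ‖C n‖) (δ := fun n => ‖D n‖) (fun _ => norm_nonneg _) fun _ => norm_nonneg _))
  refine Finset.sum_le_sum fun n₁ _ => Finset.sum_le_sum fun n₂ _ =>
    Finset.sum_le_sum fun n₃ _ => Finset.sum_le_sum fun n₄ _ => ?_
  split_ifs
  · calc |((n₁ : ℤ) : ℝ)| * (‖A n₁‖ * ‖B n₂‖ * ‖C n₃‖ * ‖D n₄‖)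
        ≤ bracket n₁ * (‖A n₁‖ * ‖B n₂‖ * ‖C n₃‖ * ‖D n₄‖) :=
          mul_le_mul_of_nonneg_right (abs_le_bracket _) (by positivity)
      _ = _ := by ring
  · exact le_rfl

theorem norm_quadForm_le_one_four (A B C D : Freq N → ℂ) :
    ‖quadForm A B C D‖ ≤ normH A * normE D * normL B * normL C := by
  rw [quadForm_swap]
  exact norm_quadForm_le_one_three A B D C

/-- The derivative in the first place is moved to the other places. -/
theorem norm_quadForm_le_one (A B C D : Freq N → ℂ) :
    ‖quadForm A B C D‖ ≤ normE A * (normH B * normL C * normL D + normH C * normL B * normL D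
      + normH D * normL B * normL C) := by
  have h2 := quad_sum_le_one_two (α := fun n => ‖A n‖) (β := fun n : Freq N => bracket n * ‖B n‖)
    (γ := fun n => ‖C n‖) (δ := fun n => ‖D n‖) (fun _ => norm_nonneg _) fun _ => norm_nonneg _
  have h3 := quad_sum_le_one_three (α := fun n => ‖A n‖) (β := fun n => ‖B n‖)
    (γ := fun n : Freq N => bracket n * ‖C n‖) (δ := fun n => ‖D n‖)
    (fun _ => norm_nonneg _) fun _ => norm_nonneg _
  have h4 := quad_sum_le_one_three (α := fun n => ‖A n‖) (β := fun n => ‖B n‖)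
    (γ := fun n : Freq N => bracket n * ‖D n‖) (δ := fun n => ‖C n‖)
    (fun _ => norm_nonneg _) fun _ => norm_nonneg _
  rw [sum_comm_1243] at h4
  have key := (norm_quadForm_le_sum A B C D).trans (b := _) (c :=
    (∑ n₁ : Freq N, ∑ n₂ : Freq N, ∑ n₃ : Freq N, ∑ n₄ : Freq N,
      (if (n₁ : ℤ) + n₂ = n₃ + n₄ then ‖A n₁‖ * (bracket n₂ * ‖B n₂‖) * ‖C n₃‖ * ‖D n₄‖ else 0))
    + (∑ n₁ : Freq N, ∑ n₂ : Freq N, ∑ n₃ : Freq N, ∑ n₄ : Freq N,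
      (if (n₁ : ℤ) + n₂ = n₃ + n₄ then ‖A n₁‖ * ‖B n₂‖ * (bracket n₃ * ‖C n₃‖) * ‖D n₄‖ else 0))
    + ∑ n₁ : Freq N, ∑ n₂ : Freq N, ∑ n₃ : Freq N, ∑ n₄ : Freq N,
      (if (n₁ : ℤ) + n₂ = n₄ + n₃ then ‖A n₁‖ * ‖B n₂‖ * (bracket n₄ * ‖D n₄‖) * ‖C n₃‖ else 0))
    (by
      simp only [← Finset.sum_add_distrib]
      refine Finset.sum_le_sum fun n₁ _ => Finset.sum_le_sum fun n₂ _ =>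
        Finset.sum_le_sum fun n₃ _ => Finset.sum_le_sum fun n₄ _ => ?_
      rw [add_comm (n₄ : ℤ)]
      split_ifs with h
      · have e : ((n₁ : ℤ) : ℝ) = ((n₃ : ℤ) : ℝ) + ((n₄ : ℤ) : ℝ) - ((n₂ : ℤ) : ℝ) := by
          have : (n₁ : ℤ) = n₃ + n₄ - n₂ := by omega
          rw [this]; push_cast; ring
        have h1 : |((n₁ : ℤ) : ℝ)| ≤ bracket n₂ + bracket n₃ + bracket n₄ := by
          rw [e]
          have h2 := abs_sub (((n₃ : ℤ) : ℝ) + ((n₄ : ℤ) : ℝ)) ((n₂ : ℤ) : ℝ)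
          have h3 := abs_add_le ((n₃ : ℤ) : ℝ) ((n₄ : ℤ) : ℝ)
          linarith [abs_le_bracket n₂, abs_le_bracket n₃, abs_le_bracket n₄]
        calc _ ≤ (bracket n₂ + bracket n₃ + bracket n₄) * (‖A n₁‖ * ‖B n₂‖ * ‖C n₃‖ * ‖D n₄‖) :=
              mul_le_mul_of_nonneg_right h1 (by positivity)
          _ = _ := by ring
      · simp)
  refine key.trans ((add_le_add (add_le_add h2 h3) h4).trans (le_of_eq ?_))
  unfold normE normH normL
  ring

/-- A box which contains all frequencies of products of three factors. -/
noncomputable def box (N : ℕ) : Finset ℤ := Finset.Icc (-(3 * N : ℤ)) (3 * N)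

/-- The `ℓ²` norm of `V` over the box. -/
noncomputable def boxE (N : ℕ) (V : ℤ → ℂ) : ℝ := Real.sqrt (∑ k ∈ box N, 1 * ‖V k‖ ^ 2)

/-- The `H⁻¹` norm of `V` over the box. -/
noncomputable def boxH (N : ℕ) (V : ℤ → ℂ) : ℝ := Real.sqrt (∑ k ∈ box N, invSq k * ‖V k‖ ^ 2)

theorem sqrt_sum_div_bracket (V : ℤ → ℂ) :
    Real.sqrt (∑ k ∈ box N, (‖V k‖ / bracket k) ^ 2) = boxH N V := by
  unfold boxH invSq
  congr 1
  refine Finset.sum_congr rfl fun k _ => ?_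
  rw [div_pow]; ring

theorem mem_box_of_abs_le {k : ℤ} (h : |k| ≤ 3 * N) : k ∈ box N :=
  Finset.mem_Icc.2 (abs_le.1 h)

/-- Young's inequality in dual form, with the derivative absorbed by the `H¹` norm of `A`. The
sequence `V` will be a convolution of Gaussian sequences without derivative, which is controlled in
`ℓ²`. -/
theorem sum_sum_test_le (A B : Freq N → ℂ) (V : ℤ → ℂ) {l : Freq N → Freq N → ℤ}
    (hl : ∀ m, Function.Injective fun n => l n m) (hK : ∀ n m, l n m ∈ box N) :
    ∑ n : Freq N, ∑ m : Freq N, |((n : ℤ) : ℝ)| * ‖A n‖ * ‖B m‖ * ‖V (l n m)‖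
      ≤ normH A * normL B * boxE N V := by
  have h := sum_sum_mul_comp_le (K := box N) (fun n : Freq N => bracket n * ‖A n‖)
    (fun n => ‖B n‖) (fun _ => norm_nonneg _) (fun k => ‖V k‖) hl hK
  unfold normH normL boxE
  simp only [one_mul]
  refine le_trans (Finset.sum_le_sum fun n _ => Finset.sum_le_sum fun m _ => ?_) h
  gcongr
  exact abs_le_bracket _

/-- Here `V` is measured only in `H⁻¹`. The missing weight `⟨l⟩` is distributed over `C` and `D` by
subadditivity of the bracket, so one of these two factors is measured in `H¹` and the other in `ℓ¹`.
-/
theorem sum_sum_test_le' (C D : Freq N → ℂ) (V : ℤ → ℂ) {l : Freq N → Freq N → ℤ}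
    (hl : ∀ m, Function.Injective fun n => l n m) (hl' : ∀ n, Function.Injective fun m => l n m)
    (hK : ∀ n m, l n m ∈ box N) (hb : ∀ n m, bracket (l n m) ≤ bracket n + bracket m) :
    ∑ n : Freq N, ∑ m : Freq N, ‖C n‖ * ‖D m‖ * ‖V (l n m)‖
      ≤ (normH C * normL D + normH D * normL C) * boxH N V := by
  have h1 := sum_sum_mul_comp_le (K := box N) (fun n : Freq N => bracket n * ‖C n‖)
    (fun n => ‖D n‖) (fun _ => norm_nonneg _) (fun k => ‖V k‖ / bracket k) hl hK
  have h2 := sum_sum_mul_comp_le (K := box N) (fun n : Freq N => bracket n * ‖D n‖)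
    (fun n => ‖C n‖) (fun _ => norm_nonneg _) (fun k => ‖V k‖ / bracket k)
    (l := fun m n => l n m) hl' fun m n => hK n m
  rw [sqrt_sum_div_bracket] at h1 h2
  rw [add_mul]
  refine le_trans ?_ (add_le_add h1 h2)
  rw [Finset.sum_comm (γ := Freq N) (f := fun t t' => bracket t * ‖D t‖ * ‖C t'‖ *
    (‖V (l t' t)‖ / bracket (l t' t)))]
  rw [← Finset.sum_add_distrib]
  refine Finset.sum_le_sum fun n _ => ?_
  rw [← Finset.sum_add_distrib]
  refine Finset.sum_le_sum fun m _ => ?_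
  have hpos := bracket_pos (l n m)
  calc ‖C n‖ * ‖D m‖ * ‖V (l n m)‖
      = bracket (l n m) * (‖C n‖ * ‖D m‖ * (‖V (l n m)‖ / bracket (l n m))) := by
        field_simp
    _ ≤ (bracket n + bracket m) * (‖C n‖ * ‖D m‖ * (‖V (l n m)‖ / bracket (l n m))) :=
        mul_le_mul_of_nonneg_right (hb n m) (by positivity)
    _ = _ := by ring

theorem sum_test_le (A : Freq N → ℂ) (V : ℤ → ℂ) :
    ∑ n : Freq N, |((n : ℤ) : ℝ)| * ‖A n‖ * ‖V n‖ ≤ normH A * boxE N V := by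
  have h := sum_mul_comp_le (K := box N) (fun n : Freq N => bracket n * ‖A n‖) (fun k => ‖V k‖)
    Subtype.val_injective (fun n => mem_box_of_abs_le (by have := n.abs_le; omega))
  unfold normH boxE
  simp only [one_mul]
  refine le_trans (Finset.sum_le_sum fun n _ => ?_) h
  gcongr
  exact abs_le_bracket _

theorem sum_test_le' (A : Freq N → ℂ) (V : ℤ → ℂ) :
    ∑ n : Freq N, ‖A n‖ * ‖V n‖ ≤ normH A * boxH N V := by
  have h := sum_mul_comp_le (K := box N) (fun n : Freq N => bracket n * ‖A n‖)
    (fun k => ‖V k‖ / bracket k)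
    Subtype.val_injective (fun n => mem_box_of_abs_le (by have := n.abs_le; omega))
  rw [sqrt_sum_div_bracket] at h
  refine le_trans (Finset.sum_le_sum fun n _ => ?_) h
  have hpos := bracket_pos n
  refine le_of_eq ?_
  field_simp

/-- The sequence `a y`. -/
def smulSeq (a : Freq N → ℝ) (y : Freq N → ℂ) : Freq N → ℂ := fun n => (a n : ℂ) * y n

/-- The weight of the derivative of a sequence. -/
def derivWeight (a : Freq N → ℝ) : Freq N → ℝ := fun n => ((n : ℤ) : ℝ) * a n

/-- The Gaussian factors are collected into a convolution before absolute values are taken, so that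
its random cancellations are kept. In this lemma and its companions the digits are the places of the
Gaussian factors. -/
theorem norm_quadForm_le_YY34 (A B : Freq N → ℂ) (c d : Freq N → ℝ) (y : Freq N → ℂ) :
    ‖quadForm A B (smulSeq c y) (smulSeq d y)‖
      ≤ normH A * normL B * boxE N (convPP c d y) := by
  have e : quadForm A B (smulSeq c y) (smulSeq d y) = ∑ n₁ : Freq N, ∑ n₂ : Freq N,
      ((n₁ : ℤ) : ℂ) * A n₁ * B n₂ * starRingEnd ℂ (convPP c d y ((n₁ : ℤ) + n₂)) := by
    unfold quadForm convPP smulSeq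
    simp only [map_sum, Finset.mul_sum]
    refine Finset.sum_congr rfl fun n₁ _ => Finset.sum_congr rfl fun n₂ _ =>
      Finset.sum_congr rfl fun n₃ _ => Finset.sum_congr rfl fun n₄ _ => ?_
    by_cases h : (n₁ : ℤ) + n₂ = n₃ + n₄
    · simp only [h, if_true, map_mul, Complex.conj_ofReal]
      push_cast
      ring
    · simp [h, Ne.symm h]
  rw [e]
  refine le_trans ?_ (sum_sum_test_le A B (convPP c d y) (l := fun n m => (n : ℤ) + m)
    (fun m n n' h => Subtype.ext (by simpa using h)) fun n m => mem_box_of_abs_le ?_)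
  · refine (norm_sum_le _ _).trans (Finset.sum_le_sum fun n₁ _ => (norm_sum_le _ _).trans
      (Finset.sum_le_sum fun n₂ _ => le_of_eq ?_))
    simp
  · have := n.abs_le
    have := m.abs_le
    have := abs_add_le (n : ℤ) m
    omega

theorem norm_quadForm_le_YY24 (A C : Freq N → ℂ) (b d : Freq N → ℝ) (y : Freq N → ℂ) :
    ‖quadForm A (smulSeq b y) C (smulSeq d y)‖
      ≤ normH A * normL C * boxE N (convPM b d y) := by
  have e : quadForm A (smulSeq b y) C (smulSeq d y) = ∑ n₁ : Freq N, ∑ n₃ : Freq N,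
      ((n₁ : ℤ) : ℂ) * A n₁ * starRingEnd ℂ (C n₃) * convPM b d y ((n₃ : ℤ) - n₁) := by
    unfold quadForm convPM smulSeq
    rw [sum_comm_1324]
    simp only [Finset.mul_sum]
    refine Finset.sum_congr rfl fun n₁ _ => Finset.sum_congr rfl fun n₃ _ =>
      Finset.sum_congr rfl fun n₂ _ => Finset.sum_congr rfl fun n₄ _ => ?_
    by_cases h : (n₁ : ℤ) + n₂ = n₃ + n₄
    · have h' : (n₂ : ℤ) - n₄ = n₃ - n₁ := by omega
      simp only [h, h', if_true, map_mul, Complex.conj_ofReal]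
      push_cast
      ring
    · have h' : ¬ (n₂ : ℤ) - n₄ = n₃ - n₁ := by omega
      simp [h, h']
  rw [e]
  refine le_trans ?_ (sum_sum_test_le A C (convPM b d y) (l := fun n m => (m : ℤ) - n)
    (fun m n n' h => Subtype.ext (by simpa using h)) fun n m => mem_box_of_abs_le ?_)
  · refine (norm_sum_le _ _).trans (Finset.sum_le_sum fun n₁ _ => (norm_sum_le _ _).trans
      (Finset.sum_le_sum fun n₂ _ => le_of_eq ?_))
    simp
  · have := n.abs_le
    have := m.abs_le
    have := abs_sub (m : ℤ) n
    omega

theorem norm_quadForm_le_YY23 (A D : Freq N → ℂ) (b c : Freq N → ℝ) (y : Freq N → ℂ) :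
    ‖quadForm A (smulSeq b y) (smulSeq c y) D‖
      ≤ normH A * normL D * boxE N (convPM b c y) := by
  rw [quadForm_swap]
  exact norm_quadForm_le_YY24 A D b c y

/-- The derivative falls on a Gaussian factor, whose differentiated coefficients are merely bounded.
The convolution is therefore taken in `H⁻¹`, and one derivative is paid by the smooth factors `C`
and `D`. -/
theorem norm_quadForm_le_YY12 (C D : Freq N → ℂ) (a b : Freq N → ℝ) (y : Freq N → ℂ) :
    ‖quadForm (smulSeq a y) (smulSeq b y) C D‖
      ≤ (normH C * normL D + normH D * normL C) * boxH N (convPP (derivWeight a) b y) := by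
  have e : quadForm (smulSeq a y) (smulSeq b y) C D = ∑ n₃ : Freq N, ∑ n₄ : Freq N,
      starRingEnd ℂ (C n₃) * starRingEnd ℂ (D n₄)
        * convPP (derivWeight a) b y ((n₃ : ℤ) + n₄) := by
    unfold quadForm convPP smulSeq derivWeight
    rw [sum_comm_3412]
    simp only [Finset.mul_sum]
    refine Finset.sum_congr rfl fun n₃ _ => Finset.sum_congr rfl fun n₄ _ =>
      Finset.sum_congr rfl fun n₁ _ => Finset.sum_congr rfl fun n₂ _ => ?_
    by_cases h : (n₁ : ℤ) + n₂ = n₃ + n₄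
    · simp only [h, if_true]
      push_cast
      ring
    · simp [h]
  rw [e]
  refine le_trans ?_ (sum_sum_test_le' C D (convPP (derivWeight a) b y)
    (l := fun n m => (n : ℤ) + m) (fun m n n' h => Subtype.ext (by simpa using h))
    (fun m n n' h => Subtype.ext (by simpa using h)) (fun n m => mem_box_of_abs_le ?_)
    fun n m => bracket_add_le _ _)
  · refine (norm_sum_le _ _).trans (Finset.sum_le_sum fun n₁ _ => (norm_sum_le _ _).trans
      (Finset.sum_le_sum fun n₂ _ => le_of_eq ?_))
    simp
  · have := n.abs_le
    have := m.abs_le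
    have := abs_add_le (n : ℤ) m
    omega

theorem norm_quadForm_le_YY13 (B D : Freq N → ℂ) (a c : Freq N → ℝ) (y : Freq N → ℂ) :
    ‖quadForm (smulSeq a y) B (smulSeq c y) D‖
      ≤ (normH B * normL D + normH D * normL B) * boxH N (convPM (derivWeight a) c y) := by
  have e : quadForm (smulSeq a y) B (smulSeq c y) D = ∑ n₂ : Freq N, ∑ n₄ : Freq N,
      B n₂ * starRingEnd ℂ (D n₄) * convPM (derivWeight a) c y ((n₄ : ℤ) - n₂) := by
    unfold quadForm convPM smulSeq derivWeight
    rw [sum_comm_2413]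
    simp only [Finset.mul_sum]
    refine Finset.sum_congr rfl fun n₂ _ => Finset.sum_congr rfl fun n₄ _ =>
      Finset.sum_congr rfl fun n₁ _ => Finset.sum_congr rfl fun n₃ _ => ?_
    by_cases h : (n₁ : ℤ) + n₂ = n₃ + n₄
    · have h' : (n₁ : ℤ) - n₃ = n₄ - n₂ := by omega
      simp only [h, h', if_true, map_mul, Complex.conj_ofReal]
      push_cast
      ring
    · have h' : ¬ (n₁ : ℤ) - n₃ = n₄ - n₂ := by omega
      simp [h, h']
  rw [e]
  refine le_trans ?_ (sum_sum_test_le' B D (convPM (derivWeight a) c y)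
    (l := fun n m => (m : ℤ) - n) (fun m n n' h => Subtype.ext (by simpa using h))
    (fun m n n' h => Subtype.ext (by simpa using h)) (fun n m => mem_box_of_abs_le ?_)
    fun n m => (bracket_sub_le _ _).trans (add_comm _ _).le)
  · refine (norm_sum_le _ _).trans (Finset.sum_le_sum fun n₁ _ => (norm_sum_le _ _).trans
      (Finset.sum_le_sum fun n₂ _ => le_of_eq ?_))
    simp
  · have := n.abs_le
    have := m.abs_le
    have := abs_sub (m : ℤ) n
    omega

theorem norm_quadForm_le_YY14 (B C : Freq N → ℂ) (a d : Freq N → ℝ) (y : Freq N → ℂ) :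
    ‖quadForm (smulSeq a y) B C (smulSeq d y)‖
      ≤ (normH B * normL C + normH C * normL B) * boxH N (convPM (derivWeight a) d y) := by
  rw [quadForm_swap]
  exact norm_quadForm_le_YY13 B C a d y

theorem norm_quadForm_le_YYY234 (A : Freq N → ℂ) (b c d : Freq N → ℝ) (y : Freq N → ℂ) :
    ‖quadForm A (smulSeq b y) (smulSeq c y) (smulSeq d y)‖
      ≤ normH A * boxE N (convPPM c d b y) := by
  have e : quadForm A (smulSeq b y) (smulSeq c y) (smulSeq d y) = ∑ n₁ : Freq N,
      ((n₁ : ℤ) : ℂ) * A n₁ * starRingEnd ℂ (convPPM c d b y n₁) := by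
    unfold quadForm convPPM smulSeq
    rw [sum_comm_1342]
    simp only [map_sum, Finset.mul_sum]
    refine Finset.sum_congr rfl fun n₁ _ => Finset.sum_congr rfl fun n₃ _ =>
      Finset.sum_congr rfl fun n₄ _ => Finset.sum_congr rfl fun n₂ _ => ?_
    by_cases h : (n₁ : ℤ) + n₂ = n₃ + n₄
    · have h' : (n₃ : ℤ) + n₄ - n₂ = n₁ := by omega
      simp only [h, h', if_true, map_mul, Complex.conj_ofReal, Complex.conj_conj]
      push_cast
      ring
    · have h' : ¬ (n₃ : ℤ) + n₄ - n₂ = n₁ := by omega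
      simp [h, h']
  rw [e]
  refine le_trans ((norm_sum_le _ _).trans (Finset.sum_le_sum fun n₁ _ => le_of_eq ?_))
    (sum_test_le A (convPPM c d b y))
  simp

theorem norm_quadForm_le_YYY134 (B : Freq N → ℂ) (a c d : Freq N → ℝ) (y : Freq N → ℂ) :
    ‖quadForm (smulSeq a y) B (smulSeq c y) (smulSeq d y)‖
      ≤ normH B * boxH N (convPPM c d (derivWeight a) y) := by
  have e : quadForm (smulSeq a y) B (smulSeq c y) (smulSeq d y) = ∑ n₂ : Freq N,
      B n₂ * starRingEnd ℂ (convPPM c d (derivWeight a) y n₂) := by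
    unfold quadForm convPPM smulSeq derivWeight
    rw [sum_comm_2341]
    simp only [map_sum, Finset.mul_sum]
    refine Finset.sum_congr rfl fun n₂ _ => Finset.sum_congr rfl fun n₃ _ =>
      Finset.sum_congr rfl fun n₄ _ => Finset.sum_congr rfl fun n₁ _ => ?_
    by_cases h : (n₁ : ℤ) + n₂ = n₃ + n₄
    · have h' : (n₃ : ℤ) + n₄ - n₁ = n₂ := by omega
      simp only [h, h', if_true, map_mul, Complex.conj_ofReal, Complex.conj_conj]
      push_cast
      ring
    · have h' : ¬ (n₃ : ℤ) + n₄ - n₁ = n₂ := by omega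
      simp [h, h']
  rw [e]
  refine le_trans ((norm_sum_le _ _).trans (Finset.sum_le_sum fun n₁ _ => le_of_eq ?_))
    (sum_test_le' B (convPPM c d (derivWeight a) y))
  simp

theorem norm_quadForm_le_YYY124 (C : Freq N → ℂ) (a b d : Freq N → ℝ) (y : Freq N → ℂ) :
    ‖quadForm (smulSeq a y) (smulSeq b y) C (smulSeq d y)‖
      ≤ normH C * boxH N (convPPM (derivWeight a) b d y) := by
  have e : quadForm (smulSeq a y) (smulSeq b y) C (smulSeq d y) = ∑ n₃ : Freq N,
      starRingEnd ℂ (C n₃) * convPPM (derivWeight a) b d y n₃ := by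
    unfold quadForm convPPM smulSeq derivWeight
    rw [sum_comm_3124]
    simp only [Finset.mul_sum]
    refine Finset.sum_congr rfl fun n₃ _ => Finset.sum_congr rfl fun n₁ _ =>
      Finset.sum_congr rfl fun n₂ _ => Finset.sum_congr rfl fun n₄ _ => ?_
    by_cases h : (n₁ : ℤ) + n₂ = n₃ + n₄
    · have h' : (n₁ : ℤ) + n₂ - n₄ = n₃ := by omega
      simp only [if_pos h, if_pos h', map_mul, Complex.conj_ofReal]
      push_cast
      ring
    · have h' : ¬ (n₁ : ℤ) + n₂ - n₄ = n₃ := by omega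
      simp [h, h']
  rw [e]
  refine le_trans ((norm_sum_le _ _).trans (Finset.sum_le_sum fun n₁ _ => le_of_eq ?_))
    (sum_test_le' C (convPPM (derivWeight a) b d y))
  simp

theorem norm_quadForm_le_YYY123 (D : Freq N → ℂ) (a b c : Freq N → ℝ) (y : Freq N → ℂ) :
    ‖quadForm (smulSeq a y) (smulSeq b y) (smulSeq c y) D‖
      ≤ normH D * boxH N (convPPM (derivWeight a) b c y) := by
  rw [quadForm_swap]
  exact norm_quadForm_le_YYY124 D a b c y

theorem quadForm_YYYY (a b c d : Freq N → ℝ) (y : Freq N → ℂ) :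
    quadForm (smulSeq a y) (smulSeq b y) (smulSeq c y) (smulSeq d y)
      = convPPMM (derivWeight a) b c d y := by
  unfold quadForm convPPMM smulSeq derivWeight
  refine Finset.sum_congr rfl fun n₃ _ => Finset.sum_congr rfl fun n₁ _ =>
    Finset.sum_congr rfl fun n₂ _ => Finset.sum_congr rfl fun n₄ _ => ?_
  split_ifs
  · simp only [map_mul, Complex.conj_ofReal]
    push_cast
    ring
  · rfl

theorem quadForm_expand (A A' B B' C C' D D' : Freq N → ℂ) :
    quadForm (A + A') (B + B') (C + C') (D + D')
      = quadForm A B C D + (quadForm A' B C D + quadForm A B' C D + quadForm A B C' D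
        + quadForm A B C D') + (quadForm A' B' C D + quadForm A' B C' D + quadForm A' B C D'
        + quadForm A B' C' D + quadForm A B' C D' + quadForm A B C' D')
        + (quadForm A B' C' D' + quadForm A' B C' D' + quadForm A' B' C D'
        + quadForm A' B' C' D) + quadForm A' B' C' D' := by
  simp only [quadForm_add_one, quadForm_add_two, quadForm_add_three, quadForm_add_four]
  ring

end QuadForm

end DNLS

namespace DNLS

/-! ### The random norms -/

section Coefficients

variable {T T' : Type*} [Fintype T] [Fintype T']

theorem sum_prod_mul (f : T → ℝ) (g : T' → ℝ) :
    ∑ p : T × T', f p.1 * g p.2 = (∑ t, f t) * ∑ t, g t := by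
  rw [Finset.sum_mul_sum, Fintype.sum_prod_type]

/-- For chaoses with a differentiated factor `f`, which is bounded but not square summable uniformly
in `N`. Summation over its frequency is paid by the weight `ω` at the output frequency. -/
theorem sum_prod_le_of_sum_le {ω : ℤ → ℝ} (hω : ∀ k, 0 ≤ ω k) (κ : T × T' → ℤ) {Ω B : ℝ}
    (hB : 0 ≤ B) (hΩ : ∀ t', ∑ t, ω (κ (t, t')) ≤ Ω) {f : T → ℝ} (hf : ∀ t, f t ^ 2 ≤ B)
    {g : T' → ℝ} (hg : ∀ t, 0 ≤ g t) :
    ∑ p : T × T', ω (κ p) * (f p.1 ^ 2 * g p.2) ≤ B * Ω * ∑ t, g t := by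
  rw [Fintype.sum_prod_type, Finset.sum_comm, Finset.mul_sum]
  refine Finset.sum_le_sum fun t' _ => ?_
  calc ∑ t, ω (κ (t, t')) * (f t ^ 2 * g t') ≤ ∑ t, (B * g t') * ω (κ (t, t')) := by
        refine Finset.sum_le_sum fun t _ => ?_
        rw [mul_comm (B * g t')]
        exact mul_le_mul_of_nonneg_left (mul_le_mul_of_nonneg_right (hf t) (hg t')) (hω _)
    _ ≤ (B * g t') * Ω := by
        rw [← Finset.mul_sum]
        exact mul_le_mul_of_nonneg_left (hΩ t') (mul_nonneg hB (hg t'))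
    _ = B * Ω * g t' := by ring

end Coefficients

variable {N : ℕ}

/-- The reflection of the frequencies. -/
def Freq.neg (n : Freq N) : Freq N :=
  ⟨-(n : ℤ), by have := Finset.mem_Icc.1 n.2; exact Finset.mem_Icc.2 (by omega)⟩

theorem Freq.neg_involutive : Function.Involutive (Freq.neg (N := N)) := fun n =>
  Subtype.ext (neg_neg (n : ℤ))

/-- An even sequence dominated by `M h^{1/2}`, where `h ≤ ⟨n⟩⁻²`. -/
structure IsWeight (M : ℝ) (h e : Freq N → ℝ) : Prop where
  nonneg : ∀ n, 0 ≤ h n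
  le_invSq : ∀ n, h n ≤ invSq n
  sq_le : ∀ n, e n ^ 2 ≤ M ^ 2 * h n
  even : ∀ n : Freq N, e n.neg = e n

namespace IsWeight

variable {M : ℝ} {h e e' : Freq N → ℝ}

theorem sum_sq_le (he : IsWeight M h e) : ∑ n, e n ^ 2 ≤ M ^ 2 * sumInvSq := by
  calc ∑ n, e n ^ 2 ≤ ∑ n : Freq N, M ^ 2 * invSq n :=
        Finset.sum_le_sum fun n _ => (he.sq_le n).trans
          (mul_le_mul_of_nonneg_left (he.le_invSq n) (sq_nonneg M))
    _ ≤ M ^ 2 * sumInvSq := by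
        rw [← Finset.mul_sum]
        exact mul_le_mul_of_nonneg_left (sum_invSq_le Subtype.val_injective) (sq_nonneg M)

theorem deriv_sq_le (he : IsWeight M h e) (n : Freq N) : derivWeight e n ^ 2 ≤ M ^ 2 := by
  have h1 := sq_mul_invSq_le_one n
  have h2 := he.sq_le n
  have h3 := he.le_invSq n
  unfold derivWeight
  calc (((n : ℤ) : ℝ) * e n) ^ 2 = ((n : ℤ) : ℝ) ^ 2 * e n ^ 2 := by ring
    _ ≤ ((n : ℤ) : ℝ) ^ 2 * (M ^ 2 * invSq n) := by gcongr; exact h2.trans (by gcongr)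
    _ = M ^ 2 * (((n : ℤ) : ℝ) ^ 2 * invSq n) := by ring
    _ ≤ M ^ 2 * 1 := by gcongr
    _ = M ^ 2 := mul_one _

/-- In `H⁻¹` a differentiated coefficient is as good as an undifferentiated one, provided that its
own frequency is the output frequency, as happens in the resonant terms. -/
theorem invSq_mul_deriv_sq_le (he : IsWeight M h e) (n : Freq N) :
    invSq n * derivWeight e n ^ 2 ≤ M ^ 2 * h n := by
  have h1 := sq_mul_invSq_le_one n
  have h2 := he.sq_le n
  unfold derivWeight
  calc invSq n * (((n : ℤ) : ℝ) * e n) ^ 2 = (((n : ℤ) : ℝ) ^ 2 * invSq n) * e n ^ 2 := by ring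
    _ ≤ 1 * (M ^ 2 * h n) :=
        mul_le_mul h1 h2 (sq_nonneg _) zero_le_one
    _ = _ := one_mul _

/-- The summand is odd under `n ↦ -n`. This is where the evenness of the coefficients enters: it
makes the resonant pairing with derivative centred. -/
theorem sum_derivWeight_mul (he : IsWeight M h e) (he' : IsWeight M h e') :
    ∑ n, derivWeight e n * e' n = 0 := by
  have h1 : ∑ n, derivWeight e n * e' n = ∑ n : Freq N, derivWeight e n.neg * e' n.neg :=
    (Equiv.sum_comp Freq.neg_involutive.toPerm fun n => derivWeight e n * e' n).symm
  have h2 : ∑ n : Freq N, derivWeight e n.neg * e' n.neg = -∑ n, derivWeight e n * e' n := by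
    rw [← Finset.sum_neg_distrib]
    refine Finset.sum_congr rfl fun n _ => ?_
    unfold derivWeight
    rw [he.even, he'.even]
    simp [Freq.neg]
  linarith

end IsWeight

theorem sum_invSq_add_le (m : ℤ) : ∑ n : Freq N, invSq ((n : ℤ) + m) ≤ sumInvSq :=
  sum_invSq_le fun a b hab => Subtype.ext (by simpa using hab)

theorem sum_invSq_sub_le (m : ℤ) : ∑ n : Freq N, invSq (m - (n : ℤ)) ≤ sumInvSq :=
  sum_invSq_le fun a b hab => Subtype.ext (by simpa using hab)

theorem pair_injective : Function.Injective fun t : Freq N × Freq N => ![t.1, t.2] := by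
  intro a b h
  have h0 := congrFun h 0
  have h1 := congrFun h 1
  simp only [Matrix.cons_val_zero, Matrix.cons_val_one] at h0 h1
  exact Prod.ext h0 h1

theorem triple_injective :
    Function.Injective fun t : Freq N × Freq N × Freq N => ![t.1, t.2.1, t.2.2] := by
  intro a b h
  have h0 := congrFun h 0
  have h1 := congrFun h 1
  have h2 := congrFun h 2
  simp at h0 h1 h2
  exact Prod.ext h0 (Prod.ext h1 h2)

theorem quadruple_injective :
    Function.Injective fun t : Freq N × Freq N × Freq N × Freq N =>
      ![t.1, t.2.1, t.2.2.1, t.2.2.2] := by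
  intro a b h
  have h0 := congrFun h 0
  have h1 := congrFun h 1
  have h2 := congrFun h 2
  have h3 := congrFun h 3
  simp at h0 h1 h2 h3
  exact Prod.ext h0 (Prod.ext h1 (Prod.ext h2 h3))

/-! ### Expectations of the random norms -/

section Expectations

variable {M : ℝ} {h e₁ e₂ e₃ e₄ : Freq N → ℝ} (K : Finset ℤ)

theorem integral_normPP_le (he₁ : IsWeight M h e₁) (he₂ : IsWeight M h e₂) :
    ∫ y, normPP e₁ e₂ (fun _ => 1) K y ∂(gaussianPi (Freq N))
      ≤ chaosConst 2 * ((M ^ 2 * sumInvSq) * (M ^ 2 * sumInvSq)) := by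
  refine (integral_chaosNorm_le two_ne_zero _ pair_injective _ _ (fun _ => zero_le_one) K).trans
    (mul_le_mul_of_nonneg_left ?_ (chaosConst_nonneg 2))
  simp_rw [one_mul, mul_pow]
  rw [sum_prod_mul (fun n => e₁ n ^ 2) fun n => e₂ n ^ 2]
  exact mul_le_mul he₁.sum_sq_le he₂.sum_sq_le (Finset.sum_nonneg fun _ _ => sq_nonneg _)
    (mul_nonneg (sq_nonneg M) sumInvSq_nonneg)

theorem integral_normPM_le (he₁ : IsWeight M h e₁) (he₂ : IsWeight M h e₂) :
    ∫ y, normPM e₁ e₂ (fun _ => 1) K y ∂(gaussianPi (Freq N))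
      ≤ chaosConst 2 * ((M ^ 2 * sumInvSq) * (M ^ 2 * sumInvSq)) := by
  refine (integral_chaosNorm_le two_ne_zero _ pair_injective _ _ (fun _ => zero_le_one) K).trans
    (mul_le_mul_of_nonneg_left ?_ (chaosConst_nonneg 2))
  simp_rw [one_mul, mul_pow]
  rw [sum_prod_mul (fun n => e₁ n ^ 2) fun n => e₂ n ^ 2]
  exact mul_le_mul he₁.sum_sq_le he₂.sum_sq_le (Finset.sum_nonneg fun _ _ => sq_nonneg _)
    (mul_nonneg (sq_nonneg M) sumInvSq_nonneg)

theorem integral_normPP_deriv_le (he₁ : IsWeight M h e₁) (he₂ : IsWeight M h e₂) :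
    ∫ y, normPP (derivWeight e₁) e₂ invSq K y ∂(gaussianPi (Freq N))
      ≤ chaosConst 2 * ((M ^ 2 * sumInvSq) * (M ^ 2 * sumInvSq)) := by
  refine (integral_chaosNorm_le two_ne_zero _ pair_injective _ _ (fun k => (invSq_pos k).le)
    K).trans (mul_le_mul_of_nonneg_left ?_ (chaosConst_nonneg 2))
  simp_rw [mul_pow]
  refine (sum_prod_le_of_sum_le (fun k => (invSq_pos k).le)
    (fun t : Freq N × Freq N => (t.1 : ℤ) + t.2) (sq_nonneg M)
    (fun n => sum_invSq_add_le (n : ℤ)) he₁.deriv_sq_le (g := fun n => e₂ n ^ 2)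
    fun _ => sq_nonneg _).trans ?_
  exact mul_le_mul_of_nonneg_left he₂.sum_sq_le (mul_nonneg (sq_nonneg M) sumInvSq_nonneg)

theorem integral_normPM_deriv_le (he₁ : IsWeight M h e₁) (he₂ : IsWeight M h e₂) :
    ∫ y, normPM (derivWeight e₁) e₂ invSq K y ∂(gaussianPi (Freq N))
      ≤ chaosConst 2 * ((M ^ 2 * sumInvSq) * (M ^ 2 * sumInvSq)) := by
  refine (integral_chaosNorm_le two_ne_zero _ pair_injective _ _ (fun k => (invSq_pos k).le)
    K).trans (mul_le_mul_of_nonneg_left ?_ (chaosConst_nonneg 2))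
  simp_rw [mul_pow]
  refine (sum_prod_le_of_sum_le (fun k => (invSq_pos k).le)
    (fun t : Freq N × Freq N => (t.1 : ℤ) - t.2) (sq_nonneg M)
    (fun n => by simpa [sub_eq_add_neg] using sum_invSq_add_le (N := N) (-n)) he₁.deriv_sq_le
    (g := fun n => e₂ n ^ 2) fun _ => sq_nonneg _).trans ?_
  exact mul_le_mul_of_nonneg_left he₂.sum_sq_le (mul_nonneg (sq_nonneg M) sumInvSq_nonneg)

theorem sum_prod_sq_mul_sq_le (he₁ : IsWeight M h e₁) (he₂ : IsWeight M h e₂) :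
    ∑ t : Freq N × Freq N, e₁ t.1 ^ 2 * e₂ t.2 ^ 2
      ≤ (M ^ 2 * sumInvSq) * (M ^ 2 * sumInvSq) := by
  rw [sum_prod_mul (fun n => e₁ n ^ 2) fun n => e₂ n ^ 2]
  exact mul_le_mul he₁.sum_sq_le he₂.sum_sq_le (Finset.sum_nonneg fun _ _ => sq_nonneg _)
    (mul_nonneg (sq_nonneg M) sumInvSq_nonneg)

theorem integral_normPPM_le (he₁ : IsWeight M h e₁) (he₂ : IsWeight M h e₂)
    (he₃ : IsWeight M h e₃) :
    ∫ y, normPPM e₁ e₂ e₃ (fun _ => 1) K y ∂(gaussianPi (Freq N))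
      ≤ chaosConst 3 * ((M ^ 2 * sumInvSq) * ((M ^ 2 * sumInvSq) * (M ^ 2 * sumInvSq))) := by
  refine (integral_chaosNorm_le three_ne_zero _ triple_injective _ _ (fun _ => zero_le_one)
    K).trans (mul_le_mul_of_nonneg_left ?_ (chaosConst_nonneg 3))
  have e : ∀ t : Freq N × Freq N × Freq N, (e₁ t.1 * e₂ t.2.1 * e₃ t.2.2) ^ 2
      = e₁ t.1 ^ 2 * (e₂ t.2.1 ^ 2 * e₃ t.2.2 ^ 2) := fun t => by ring
  simp_rw [one_mul, e]
  rw [sum_prod_mul (fun n => e₁ n ^ 2) fun t : Freq N × Freq N => e₂ t.1 ^ 2 * e₃ t.2 ^ 2]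
  exact mul_le_mul he₁.sum_sq_le (sum_prod_sq_mul_sq_le he₂ he₃)
    (Finset.sum_nonneg fun _ _ => by positivity) (mul_nonneg (sq_nonneg M) sumInvSq_nonneg)

theorem integral_normPPM_deriv_le (he₁ : IsWeight M h e₁) (he₂ : IsWeight M h e₂)
    (he₃ : IsWeight M h e₃) :
    ∫ y, normPPM (derivWeight e₁) e₂ e₃ invSq K y ∂(gaussianPi (Freq N))
      ≤ chaosConst 3 * ((M ^ 2 * sumInvSq) * ((M ^ 2 * sumInvSq) * (M ^ 2 * sumInvSq))) := by
  refine (integral_chaosNorm_le three_ne_zero _ triple_injective _ _ (fun k => (invSq_pos k).le)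
    K).trans (mul_le_mul_of_nonneg_left ?_ (chaosConst_nonneg 3))
  have e : ∀ t : Freq N × Freq N × Freq N, (derivWeight e₁ t.1 * e₂ t.2.1 * e₃ t.2.2) ^ 2
      = derivWeight e₁ t.1 ^ 2 * (e₂ t.2.1 ^ 2 * e₃ t.2.2 ^ 2) := fun t => by ring
  simp_rw [e]
  refine (sum_prod_le_of_sum_le (fun k => (invSq_pos k).le)
    (fun t : Freq N × Freq N × Freq N => (t.1 : ℤ) + t.2.1 - t.2.2) (sq_nonneg M)
    (fun t => by simpa [add_sub_assoc] using sum_invSq_add_le (N := N) ((t.1 : ℤ) - t.2))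
    he₁.deriv_sq_le (g := fun t : Freq N × Freq N => e₂ t.1 ^ 2 * e₃ t.2 ^ 2)
    fun _ => by positivity).trans ?_
  exact mul_le_mul_of_nonneg_left (sum_prod_sq_mul_sq_le he₂ he₃)
    (mul_nonneg (sq_nonneg M) sumInvSq_nonneg)

theorem integral_normPPM_deriv_last_le (he₁ : IsWeight M h e₁) (he₂ : IsWeight M h e₂)
    (he₃ : IsWeight M h e₃) :
    ∫ y, normPPM e₁ e₂ (derivWeight e₃) invSq K y ∂(gaussianPi (Freq N))
      ≤ chaosConst 3 * ((M ^ 2 * sumInvSq) * ((M ^ 2 * sumInvSq) * (M ^ 2 * sumInvSq))) := by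
  refine (integral_chaosNorm_le three_ne_zero _ triple_injective _ _ (fun k => (invSq_pos k).le)
    K).trans (mul_le_mul_of_nonneg_left ?_ (chaosConst_nonneg 3))
  -- The differentiated frequency is brought to the front, since it is the one to be summed against
  -- `invSq`.
  have e : ∑ t : Freq N × Freq N × Freq N,
      invSq ((t.1 : ℤ) + t.2.1 - t.2.2) * (e₁ t.1 * e₂ t.2.1 * derivWeight e₃ t.2.2) ^ 2
      = ∑ p : Freq N × (Freq N × Freq N), invSq ((p.2.1 : ℤ) + p.2.2 - p.1)
        * (derivWeight e₃ p.1 ^ 2 * (e₁ p.2.1 ^ 2 * e₂ p.2.2 ^ 2)) := by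
    simp_rw [Fintype.sum_prod_type]
    rw [Finset.sum_congr rfl fun _ _ => Finset.sum_comm, Finset.sum_comm]
    exact Finset.sum_congr rfl fun _ _ => Finset.sum_congr rfl fun _ _ =>
      Finset.sum_congr rfl fun _ _ => by ring
  rw [e]
  refine (sum_prod_le_of_sum_le (fun k => (invSq_pos k).le)
    (fun p : Freq N × Freq N × Freq N => (p.2.1 : ℤ) + p.2.2 - p.1) (sq_nonneg M)
    (fun t => sum_invSq_sub_le ((t.1 : ℤ) + t.2))
    he₃.deriv_sq_le (g := fun t : Freq N × Freq N => e₁ t.1 ^ 2 * e₂ t.2 ^ 2)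
    fun _ => by positivity).trans ?_
  exact mul_le_mul_of_nonneg_left (sum_prod_sq_mul_sq_le he₁ he₂)
    (mul_nonneg (sq_nonneg M) sumInvSq_nonneg)

theorem integral_normPPMM_deriv_le (he₁ : IsWeight M h e₁) (he₂ : IsWeight M h e₂)
    (he₃ : IsWeight M h e₃) (he₄ : IsWeight M h e₄) :
    ∫ y, normPPMM (derivWeight e₁) e₂ e₃ e₄ y ∂(gaussianPi (Freq N))
      ≤ chaosConst 4 * (M ^ 2 * ((M ^ 2 * sumInvSq) * ((M ^ 2 * sumInvSq)
        * (M ^ 2 * sumInvSq)))) := by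
  have hω : ∀ k : ℤ, (0 : ℝ) ≤ if k = 0 then 1 else 0 := fun k => by split_ifs <;> norm_num
  refine (integral_chaosNorm_le four_ne_zero _ quadruple_injective _ _ hω
    {0}).trans (mul_le_mul_of_nonneg_left ?_ (chaosConst_nonneg 4))
  have e : ∀ t : Freq N × Freq N × Freq N × Freq N,
      (derivWeight e₁ t.1 * e₂ t.2.1 * e₃ t.2.2.1 * e₄ t.2.2.2) ^ 2
      = derivWeight e₁ t.1 ^ 2 * (e₂ t.2.1 ^ 2 * (e₃ t.2.2.1 ^ 2 * e₄ t.2.2.2 ^ 2)) :=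
    fun t => by ring
  simp_rw [e]
  -- Once the other three frequencies are given, at most one `n₁` satisfies the linear relation;
  -- hence the value `1` for `Ω`.
  refine (sum_prod_le_of_sum_le hω (Ω := 1)
    (fun t : Freq N × Freq N × Freq N × Freq N => (t.1 : ℤ) + t.2.1 - t.2.2.1 - t.2.2.2)
    (sq_nonneg M) (fun t => ?_) he₁.deriv_sq_le
    (g := fun t : Freq N × Freq N × Freq N => e₂ t.1 ^ 2 * (e₃ t.2.1 ^ 2 * e₄ t.2.2 ^ 2))
    fun _ => by positivity).trans ?_
  · rw [← Finset.sum_filter, Finset.sum_const, nsmul_eq_mul, mul_one]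
    have : (Finset.univ.filter fun n : Freq N =>
        (n : ℤ) + t.1 - t.2.1 - t.2.2 = 0).card ≤ 1 := by
      rw [Finset.card_le_one]
      intro b hb c hc
      simp only [Finset.mem_filter, Finset.mem_univ, true_and] at hb hc
      exact Subtype.ext (by omega)
    exact_mod_cast this
  · rw [mul_one]
    refine mul_le_mul_of_nonneg_left ?_ (sq_nonneg M)
    rw [sum_prod_mul (fun n => e₂ n ^ 2)
      fun t : Freq N × Freq N => e₃ t.1 ^ 2 * e₄ t.2 ^ 2]
    exact mul_le_mul he₂.sum_sq_le (sum_prod_sq_mul_sq_le he₃ he₄)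
      (Finset.sum_nonneg fun _ _ => by positivity) (mul_nonneg (sq_nonneg M) sumInvSq_nonneg)

theorem memLp_norm_sq : MemLp (fun z : ℂ => ‖z‖ ^ 2) 2 stdComplexGaussian := by
  rw [memLp_two_iff_integrable_sq (by fun_prop)]
  exact (integrable_norm_pow 4).congr (.of_forall fun z => by simp only; ring)

theorem integrable_pairing_sq (a b : Freq N → ℝ) :
    Integrable (fun y => pairing a b y ^ 2) (gaussianPi (Freq N)) := by
  have : MemLp (pairing a b) 2 (gaussianPi (Freq N)) := by
    unfold pairing
    exact memLp_finsetSum _ fun n _ => (memLp_norm_sq.comp_measurePreserving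
      (measurePreserving_eval (fun _ : Freq N => stdComplexGaussian) n)).const_mul _
  exact this.integrable_sq

/-- The mean vanishes by oddness of the coefficients, so the second moment is the variance, which is
additive over the independent coordinates. The squared coefficients `M² e₂(n)²` are summable,
although the coefficients are only of size `1/⟨n⟩`. -/
theorem integral_pairing_sq_le (he₁ : IsWeight M h e₁) (he₂ : IsWeight M h e₂) :
    ∫ y, pairing (derivWeight e₁) e₂ y ^ 2 ∂(gaussianPi (Freq N))
      ≤ (∫ z, ‖z‖ ^ 4 ∂stdComplexGaussian) * (M ^ 2 * (M ^ 2 * sumInvSq)) := by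
  have hmean : ∫ y, pairing (derivWeight e₁) e₂ y ∂(gaussianPi (Freq N)) = 0 := by
    unfold pairing
    rw [integral_finsetSum _ fun n _ => (integrable_eval_norm_pow n 2).const_mul _]
    simp_rw [integral_const_mul, integral_eval_norm_pow]
    rw [← Finset.sum_mul, he₁.sum_derivWeight_mul he₂, zero_mul]
  have hmem : ∀ n : Freq N, MemLp (fun z : ℂ => derivWeight e₁ n * e₂ n * ‖z‖ ^ 2) 2
      stdComplexGaussian := fun n => memLp_norm_sq.const_mul _
  have hvar := variance_sum_pi (μ := fun _ : Freq N => stdComplexGaussian)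
    (X := fun n z => derivWeight e₁ n * e₂ n * ‖z‖ ^ 2) hmem
  have e : (∑ n : Freq N, fun y : Freq N → ℂ => derivWeight e₁ n * e₂ n * ‖y n‖ ^ 2)
      = pairing (derivWeight e₁) e₂ := by
    ext y; simp [pairing]
  rw [e] at hvar
  have hmeas : AEMeasurable (pairing (derivWeight e₁) e₂) (gaussianPi (Freq N)) := by
    refine Measurable.aemeasurable ?_
    unfold pairing
    fun_prop
  rw [variance_of_integral_eq_zero hmeas hmean] at hvar
  rw [hvar, Finset.sum_congr rfl fun n _ => variance_const_mul (derivWeight e₁ n * e₂ n)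
    (fun z : ℂ => ‖z‖ ^ 2) stdComplexGaussian, ← Finset.sum_mul, mul_comm]
  have hv : variance (fun z : ℂ => ‖z‖ ^ 2) stdComplexGaussian
      ≤ ∫ z, ‖z‖ ^ 4 ∂stdComplexGaussian := by
    refine (variance_le_expectation_sq (by fun_prop)).trans (le_of_eq ?_)
    refine integral_congr_ae (.of_forall fun z => ?_)
    simp only [Pi.pow_apply]
    ring
  refine mul_le_mul hv ?_ (Finset.sum_nonneg fun _ _ => sq_nonneg _)
    (integral_nonneg fun z => by positivity)
  calc ∑ n, (derivWeight e₁ n * e₂ n) ^ 2 ≤ ∑ n, M ^ 2 * e₂ n ^ 2 := by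
        refine Finset.sum_le_sum fun n _ => ?_
        rw [mul_pow]
        exact mul_le_mul_of_nonneg_right (he₁.deriv_sq_le n) (sq_nonneg _)
    _ ≤ M ^ 2 * (M ^ 2 * sumInvSq) := by
        rw [← Finset.mul_sum]
        exact mul_le_mul_of_nonneg_left he₂.sum_sq_le (sq_nonneg M)

/-- The sum `∑ |a(n) b(n) c(n) d(n)| |y(n)|⁴`. -/
noncomputable def diagonal (a b c d : Freq N → ℝ) (y : Freq N → ℂ) : ℝ :=
  ∑ n, |a n * b n * c n * d n| * ‖y n‖ ^ 4

/-- The diagonal needs no cancellation: two of the coefficients are bounded by `M`, the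
differentiated one included, and the other two together give the summable factor `M² h`. -/
theorem integral_diagonal_le (hM : 0 ≤ M) (he₁ : IsWeight M h e₁) (he₂ : IsWeight M h e₂)
    (he₃ : IsWeight M h e₃) (he₄ : IsWeight M h e₄) :
    ∫ y, diagonal (derivWeight e₁) e₂ e₃ e₄ y ∂(gaussianPi (Freq N))
      ≤ (∫ z, ‖z‖ ^ 4 ∂stdComplexGaussian) * (M ^ 2 * (M ^ 2 * sumInvSq)) := by
  unfold diagonal
  rw [integral_finsetSum _ fun n _ => (integrable_eval_norm_pow n 4).const_mul _]
  simp_rw [integral_const_mul, integral_eval_norm_pow]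
  rw [← Finset.sum_mul, mul_comm]
  refine mul_le_mul_of_nonneg_left ?_ (integral_nonneg fun z => by positivity)
  calc ∑ n, |derivWeight e₁ n * e₂ n * e₃ n * e₄ n| ≤ ∑ n : Freq N, M ^ 2 * (M ^ 2 * invSq n) := by
        refine Finset.sum_le_sum fun n _ => ?_
        have h0 := he₁.nonneg n
        have h1 : |derivWeight e₁ n| ≤ M := abs_le_of_sq_le_sq (he₁.deriv_sq_le n) hM
        have h2 : |e₂ n| ≤ M := abs_le_of_sq_le_sq ((he₂.sq_le n).trans
          (mul_le_of_le_one_right (sq_nonneg M) ((he₂.le_invSq n).trans (invSq_le_one n)))) hM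
        have h3 : |e₃ n * e₄ n| ≤ M ^ 2 * h n := by
          refine abs_le_of_sq_le_sq ?_ (by positivity)
          rw [mul_pow, sq (M ^ 2 * h n)]
          exact mul_le_mul (he₃.sq_le n) (he₄.sq_le n) (sq_nonneg _) (by positivity)
        calc |derivWeight e₁ n * e₂ n * e₃ n * e₄ n|
            = |derivWeight e₁ n| * |e₂ n| * |e₃ n * e₄ n| := by
              simp only [abs_mul]; ring
          _ ≤ M * M * (M ^ 2 * h n) := by gcongr
          _ ≤ M * M * (M ^ 2 * invSq n) := by gcongr; exact he₁.le_invSq n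
          _ = _ := by ring
    _ ≤ _ := by
        rw [← Finset.mul_sum, ← Finset.mul_sum]
        gcongr
        exact sum_invSq_le Subtype.val_injective

end Expectations

end DNLS

namespace DNLS

/-! ### The event on which all random norms are bounded -/

section Total

variable {N : ℕ}

/-- The sum of all random quantities that have to be bounded. -/
noncomputable def chaosTotal (e₁ e₂ e₃ e₄ : Freq N → ℝ) (y : Freq N → ℂ) : ℝ :=
  normPP e₃ e₄ (fun _ => 1) (box N) y + normPM e₂ e₃ (fun _ => 1) (box N) y
  + normPM e₂ e₄ (fun _ => 1) (box N) y + normPP (derivWeight e₁) e₂ invSq (box N) y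
  + normPM (derivWeight e₁) e₃ invSq (box N) y + normPM (derivWeight e₁) e₄ invSq (box N) y
  + normPPM e₃ e₄ e₂ (fun _ => 1) (box N) y + normPPM e₃ e₄ (derivWeight e₁) invSq (box N) y
  + normPPM (derivWeight e₁) e₂ e₃ invSq (box N) y
  + normPPM (derivWeight e₁) e₂ e₄ invSq (box N) y
  + normPPMM (derivWeight e₁) e₂ e₃ e₄ y
  + pairing (derivWeight e₁) e₃ y ^ 2 + pairing (derivWeight e₁) e₄ y ^ 2
  + diagonal (derivWeight e₁) e₂ e₃ e₄ y

theorem measurable_chaosNorm {d : ℕ} {T : Type*} [Fintype T] (σ : Fin d → Bool)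
    (n : T → Fin d → Freq N) (κ : T → ℤ) (a : T → ℝ) (ω : ℤ → ℝ) (K : Finset ℤ) :
    Measurable (chaosNorm σ n κ a ω K) := by
  classical
  refine Finset.measurable_sum _ fun k _ => Measurable.const_mul ?_ _
  simp_rw [chaosAt_eq]
  exact (measurable_chaos σ n _).norm.pow_const 2

theorem measurable_chaosTotal (e₁ e₂ e₃ e₄ : Freq N → ℝ) :
    Measurable (chaosTotal e₁ e₂ e₃ e₄) := by
  have hp : ∀ a b : Freq N → ℝ, Measurable fun y => pairing a b y ^ 2 := fun a b => by
    unfold pairing; fun_prop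
  have hd : ∀ a b c d : Freq N → ℝ, Measurable (diagonal a b c d) := fun a b c d => by
    unfold diagonal; fun_prop
  unfold chaosTotal
  exact (((((((((((((measurable_chaosNorm ..).add (measurable_chaosNorm ..)).add
    (measurable_chaosNorm ..)).add (measurable_chaosNorm ..)).add (measurable_chaosNorm ..)).add
    (measurable_chaosNorm ..)).add (measurable_chaosNorm ..)).add (measurable_chaosNorm ..)).add
    (measurable_chaosNorm ..)).add (measurable_chaosNorm ..)).add (measurable_chaosNorm ..)).add
    (hp _ _)).add (hp _ _)).add (hd _ _ _ _)

/-- A bound for each of the expectations. -/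
noncomputable def totalConst (M : ℝ) : ℝ :=
  (chaosConst 2 + chaosConst 3 + chaosConst 4 + ∫ z, ‖z‖ ^ 4 ∂stdComplexGaussian)
    * (M ^ 8 * (sumInvSq + 1) ^ 3)

theorem totalConst_nonneg {M : ℝ} (hM : 1 ≤ M) : 0 ≤ totalConst M := by
  have h2 := chaosConst_nonneg 2
  have h3 := chaosConst_nonneg 3
  have h4 := chaosConst_nonneg 4
  have hS := sumInvSq_nonneg
  have h5 : 0 ≤ ∫ z, ‖z‖ ^ 4 ∂stdComplexGaussian := integral_nonneg fun z => by positivity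
  unfold totalConst
  positivity

theorem integrable_chaosTotal (e₁ e₂ e₃ e₄ : Freq N → ℝ) :
    Integrable (chaosTotal e₁ e₂ e₃ e₄) (gaussianPi (Freq N)) := by
  have hd : Integrable (diagonal (derivWeight e₁) e₂ e₃ e₄) (gaussianPi (Freq N)) := by
    unfold diagonal
    exact integrable_finsetSum _ fun n _ => (integrable_eval_norm_pow n 4).const_mul _
  have c2 : (2 : ℕ) ≠ 0 := two_ne_zero
  have c3 : (3 : ℕ) ≠ 0 := three_ne_zero
  have c4 : (4 : ℕ) ≠ 0 := four_ne_zero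
  unfold chaosTotal
  exact (((((((((((((integrable_chaosNorm c2 ..).add (integrable_chaosNorm c2 ..)).add
    (integrable_chaosNorm c2 ..)).add (integrable_chaosNorm c2 ..)).add
    (integrable_chaosNorm c2 ..)).add (integrable_chaosNorm c2 ..)).add
    (integrable_chaosNorm c3 ..)).add (integrable_chaosNorm c3 ..)).add
    (integrable_chaosNorm c3 ..)).add (integrable_chaosNorm c3 ..)).add
    (integrable_chaosNorm c4 ..)).add (integrable_pairing_sq _ _)).add
    (integrable_pairing_sq _ _)).add hd

theorem integral_chaosTotal_le {M : ℝ} (hM : 1 ≤ M) {h e₁ e₂ e₃ e₄ : Freq N → ℝ}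
    (he₁ : IsWeight M h e₁) (he₂ : IsWeight M h e₂) (he₃ : IsWeight M h e₃)
    (he₄ : IsWeight M h e₄) :
    ∫ y, chaosTotal e₁ e₂ e₃ e₄ y ∂(gaussianPi (Freq N)) ≤ 14 * totalConst M := by
  have hd : Integrable (diagonal (derivWeight e₁) e₂ e₃ e₄) (gaussianPi (Freq N)) := by
    unfold diagonal
    exact integrable_finsetSum _ fun n _ => (integrable_eval_norm_pow n 4).const_mul _
  have h2 := chaosConst_nonneg 2
  have h3 := chaosConst_nonneg 3
  have h4 := chaosConst_nonneg 4
  have h5 : 0 ≤ ∫ z, ‖z‖ ^ 4 ∂stdComplexGaussian := integral_nonneg fun z => by positivity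
  have hS := sumInvSq_nonneg
  have hM0 : 0 ≤ M := by linarith
  set S := sumInvSq with hSdef
  set D := M ^ 8 * (S + 1) ^ 3 with hD
  have pw : ∀ k ≤ 8, M ^ k ≤ M ^ 8 := fun k hk => pow_le_pow_right₀ hM hk
  have sw : ∀ k ≤ 3, S ^ k ≤ (S + 1) ^ 3 := fun k hk =>
    (pow_le_pow_left₀ hS (by linarith) k).trans (pow_le_pow_right₀ (by linarith) hk)
  have b2 : (M ^ 2 * S) * (M ^ 2 * S) ≤ D := by
    calc (M ^ 2 * S) * (M ^ 2 * S) = M ^ 4 * S ^ 2 := by ring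
      _ ≤ D := mul_le_mul (pw 4 (by norm_num)) (sw 2 (by norm_num)) (by positivity) (by positivity)
  have b3 : (M ^ 2 * S) * ((M ^ 2 * S) * (M ^ 2 * S)) ≤ D := by
    calc (M ^ 2 * S) * ((M ^ 2 * S) * (M ^ 2 * S)) = M ^ 6 * S ^ 3 := by ring
      _ ≤ D := mul_le_mul (pw 6 (by norm_num)) (sw 3 (by norm_num)) (by positivity) (by positivity)
  have b4 : M ^ 2 * ((M ^ 2 * S) * ((M ^ 2 * S) * (M ^ 2 * S))) ≤ D := by
    calc M ^ 2 * ((M ^ 2 * S) * ((M ^ 2 * S) * (M ^ 2 * S))) = M ^ 8 * S ^ 3 := by ring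
      _ ≤ D := mul_le_mul (pw 8 (by norm_num)) (sw 3 (by norm_num)) (by positivity) (by positivity)
  have b1 : M ^ 2 * (M ^ 2 * S) ≤ D := by
    calc M ^ 2 * (M ^ 2 * S) = M ^ 4 * S ^ 1 := by ring
      _ ≤ D := mul_le_mul (pw 4 (by norm_num)) (sw 1 (by norm_num)) (by positivity) (by positivity)
  have hD0 : 0 ≤ D := by positivity
  have q2 : chaosConst 2 * ((M ^ 2 * S) * (M ^ 2 * S)) ≤ totalConst M := by
    unfold totalConst
    exact mul_le_mul (by linarith) b2 (by positivity) (by positivity)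
  have q3 : chaosConst 3 * ((M ^ 2 * S) * ((M ^ 2 * S) * (M ^ 2 * S))) ≤ totalConst M := by
    unfold totalConst
    exact mul_le_mul (by linarith) b3 (by positivity) (by positivity)
  have q4 : chaosConst 4 * (M ^ 2 * ((M ^ 2 * S) * ((M ^ 2 * S) * (M ^ 2 * S))))
      ≤ totalConst M := by
    unfold totalConst
    exact mul_le_mul (by linarith) b4 (by positivity) (by positivity)
  have q1 : (∫ z, ‖z‖ ^ 4 ∂stdComplexGaussian) * (M ^ 2 * (M ^ 2 * S)) ≤ totalConst M := by
    unfold totalConst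
    exact mul_le_mul (by linarith) b1 (by positivity) (by positivity)
  have c2 : (2 : ℕ) ≠ 0 := two_ne_zero
  have c3 : (3 : ℕ) ≠ 0 := three_ne_zero
  have c4 : (4 : ℕ) ≠ 0 := four_ne_zero
  have i1 := (integrable_chaosNorm c2 ![true, true] (fun t : Freq N × Freq N => ![t.1, t.2])
    (fun t => (t.1 : ℤ) + t.2) (fun t => e₃ t.1 * e₄ t.2) (fun _ => 1) (box N))
  have a1 := i1
  have a2 := a1.add (integrable_chaosNorm c2 ![true, false]
    (fun t : Freq N × Freq N => ![t.1, t.2])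
    (fun t => (t.1 : ℤ) - t.2) (fun t => e₂ t.1 * e₃ t.2) (fun _ => 1) (box N))
  have a3 := a2.add (integrable_chaosNorm c2 ![true, false]
    (fun t : Freq N × Freq N => ![t.1, t.2])
    (fun t => (t.1 : ℤ) - t.2) (fun t => e₂ t.1 * e₄ t.2) (fun _ => 1) (box N))
  have a4 := a3.add (integrable_chaosNorm c2 ![true, true]
    (fun t : Freq N × Freq N => ![t.1, t.2])
    (fun t => (t.1 : ℤ) + t.2) (fun t => derivWeight e₁ t.1 * e₂ t.2) invSq (box N))
  have a5 := a4.add (integrable_chaosNorm c2 ![true, false]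
    (fun t : Freq N × Freq N => ![t.1, t.2])
    (fun t => (t.1 : ℤ) - t.2) (fun t => derivWeight e₁ t.1 * e₃ t.2) invSq (box N))
  have a6 := a5.add (integrable_chaosNorm c2 ![true, false]
    (fun t : Freq N × Freq N => ![t.1, t.2])
    (fun t => (t.1 : ℤ) - t.2) (fun t => derivWeight e₁ t.1 * e₄ t.2) invSq (box N))
  have j3 := fun (a b c : Freq N → ℝ) (ω : ℤ → ℝ) => integrable_chaosNorm c3
    ![true, true, false] (fun t : Freq N × Freq N × Freq N => ![t.1, t.2.1, t.2.2])
    (fun t => (t.1 : ℤ) + t.2.1 - t.2.2) (fun t => a t.1 * b t.2.1 * c t.2.2) ω (box N)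
  have a7 := a6.add (j3 e₃ e₄ e₂ fun _ => 1)
  have a8 := a7.add (j3 e₃ e₄ (derivWeight e₁) invSq)
  have a9 := a8.add (j3 (derivWeight e₁) e₂ e₃ invSq)
  have a10 := a9.add (j3 (derivWeight e₁) e₂ e₄ invSq)
  have j4 : Integrable (normPPMM (derivWeight e₁) e₂ e₃ e₄) (gaussianPi (Freq N)) :=
    integrable_chaosNorm c4 ..
  have a11 := a10.add j4
  have a12 := a11.add (integrable_pairing_sq (derivWeight e₁) e₃)
  have a13 := a12.add (integrable_pairing_sq (derivWeight e₁) e₄)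
  have t1 := (integral_normPP_le (box N) he₃ he₄).trans q2
  have t2 := (integral_normPM_le (box N) he₂ he₃).trans q2
  have t3 := (integral_normPM_le (box N) he₂ he₄).trans q2
  have t4 := (integral_normPP_deriv_le (box N) he₁ he₂).trans q2
  have t5 := (integral_normPM_deriv_le (box N) he₁ he₃).trans q2
  have t6 := (integral_normPM_deriv_le (box N) he₁ he₄).trans q2
  have t7 := (integral_normPPM_le (box N) he₃ he₄ he₂).trans q3
  have t8 := (integral_normPPM_deriv_last_le (box N) he₃ he₄ he₁).trans q3
  have t9 := (integral_normPPM_deriv_le (box N) he₁ he₂ he₃).trans q3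
  have t10 := (integral_normPPM_deriv_le (box N) he₁ he₂ he₄).trans q3
  have t11 := (integral_normPPMM_deriv_le he₁ he₂ he₃ he₄).trans q4
  have t12 := (integral_pairing_sq_le he₁ he₃).trans q1
  have t13 := (integral_pairing_sq_le he₁ he₄).trans q1
  have t14 := (integral_diagonal_le hM0 he₁ he₂ he₃ he₄).trans q1
  have e := integral_add a13 hd
  rw [integral_add' a12 (integrable_pairing_sq (derivWeight e₁) e₄),
    integral_add' a11 (integrable_pairing_sq (derivWeight e₁) e₃), integral_add' a10 j4,
    integral_add' a9 (j3 (derivWeight e₁) e₂ e₄ invSq),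
    integral_add' a8 (j3 (derivWeight e₁) e₂ e₃ invSq),
    integral_add' a7 (j3 e₃ e₄ (derivWeight e₁) invSq),
    integral_add' a6 (j3 e₃ e₄ e₂ fun _ => 1),
    integral_add' a5 (integrable_chaosNorm c2 ..), integral_add' a4 (integrable_chaosNorm c2 ..),
    integral_add' a3 (integrable_chaosNorm c2 ..), integral_add' a2 (integrable_chaosNorm c2 ..),
    integral_add' a1 (integrable_chaosNorm c2 ..)] at e
  refine (le_of_eq e).trans ?_
  unfold normPP at t1 t4
  unfold normPM at t2 t3 t5 t6
  unfold normPPM at t7 t8 t9 t10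
  linarith

/-- The bounds for products of Gaussian sequences that are used in the deterministic estimate. -/
structure RandomNormBounds (R : ℝ) (e₁ e₂ e₃ e₄ : Freq N → ℝ) (y : Freq N → ℂ) : Prop where
  pp34 : boxE N (convPP e₃ e₄ y) ≤ R
  pm23 : boxE N (convPM e₂ e₃ y) ≤ R
  pm24 : boxE N (convPM e₂ e₄ y) ≤ R
  pp12 : boxH N (convPP (derivWeight e₁) e₂ y) ≤ R
  pm13 : boxH N (convPM (derivWeight e₁) e₃ y) ≤ R
  pm14 : boxH N (convPM (derivWeight e₁) e₄ y) ≤ R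
  ppm234 : boxE N (convPPM e₃ e₄ e₂ y) ≤ R
  ppm134 : boxH N (convPPM e₃ e₄ (derivWeight e₁) y) ≤ R
  ppm123 : boxH N (convPPM (derivWeight e₁) e₂ e₃ y) ≤ R
  ppm124 : boxH N (convPPM (derivWeight e₁) e₂ e₄ y) ≤ R
  ppmm : ‖convPPMM (derivWeight e₁) e₂ e₃ e₄ y‖ ≤ R

/-- A pairing without derivative requires no probability: it is dominated by the squared `L²` norm
of the random part, which is at most `1` on the chosen event. -/
theorem abs_pairing_le {M : ℝ} {h a b : Freq N → ℝ} (ha : IsWeight M h a)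
    (hb : IsWeight M h b) {y : Freq N → ℂ} (hq : ∑ n, h n * ‖y n‖ ^ 2 ≤ 1) :
    |pairing a b y| ≤ M ^ 2 := by
  have h1 : ∀ n, |a n * b n| ≤ M ^ 2 * h n := fun n => by
    have := ha.nonneg n
    refine abs_le_of_sq_le_sq ?_ (by positivity)
    rw [mul_pow, sq (M ^ 2 * h n)]
    exact mul_le_mul (ha.sq_le n) (hb.sq_le n) (sq_nonneg _) (by positivity)
  calc |pairing a b y| ≤ ∑ n, |a n * b n * ‖y n‖ ^ 2| := Finset.abs_sum_le_sum_abs _ _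
    _ ≤ ∑ n, M ^ 2 * (h n * ‖y n‖ ^ 2) := by
        refine Finset.sum_le_sum fun n _ => ?_
        rw [abs_mul, abs_of_nonneg (sq_nonneg ‖y n‖), ← mul_assoc]
        exact mul_le_mul_of_nonneg_right (h1 n) (sq_nonneg _)
    _ ≤ M ^ 2 := by
        rw [← Finset.mul_sum]
        exact mul_le_of_le_one_right (sq_nonneg M) hq

theorem sum_weight_le {M : ℝ} {h a : Freq N → ℝ} (ha : ∀ n, a n ≤ M ^ 2 * h n)
    {y : Freq N → ℂ} (hq : ∑ n, h n * ‖y n‖ ^ 2 ≤ 1) : ∑ n, a n * ‖y n‖ ^ 2 ≤ M ^ 2 := by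
  calc ∑ n, a n * ‖y n‖ ^ 2 ≤ ∑ n, M ^ 2 * (h n * ‖y n‖ ^ 2) := by
        refine Finset.sum_le_sum fun n _ => ?_
        rw [← mul_assoc]
        exact mul_le_mul_of_nonneg_right (ha n) (sq_nonneg _)
    _ ≤ M ^ 2 := by
        rw [← Finset.mul_sum]
        exact mul_le_of_le_one_right (sq_nonneg M) hq

/-- Each term `h n * ‖y n‖²` is at most `1`, so its cube is at most itself and the sum of the cubes
is controlled by the `L²` norm. -/
theorem sum_weight_cube_le {M : ℝ} {h a b c : Freq N → ℝ} (h0 : ∀ n, 0 ≤ h n)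
    (ha0 : ∀ n, 0 ≤ a n) (hb0 : ∀ n, 0 ≤ b n) (hc0 : ∀ n, 0 ≤ c n)
    (ha : ∀ n, a n ≤ M ^ 2 * h n) (hb : ∀ n, b n ≤ M ^ 2 * h n) (hc : ∀ n, c n ≤ M ^ 2 * h n)
    {y : Freq N → ℂ} (hq : ∑ n, h n * ‖y n‖ ^ 2 ≤ 1) :
    ∑ n, a n * b n * c n * ‖y n‖ ^ 6 ≤ M ^ 6 := by
  have h1 : ∀ n, h n * ‖y n‖ ^ 2 ≤ 1 := fun n =>
    (Finset.single_le_sum (f := fun n => h n * ‖y n‖ ^ 2)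
      (fun n _ => mul_nonneg (h0 n) (sq_nonneg _)) (Finset.mem_univ n)).trans hq
  calc ∑ n, a n * b n * c n * ‖y n‖ ^ 6 ≤ ∑ n, M ^ 6 * (h n * ‖y n‖ ^ 2) := by
        refine Finset.sum_le_sum fun n _ => ?_
        have hn := h0 n
        have hb' := hb0 n
        have hc' := hc0 n
        have ha' := ha0 n
        have hp : 0 ≤ h n * ‖y n‖ ^ 2 := by positivity
        calc a n * b n * c n * ‖y n‖ ^ 6
            ≤ (M ^ 2 * h n) * (M ^ 2 * h n) * (M ^ 2 * h n) * ‖y n‖ ^ 6 := by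
              gcongr
              · exact ha n
              · exact hb n
              · exact hc n
          _ = M ^ 6 * (h n * ‖y n‖ ^ 2) ^ 3 := by ring
          _ ≤ M ^ 6 * (h n * ‖y n‖ ^ 2) := by
              refine mul_le_mul_of_nonneg_left ?_ (by positivity)
              exact pow_le_of_le_one hp (h1 n) three_ne_zero
    _ ≤ M ^ 6 := by
        rw [← Finset.mul_sum]
        exact mul_le_of_le_one_right (by positivity) hq

theorem pairing_comm (a b : Freq N → ℝ) (y : Freq N → ℂ) : pairing a b y = pairing b a y := by
  unfold pairing
  exact Finset.sum_congr rfl fun n _ => by ring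

/-- Each convolution is its part without resonances plus pairings. In the pairings, those with
derivative are bounded by `r` through `chaosTotal`, those without by powers of `M` through the `L²`
norm. The constant is generous so that one number serves all eleven bounds. -/
theorem randomNormBounds_of_chaosTotal_le {M : ℝ} (hM : 1 ≤ M) {h e₁ e₂ e₃ e₄ : Freq N → ℝ}
    (he₁ : IsWeight M h e₁) (he₂ : IsWeight M h e₂) (he₃ : IsWeight M h e₃)
    (he₄ : IsWeight M h e₄) {y : Freq N → ℂ} {r : ℝ} (hr : chaosTotal e₁ e₂ e₃ e₄ y ≤ r)
    (hq : ∑ n, h n * ‖y n‖ ^ 2 ≤ 1) :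
    RandomNormBounds (16 * M ^ 6 * (r + 1)) e₁ e₂ e₃ e₄ y := by
  have w1 : ∀ k : ℤ, (0 : ℝ) ≤ (fun _ : ℤ => (1 : ℝ)) k := fun _ => zero_le_one
  have w2 : ∀ k : ℤ, 0 ≤ invSq k := fun k => (invSq_pos k).le
  have w3 : ∀ k : ℤ, (0 : ℝ) ≤ if k = 0 then 1 else 0 := fun k => by split_ifs <;> norm_num
  set f := derivWeight e₁ with hf
  have n1 : 0 ≤ normPP e₃ e₄ (fun _ => 1) (box N) y := chaosNorm_nonneg w1 y
  have n2 : 0 ≤ normPM e₂ e₃ (fun _ => 1) (box N) y := chaosNorm_nonneg w1 y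
  have n3 : 0 ≤ normPM e₂ e₄ (fun _ => 1) (box N) y := chaosNorm_nonneg w1 y
  have n4 : 0 ≤ normPP f e₂ invSq (box N) y := chaosNorm_nonneg w2 y
  have n5 : 0 ≤ normPM f e₃ invSq (box N) y := chaosNorm_nonneg w2 y
  have n6 : 0 ≤ normPM f e₄ invSq (box N) y := chaosNorm_nonneg w2 y
  have n7 : 0 ≤ normPPM e₃ e₄ e₂ (fun _ => 1) (box N) y := chaosNorm_nonneg w1 y
  have n8 : 0 ≤ normPPM e₃ e₄ f invSq (box N) y := chaosNorm_nonneg w2 y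
  have n9 : 0 ≤ normPPM f e₂ e₃ invSq (box N) y := chaosNorm_nonneg w2 y
  have n10 : 0 ≤ normPPM f e₂ e₄ invSq (box N) y := chaosNorm_nonneg w2 y
  have n11 : 0 ≤ normPPMM f e₂ e₃ e₄ y := chaosNorm_nonneg w3 y
  have n12 := sq_nonneg (pairing f e₃ y)
  have n13 := sq_nonneg (pairing f e₄ y)
  have n14 : 0 ≤ diagonal f e₂ e₃ e₄ y :=
    Finset.sum_nonneg fun n _ => mul_nonneg (abs_nonneg _) (by positivity)
  unfold chaosTotal at hr
  have hr0 : 0 ≤ r := by linarith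
  set R := 16 * M ^ 6 * (r + 1) with hR
  have hM6 : 1 ≤ M ^ 6 := one_le_pow₀ hM
  have hM26 : M ^ 2 ≤ M ^ 6 := pow_le_pow_right₀ hM (by norm_num)
  have hM46 : M ^ 4 ≤ M ^ 6 := pow_le_pow_right₀ hM (by norm_num)
  have hM2 : 1 ≤ M ^ 2 := one_le_pow₀ hM
  have hr6 : r ≤ r * M ^ 6 := le_mul_of_one_le_right hr0 hM6
  have hr26 : r * M ^ 2 ≤ r * M ^ 6 := mul_le_mul_of_nonneg_left hM26 hr0
  have hRe : R = 16 * (r * M ^ 6) + 16 * M ^ 6 := by rw [hR]; ring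
  have hrM : 0 ≤ r * M ^ 6 := mul_nonneg hr0 (zero_le_one.trans hM6)
  have hR1 : 1 ≤ R := by rw [hRe]; linarith only [hrM, hM6]
  -- Because `R ≥ 1`, it suffices to bound the squared norms by `R` itself.
  have root : ∀ x : ℝ, x ≤ R → Real.sqrt x ≤ R := fun x hx =>
    Real.sqrt_le_iff.2 ⟨zero_le_one.trans hR1, hx.trans (le_self_pow₀ hR1 two_ne_zero)⟩
  have p4 : ∀ {a b : Freq N → ℝ}, IsWeight M h a → IsWeight M h b → pairing a b y ^ 2 ≤ M ^ 4 :=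
    fun ha hb => by
      have := abs_pairing_le ha hb hq
      calc pairing _ _ y ^ 2 = |pairing _ _ y| ^ 2 := (sq_abs _).symm
        _ ≤ (M ^ 2) ^ 2 := by gcongr
        _ = M ^ 4 := by ring
  have h0 := he₁.nonneg
  have s1 : ∀ {a : Freq N → ℝ}, IsWeight M h a →
      ∑ n : Freq N, (1 : ℝ) * (a n ^ 2 * ‖y n‖ ^ 2) ≤ M ^ 2 := fun ha => by
    simp only [one_mul]
    exact sum_weight_le ha.sq_le hq
  have s2 : ∀ {a : Freq N → ℝ}, IsWeight M h a →
      ∑ n : Freq N, invSq n * (a n ^ 2 * ‖y n‖ ^ 2) ≤ M ^ 2 := fun {a} ha =>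
    (Finset.sum_le_sum fun n _ => mul_le_of_le_one_left
      (by positivity : 0 ≤ a n ^ 2 * ‖y n‖ ^ 2) (invSq_le_one n)).trans
      (sum_weight_le ha.sq_le hq)
  have s3 : ∑ n : Freq N, invSq n * (f n ^ 2 * ‖y n‖ ^ 2) ≤ M ^ 2 := by
    simp only [← mul_assoc]
    exact sum_weight_le he₁.invSq_mul_deriv_sq_le hq
  have c1 : ∑ n : Freq N, (1 : ℝ) * (e₃ n ^ 2 * e₄ n ^ 2 * e₂ n ^ 2 * ‖y n‖ ^ 6) ≤ M ^ 6 := by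
    simp only [one_mul]
    exact sum_weight_cube_le h0 (fun _ => sq_nonneg _) (fun _ => sq_nonneg _)
      (fun _ => sq_nonneg _) he₃.sq_le he₄.sq_le he₂.sq_le hq
  have c2 : ∀ {a b : Freq N → ℝ}, IsWeight M h a → IsWeight M h b →
      ∑ n : Freq N, (invSq n * f n ^ 2) * a n ^ 2 * b n ^ 2 * ‖y n‖ ^ 6 ≤ M ^ 6 := fun ha hb =>
    sum_weight_cube_le h0 (fun n => mul_nonneg (w2 n) (sq_nonneg _)) (fun _ => sq_nonneg _)
      (fun _ => sq_nonneg _) he₁.invSq_mul_deriv_sq_le ha.sq_le hb.sq_le hq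
  have pr : ∀ {x s X B : ℝ}, 0 ≤ s → 0 ≤ X → x ≤ X → s ≤ B → x * s ≤ X * B :=
    fun hs hX hx hsB => mul_le_mul hx hsB hs hX
  have sn : ∀ (ω : ℤ → ℝ) (a : Freq N → ℝ), (∀ k, 0 ≤ ω k) →
      0 ≤ ∑ n : Freq N, ω n * (a n ^ 2 * ‖y n‖ ^ 2) := fun ω a hω =>
    Finset.sum_nonneg fun n _ => mul_nonneg (hω _) (by positivity)
  have m46 : M ^ 4 * M ^ 2 = M ^ 6 := by ring
  have i0 : invSq 0 ≤ 1 := invSq_le_one 0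
  have hpos4 : 0 ≤ M ^ 4 := by positivity
  refine ⟨?_, ?_, ?_, ?_, ?_, ?_, ?_, ?_, ?_, ?_, ?_⟩
  · refine root _ ?_
    rw [sum_norm_convPP e₃ e₄ (fun _ => 1)]
    linarith
  · refine root _ ((sum_norm_convPM_le e₂ e₃ w1 _ y).trans ?_)
    have := p4 he₂ he₃
    simp only [one_mul]
    linarith
  · refine root _ ((sum_norm_convPM_le e₂ e₄ w1 _ y).trans ?_)
    have := p4 he₂ he₄
    simp only [one_mul]
    linarith
  · refine root _ ?_
    rw [sum_norm_convPP f e₂ invSq]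
    linarith
  · refine root _ ((sum_norm_convPM_le f e₃ w2 _ y).trans ?_)
    have := mul_le_of_le_one_left n12 i0
    linarith
  · refine root _ ((sum_norm_convPM_le f e₄ w2 _ y).trans ?_)
    have := mul_le_of_le_one_left n13 i0
    linarith
  · refine root _ ((sum_norm_convPPM_le e₃ e₄ e₂ w1 _ y).trans ?_)
    have t1 := pr (sn (fun _ => 1) e₄ w1) hpos4 (p4 he₃ he₂) (s1 he₄)
    have t2 := pr (sn (fun _ => 1) e₃ w1) hpos4 (p4 he₄ he₂) (s1 he₃)
    rw [m46] at t1 t2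
    linarith
  · refine root _ ((sum_norm_convPPM_le e₃ e₄ f w2 _ y).trans ?_)
    rw [pairing_comm e₃ f, pairing_comm e₄ f]
    have t1 := pr (sn invSq e₄ w2) hr0 (show pairing f e₃ y ^ 2 ≤ r by linarith) (s2 he₄)
    have t2 := pr (sn invSq e₃ w2) hr0 (show pairing f e₄ y ^ 2 ≤ r by linarith) (s2 he₃)
    have t3 := c2 he₃ he₄
    have e : ∑ n : Freq N, invSq n * (e₃ n ^ 2 * e₄ n ^ 2 * f n ^ 2 * ‖y n‖ ^ 6)
        = ∑ n : Freq N, (invSq n * f n ^ 2) * e₃ n ^ 2 * e₄ n ^ 2 * ‖y n‖ ^ 6 :=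
      Finset.sum_congr rfl fun n _ => by ring
    rw [e]
    linarith
  · refine root _ ((sum_norm_convPPM_le f e₂ e₃ w2 _ y).trans ?_)
    have t1 := pr (sn invSq e₂ w2) hr0 (show pairing f e₃ y ^ 2 ≤ r by linarith) (s2 he₂)
    have t2 := pr (sn invSq f w2) hpos4 (p4 he₂ he₃) s3
    have t3 := c2 he₂ he₃
    have e : ∑ n : Freq N, invSq n * (f n ^ 2 * e₂ n ^ 2 * e₃ n ^ 2 * ‖y n‖ ^ 6)
        = ∑ n : Freq N, (invSq n * f n ^ 2) * e₂ n ^ 2 * e₃ n ^ 2 * ‖y n‖ ^ 6 :=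
      Finset.sum_congr rfl fun n _ => by ring
    rw [e]
    rw [m46] at t2
    linarith
  · refine root _ ((sum_norm_convPPM_le f e₂ e₄ w2 _ y).trans ?_)
    have t1 := pr (sn invSq e₂ w2) hr0 (show pairing f e₄ y ^ 2 ≤ r by linarith) (s2 he₂)
    have t2 := pr (sn invSq f w2) hpos4 (p4 he₂ he₄) s3
    have t3 := c2 he₂ he₄
    have e : ∑ n : Freq N, invSq n * (f n ^ 2 * e₂ n ^ 2 * e₄ n ^ 2 * ‖y n‖ ^ 6)
        = ∑ n : Freq N, (invSq n * f n ^ 2) * e₂ n ^ 2 * e₄ n ^ 2 * ‖y n‖ ^ 6 :=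
      Finset.sum_congr rfl fun n _ => by ring
    rw [e]
    rw [m46] at t2
    linarith
  · rw [convPPMM_eq]
    have hn : ‖chaosAt ![true, true, false, false]
        (fun t : Freq N × Freq N × Freq N × Freq N => ![t.1, t.2.1, t.2.2.1, t.2.2.2])
        (fun t => (t.1 : ℤ) + t.2.1 - t.2.2.1 - t.2.2.2)
        (fun t => f t.1 * e₂ t.2.1 * e₃ t.2.2.1 * e₄ t.2.2.2) y 0‖ ^ 2 ≤ r := by
      have e : normPPMM f e₂ e₃ e₄ y = ‖chaosAt ![true, true, false, false]
        (fun t : Freq N × Freq N × Freq N × Freq N => ![t.1, t.2.1, t.2.2.1, t.2.2.2])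
        (fun t => (t.1 : ℤ) + t.2.1 - t.2.2.1 - t.2.2.2)
        (fun t => f t.1 * e₂ t.2.1 * e₃ t.2.2.1 * e₄ t.2.2.2) y 0‖ ^ 2 := by
        simp [normPPMM, chaosNorm]
      linarith
    have sq1 : ∀ {x : ℝ}, x ^ 2 ≤ r → |x| ≤ r + 1 := fun {x} hx =>
      abs_le_of_sq_le_sq
        (by linarith only [hx, sq_nonneg r, hr0, (by ring : (r + 1) ^ 2 = r ^ 2 + 2 * r + 1)])
        (by linarith only [hr0])
    have g1 := sq1 hn
    rw [abs_of_nonneg (norm_nonneg _)] at g1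
    have g2 := sq1 (show pairing f e₃ y ^ 2 ≤ r by linarith)
    have g3 := sq1 (show pairing f e₄ y ^ 2 ≤ r by linarith)
    have g4 := abs_pairing_le he₂ he₄ hq
    have g5 := abs_pairing_le he₂ he₃ hq
    have g6 : |∑ n, f n * e₂ n * e₃ n * e₄ n * ‖y n‖ ^ 4| ≤ r := by
      refine (Finset.abs_sum_le_sum_abs _ _).trans ?_
      have : ∑ n, |f n * e₂ n * e₃ n * e₄ n * ‖y n‖ ^ 4| = diagonal f e₂ e₃ e₄ y := by
        unfold diagonal
        refine Finset.sum_congr rfl fun n _ => ?_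
        rw [abs_mul, abs_of_nonneg (by positivity : 0 ≤ ‖y n‖ ^ 4)]
      linarith
    have k1 : |pairing f e₃ y| * |pairing e₂ e₄ y| ≤ (r + 1) * M ^ 2 :=
      mul_le_mul g2 g4 (abs_nonneg _) (by linarith)
    have k2 : |pairing f e₄ y| * |pairing e₂ e₃ y| ≤ (r + 1) * M ^ 2 :=
      mul_le_mul g3 g5 (abs_nonneg _) (by linarith)
    refine (norm_sub_le _ _).trans ((add_le_add norm_add₃_le le_rfl).trans ?_)
    rw [norm_mul, norm_mul]
    simp only [Complex.norm_real, Real.norm_eq_abs]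
    linarith

end Total

/-! ### The sixteen terms of the quadrilinear form -/

section Deterministic

variable {N : ℕ}

/-- The terms are grouped by the number of factors `W`. Of the six terms with two of them, the three
with derivative on `W₁` count once and the others twice, which gives `9`. The terms with three give
`3 + 1 + 1 + 1`, and the one with four makes `7`. -/
theorem norm_quadForm_add_le {M t μ L R : ℝ} (hM : 1 ≤ M) (ht : 0 ≤ t) (hμ : 0 ≤ μ) (hL : 0 ≤ L)
    {e₁ e₂ e₃ e₄ : Freq N → ℝ} {y : Freq N → ℂ} {W₁ W₂ W₃ W₄ : Freq N → ℂ}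
    (hb : RandomNormBounds R e₁ e₂ e₃ e₄ y)
    (y₁ : normE (smulSeq e₁ y) ≤ M * μ) (y₂ : normE (smulSeq e₂ y) ≤ M * μ)
    (y₃ : normE (smulSeq e₃ y) ≤ M * μ) (y₄ : normE (smulSeq e₄ y) ≤ M * μ)
    (E₂ : normE W₂ ≤ M * μ)
    (H₁ : normH W₁ ≤ M * t) (H₂ : normH W₂ ≤ M * t) (H₃ : normH W₃ ≤ M * t)
    (H₄ : normH W₄ ≤ M * t) (L₂ : normL W₂ ≤ M * L) (L₃ : normL W₃ ≤ M * L)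
    (L₄ : normL W₄ ≤ M * L) :
    ‖quadForm (smulSeq e₁ y + W₁) (smulSeq e₂ y + W₂) (smulSeq e₃ y + W₃) (smulSeq e₄ y + W₄)‖
      ≤ R + 4 * (M * t * R) + 9 * (M ^ 2 * t * L * R) + 7 * (M ^ 4 * t * μ * L ^ 2) := by
  have hM0 : 0 ≤ M := by linarith
  have hMt : 0 ≤ M * t := mul_nonneg hM0 ht
  have hMμ : 0 ≤ M * μ := mul_nonneg hM0 hμ
  have hML : 0 ≤ M * L := mul_nonneg hM0 hL
  have n0 := hb.ppmm
  rw [← quadForm_YYYY] at n0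
  have one : ∀ {a b : ℝ}, a ≤ M * t → 0 ≤ b → b ≤ R → a * b ≤ M * t * R :=
    fun ha hb0 hb => mul_le_mul ha hb hb0 hMt
  have two : ∀ {a l b : ℝ}, a ≤ M * t → 0 ≤ l → l ≤ M * L → 0 ≤ b → b ≤ R →
      a * l * b ≤ M ^ 2 * t * L * R := fun ha hl0 hl hb0 hb => by
    calc _ ≤ (M * t) * (M * L) * R :=
          mul_le_mul (mul_le_mul ha hl hl0 hMt) hb hb0 (mul_nonneg hMt hML)
      _ = _ := by ring
  have two' : ∀ {a l a' l' b : ℝ}, a ≤ M * t → 0 ≤ l → l ≤ M * L → a' ≤ M * t → 0 ≤ l' →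
      l' ≤ M * L → 0 ≤ b → b ≤ R → (a * l + a' * l') * b ≤ 2 * (M ^ 2 * t * L * R) :=
    fun ha hl0 hl ha' hl0' hl' hb0 hb => by
      rw [add_mul, two_mul]
      exact add_le_add (two ha hl0 hl hb0 hb) (two ha' hl0' hl' hb0 hb)
  have three : ∀ {a e l l' : ℝ}, a ≤ M * t → 0 ≤ e → e ≤ M * μ → 0 ≤ l → l ≤ M * L → 0 ≤ l' →
      l' ≤ M * L → a * e * l * l' ≤ M ^ 4 * t * μ * L ^ 2 :=
    fun ha he0 he hl0 hl hl0' hl' => by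
      calc _ ≤ (M * t) * (M * μ) * (M * L) * (M * L) :=
            mul_le_mul (mul_le_mul (mul_le_mul ha he he0 hMt) hl hl0 (mul_nonneg hMt hMμ)) hl' hl0'
              (mul_nonneg (mul_nonneg hMt hMμ) hML)
        _ = _ := by ring
  have hE : ∀ V, 0 ≤ boxE N V := fun V => Real.sqrt_nonneg _
  have hH : ∀ V, 0 ≤ boxH N V := fun V => Real.sqrt_nonneg _
  have a1 := (norm_quadForm_le_YYY234 W₁ e₂ e₃ e₄ y).trans (one H₁ (hE _) hb.ppm234)
  have a2 := (norm_quadForm_le_YYY134 W₂ e₁ e₃ e₄ y).trans (one H₂ (hH _) hb.ppm134)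
  have a3 := (norm_quadForm_le_YYY124 W₃ e₁ e₂ e₄ y).trans (one H₃ (hH _) hb.ppm124)
  have a4 := (norm_quadForm_le_YYY123 W₄ e₁ e₂ e₃ y).trans (one H₄ (hH _) hb.ppm123)
  have b1 := (norm_quadForm_le_YY34 W₁ W₂ e₃ e₄ y).trans
    (two H₁ (normL_nonneg _) L₂ (hE _) hb.pp34)
  have b2 := (norm_quadForm_le_YY24 W₁ W₃ e₂ e₄ y).trans
    (two H₁ (normL_nonneg _) L₃ (hE _) hb.pm24)
  have b3 := (norm_quadForm_le_YY23 W₁ W₄ e₂ e₃ y).trans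
    (two H₁ (normL_nonneg _) L₄ (hE _) hb.pm23)
  have b4 := (norm_quadForm_le_YY14 W₂ W₃ e₁ e₄ y).trans
    (two' H₂ (normL_nonneg _) L₃ H₃ (normL_nonneg _) L₂ (hH _) hb.pm14)
  have b5 := (norm_quadForm_le_YY13 W₂ W₄ e₁ e₃ y).trans
    (two' H₂ (normL_nonneg _) L₄ H₄ (normL_nonneg _) L₂ (hH _) hb.pm13)
  have b6 := (norm_quadForm_le_YY12 W₃ W₄ e₁ e₂ y).trans
    (two' H₃ (normL_nonneg _) L₄ H₄ (normL_nonneg _) L₃ (hH _) hb.pp12)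
  -- The derivative sits on the Gaussian factor, for which only the small `ℓ²` norm is available; it
  -- is moved to the three smooth factors.
  have c1 : ‖quadForm (smulSeq e₁ y) W₂ W₃ W₄‖ ≤ 3 * (M ^ 4 * t * μ * L ^ 2) := by
    refine (norm_quadForm_le_one _ _ _ _).trans ?_
    have d1 := three H₂ (normE_nonneg _) y₁ (normL_nonneg _) L₃ (normL_nonneg _) L₄
    have d2 := three H₃ (normE_nonneg _) y₁ (normL_nonneg _) L₂ (normL_nonneg _) L₄
    have d3 := three H₄ (normE_nonneg _) y₁ (normL_nonneg _) L₂ (normL_nonneg _) L₃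
    linarith
  have c2 := (norm_quadForm_le_one_two W₁ (smulSeq e₂ y) W₃ W₄).trans
    (three H₁ (normE_nonneg _) y₂ (normL_nonneg _) L₃ (normL_nonneg _) L₄)
  have c3 := (norm_quadForm_le_one_three W₁ W₂ (smulSeq e₃ y) W₄).trans
    (three H₁ (normE_nonneg _) y₃ (normL_nonneg _) L₂ (normL_nonneg _) L₄)
  have c4 := (norm_quadForm_le_one_four W₁ W₂ W₃ (smulSeq e₄ y)).trans
    (three H₁ (normE_nonneg _) y₄ (normL_nonneg _) L₂ (normL_nonneg _) L₃)
  have d := (norm_quadForm_le_one_two W₁ W₂ W₃ W₄).trans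
    (three H₁ (normE_nonneg _) E₂ (normL_nonneg _) L₃ (normL_nonneg _) L₄)
  rw [quadForm_expand]
  have tri4 : ∀ p q r s : ℂ, ‖p + q + r + s‖ ≤ ‖p‖ + ‖q‖ + ‖r‖ + ‖s‖ := fun p q r s =>
    (norm_add_le _ _).trans (add_le_add norm_add₃_le le_rfl)
  have tri6 : ∀ p q r s u v : ℂ, ‖p + q + r + s + u + v‖
      ≤ ‖p‖ + ‖q‖ + ‖r‖ + ‖s‖ + ‖u‖ + ‖v‖ := fun p q r s u v =>
    (norm_add_le _ _).trans (add_le_add ((norm_add_le _ _).trans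
      (add_le_add (tri4 p q r s) le_rfl)) le_rfl)
  refine (norm_add_le _ _).trans ((add_le_add ((tri4 _ _ _ _).trans
    (add_le_add (add_le_add (add_le_add le_rfl (tri4 _ _ _ _)) (tri6 _ _ _ _ _ _))
      (tri4 _ _ _ _))) le_rfl).trans ?_)
  linarith

end Deterministic

end DNLS

namespace DNLS

/-! ### The exponential estimate for finitely many Gaussian variables -/

/-- The indicator function of the frequencies `|n| ≥ K`. -/
noncomputable def cut (K : ℕ) (n : ℤ) : ℝ := if (K : ℤ) ≤ |n| then 1 else 0

theorem cut_eq_zero_or_one (K : ℕ) (n : ℤ) : cut K n = 0 ∨ cut K n = 1 := by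
  unfold cut
  split_ifs
  · exact Or.inr rfl
  · exact Or.inl rfl

theorem cut_nonneg (K : ℕ) (n : ℤ) : 0 ≤ cut K n := by
  rcases cut_eq_zero_or_one K n with h | h <;> simp [h]

theorem cut_le_one (K : ℕ) (n : ℤ) : cut K n ≤ 1 := by
  rcases cut_eq_zero_or_one K n with h | h <;> simp [h]

theorem cut_sq (K : ℕ) (n : ℤ) : cut K n ^ 2 = cut K n := by
  rcases cut_eq_zero_or_one K n with h | h <;> simp [h]

theorem cut_neg (K : ℕ) (n : ℤ) : cut K (-n) = cut K n := by simp [cut]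

theorem exists_sum_cut_mul_invSq_le {ε : ℝ} (hε : 0 < ε) :
    ∃ K : ℕ, ∀ N : ℕ, ∑ n : Freq N, cut K n * invSq n ≤ ε := by
  obtain ⟨s, hs⟩ := summable_iff_vanishing_norm.1 summable_invSq ε hε
  refine ⟨s.sup Int.natAbs + 1, fun N => ?_⟩
  rw [Finset.sum_coe_sort (Finset.Icc (-(N : ℤ)) N) fun n => cut _ n * invSq n]
  simp only [cut, ite_mul, one_mul, zero_mul]
  rw [← Finset.sum_filter]
  refine (le_abs_self _).trans (hs _ ?_).le
  rw [Finset.disjoint_left]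
  intro n hn hns
  have h1 := Finset.le_sup (f := Int.natAbs) hns
  have h2 := (Finset.mem_filter.1 hn).2
  rw [Int.abs_eq_natAbs] at h2
  omega

/-- The coefficient `b(n) / ⟨n⟩` of the Gaussian variable of frequency `n`. -/
noncomputable def freqWeight {N : ℕ} (b : ℤ → ℝ) (n : Freq N) : ℝ := b n / bracket n

/-- The coefficient `b(n) / ⟨n⟩`, restricted to the frequencies `|n| ≥ K`. -/
noncomputable def cutWeight {N : ℕ} (K : ℕ) (b : ℤ → ℝ) (n : Freq N) : ℝ :=
  cut K n * (b n / bracket n)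

section Estimate

variable {N : ℕ}

theorem isWeight_cutWeight {M : ℝ} (K : ℕ) {b : ℤ → ℝ} (hb : ∀ n, |b n| ≤ M)
    (hb_even : ∀ n, b n = b (-n)) :
    IsWeight M (fun n : Freq N => cut K n * invSq n) (cutWeight K b) where
  nonneg n := mul_nonneg (cut_nonneg _ _) (invSq_pos _).le
  le_invSq n := mul_le_of_le_one_left (invSq_pos _).le (cut_le_one _ _)
  sq_le n := by
    have h : b n ^ 2 ≤ M ^ 2 := by
      rw [← sq_abs]
      exact pow_le_pow_left₀ (abs_nonneg _) (hb n) 2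
    calc cutWeight K b n ^ 2 = b n ^ 2 * (cut K n * invSq n) := by
          rw [cutWeight, mul_pow, cut_sq, div_pow, invSq, div_eq_mul_inv]; ring
      _ ≤ _ := mul_le_mul_of_nonneg_right h (mul_nonneg (cut_nonneg _ _) (invSq_pos _).le)
  even n := by
    have h : ((Freq.neg n : Freq N) : ℤ) = -n := rfl
    rw [cutWeight, cutWeight, h, cut_neg, bracket_neg, ← hb_even]

/-- The Fourier coefficients of the difference of the function and the high frequency part of the
random series. -/
noncomputable def remainder (K : ℕ) (x y : Freq N → ℂ) (n : Freq N) : ℂ :=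
  (x n - (cut K n : ℂ) * y n) / (bracket n : ℂ)

/-- One and the same remainder serves all four factors, since the multiplier `b` acts diagonally. -/
theorem smulSeq_freqWeight (K : ℕ) (b : ℤ → ℝ) (x y : Freq N → ℂ) :
    smulSeq (freqWeight b) x
      = smulSeq (cutWeight K b) y + smulSeq (fun n => b n) (remainder K x y) := by
  funext n
  have : (bracket n : ℂ) ≠ 0 := Complex.ofReal_ne_zero.2 (bracket_pos n).ne'
  simp only [smulSeq, freqWeight, cutWeight, remainder, Pi.add_apply]
  push_cast
  field_simp
  ring

theorem norm_div_bracket_sq (z : ℂ) (n : ℤ) :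
    ‖z / (bracket n : ℂ)‖ ^ 2 = invSq n * ‖z‖ ^ 2 := by
  rw [norm_div, Complex.norm_real, Real.norm_eq_abs, abs_of_pos (bracket_pos n), div_pow, invSq,
    div_eq_mul_inv, mul_comm]

theorem normE_remainder_le {K : ℕ} {q : ℝ} (hq : 0 ≤ q) {x y : Freq N → ℂ}
    (hx : ∑ n : Freq N, invSq n * ‖x n‖ ^ 2 ≤ q ^ 2)
    (hy : ∑ n : Freq N, cut K n * invSq n * ‖y n‖ ^ 2 ≤ q ^ 2) :
    normE (remainder K x y) ≤ 2 * q := by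
  have e : normE (remainder K x y) = l2 fun n : Freq N =>
      ‖x n / (bracket n : ℂ) - (cut K n : ℂ) * y n / (bracket n : ℂ)‖ := by
    simp only [normE, remainder, sub_div]
  rw [e, two_mul]
  refine (l2_sub_le _ _).trans (add_le_add (l2_le hq ?_) (l2_le hq ?_))
  · simpa only [norm_div_bracket_sq] using hx
  · refine le_trans (le_of_eq (Finset.sum_congr rfl fun n _ => ?_)) hy
    rw [norm_div_bracket_sq, norm_mul, Complex.norm_real, Real.norm_eq_abs, mul_pow, sq_abs, cut_sq]
    ring

/-- At frequencies `|n| ≥ K` the bracket cancels and leaves exactly `‖x n - y n‖`. At `|n| < K` the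
remainder is that of `x` alone, and `⟨n⟩² ≤ 1 + K²` reduces its `H¹` norm to the small `L²` norm. -/
theorem normH_remainder_le {K : ℕ} {q t : ℝ} (ht : 0 ≤ t) {x y : Freq N → ℂ}
    (hx : ∑ n : Freq N, invSq n * ‖x n‖ ^ 2 ≤ q ^ 2)
    (h : ∑ n : Freq N, ‖x n - y n‖ ^ 2 + (1 + (K : ℝ) ^ 2) * q ^ 2 ≤ t ^ 2) :
    normH (remainder K x y) ≤ t := by
  refine l2_le ht (le_trans ?_ h)
  refine le_trans ?_ (add_le_add le_rfl (mul_le_mul_of_nonneg_left hx (by positivity)))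
  rw [Finset.mul_sum, ← Finset.sum_add_distrib]
  refine Finset.sum_le_sum fun n _ => ?_
  have e : (bracket n * ‖remainder K x y n‖) ^ 2 = ‖x n - (cut K n : ℂ) * y n‖ ^ 2 := by
    rw [mul_pow, remainder, norm_div_bracket_sq, ← mul_assoc, invSq,
      mul_inv_cancel₀ (pow_pos (bracket_pos n) 2).ne', one_mul]
  rw [e]
  have hi := (invSq_pos n).le
  by_cases hn : (K : ℤ) ≤ |(n : ℤ)|
  · have : cut K n = 1 := if_pos hn
    rw [this, Complex.ofReal_one, one_mul]
    exact le_add_of_nonneg_right (by positivity)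
  · have : cut K n = 0 := if_neg hn
    rw [this, Complex.ofReal_zero, zero_mul, sub_zero]
    have h1 : ‖x n‖ ^ 2 = bracket n ^ 2 * (invSq n * ‖x n‖ ^ 2) := by
      rw [← mul_assoc, invSq, mul_inv_cancel₀ (pow_pos (bracket_pos n) 2).ne', one_mul]
    have h2 : bracket n ^ 2 ≤ 1 + (K : ℝ) ^ 2 := by
      rw [bracket_sq]
      have h3 : |((n : ℤ) : ℝ)| ≤ K := by exact_mod_cast (not_le.1 hn).le
      have := pow_le_pow_left₀ (abs_nonneg _) h3 2
      rw [sq_abs] at this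
      linarith
    refine h1.le.trans ?_
    exact (mul_le_mul_of_nonneg_right h2 (by positivity)).trans
      (le_add_of_nonneg_left (sq_nonneg _))

theorem norm_smulSeq_le {M : ℝ} {b : ℤ → ℝ} (hb : ∀ n, |b n| ≤ M) (w : Freq N → ℂ) (n : Freq N) :
    ‖smulSeq (fun n => b n) w n‖ ≤ M * ‖w n‖ := by
  rw [smulSeq, norm_mul, Complex.norm_real]
  exact mul_le_mul_of_nonneg_right (hb n) (norm_nonneg _)

theorem normE_smulSeq_le {M : ℝ} (hM : 0 ≤ M) {b : ℤ → ℝ} (hb : ∀ n, |b n| ≤ M)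
    (w : Freq N → ℂ) : normE (smulSeq (fun n => b n) w) ≤ M * normE w := by
  refine (l2_mono (fun n => norm_nonneg _) (norm_smulSeq_le hb w)).trans ?_
  exact (l2_const_mul hM _).le

theorem normH_smulSeq_le {M : ℝ} (hM : 0 ≤ M) {b : ℤ → ℝ} (hb : ∀ n, |b n| ≤ M)
    (w : Freq N → ℂ) : normH (smulSeq (fun n => b n) w) ≤ M * normH w := by
  refine (l2_mono (β := fun n : Freq N => M * (bracket n * ‖w n‖))
    (fun n => mul_nonneg (bracket_pos n).le (norm_nonneg _)) fun n => ?_).trans ?_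
  · rw [mul_left_comm]
    exact mul_le_mul_of_nonneg_left (norm_smulSeq_le hb w n) (bracket_pos n).le
  · exact (l2_const_mul hM _).le

theorem normL_smulSeq_le {M : ℝ} {b : ℤ → ℝ} (hb : ∀ n, |b n| ≤ M)
    (w : Freq N → ℂ) : normL (smulSeq (fun n => b n) w) ≤ M * normL w := by
  unfold normL
  rw [Finset.mul_sum]
  exact Finset.sum_le_sum fun n _ => norm_smulSeq_le hb w n

theorem norm_quadForm_le {M q t R : ℝ} {K : ℕ} (hM : 1 ≤ M) (hq : 0 ≤ q) (hq1 : 2 * q ≤ 1)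
    (ht : 0 ≤ t) {b₁ b₂ b₃ b₄ : ℤ → ℝ} (h₁ : ∀ n, |b₁ n| ≤ M) (h₂ : ∀ n, |b₂ n| ≤ M)
    (h₃ : ∀ n, |b₃ n| ≤ M) (h₄ : ∀ n, |b₄ n| ≤ M) {x y : Freq N → ℂ}
    (hx : ∑ n : Freq N, invSq n * ‖x n‖ ^ 2 ≤ q ^ 2)
    (hy : ∑ n : Freq N, cut K n * invSq n * ‖y n‖ ^ 2 ≤ q ^ 2)
    (hb : RandomNormBounds R (cutWeight K b₁) (cutWeight K b₂) (cutWeight K b₃)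
      (cutWeight K b₄) y)
    (h : ∑ n : Freq N, ‖x n - y n‖ ^ 2 + (1 + (K : ℝ) ^ 2) * q ^ 2 ≤ t ^ 2) :
    ‖quadForm (smulSeq (freqWeight b₁) x) (smulSeq (freqWeight b₂) x) (smulSeq (freqWeight b₃) x)
        (smulSeq (freqWeight b₄) x)‖
      ≤ R + 4 * (M * t * R) + 36 * (M ^ 2 * t * Real.sqrt t * R) + 224 * (M ^ 4 * q * t ^ 2) := by
  have hM0 : 0 ≤ M := by linarith
  set w := remainder K x y with hw
  have wE : normE w ≤ 2 * q := normE_remainder_le hq hx hy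
  have wH : normH w ≤ t := normH_remainder_le ht hx h
  -- Carlson–Agmon, with the `L²` norm of `w` estimated simply by `1`. The smallness of `q` enters
  -- through the bounds `yE` and `vE`.
  have wL : normL w ≤ 4 * Real.sqrt t := by
    refine abs_le_of_sq_le_sq' ?_ (by positivity) |>.2
    rw [mul_pow, Real.sq_sqrt ht]
    have h1 : normL w ^ 2 ≤ 16 * normE w * normH w :=
      sum_sq_le_l2_mul_l2 _ fun n => norm_nonneg _
    have h2 : normE w * normH w ≤ 1 * t :=
      mul_le_mul (wE.trans hq1) wH (normH_nonneg _) zero_le_one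
    linarith
  have yE : ∀ {b : ℤ → ℝ}, (∀ n, |b n| ≤ M) → normE (smulSeq (cutWeight K b) y) ≤ M * (2 * q) := by
    intro b hb
    have h1 : normE (smulSeq (cutWeight K b) y) ≤ M * q := by
      refine l2_le (mul_nonneg hM0 hq) ?_
      rw [mul_pow]
      refine le_trans ?_ (mul_le_mul_of_nonneg_left hy (sq_nonneg M))
      rw [Finset.mul_sum]
      refine Finset.sum_le_sum fun n _ => ?_
      have h3 : b n ^ 2 ≤ M ^ 2 := by
        rw [← sq_abs]
        exact pow_le_pow_left₀ (abs_nonneg _) (hb n) 2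
      have h4 : 0 ≤ cut K n * invSq n * ‖y n‖ ^ 2 :=
        mul_nonneg (mul_nonneg (cut_nonneg _ _) (invSq_pos _).le) (sq_nonneg _)
      calc ‖smulSeq (cutWeight K b) y n‖ ^ 2 = b n ^ 2 * (cut K n * invSq n * ‖y n‖ ^ 2) := by
            rw [smulSeq, norm_mul, mul_pow, Complex.norm_real, Real.norm_eq_abs, sq_abs, cutWeight,
              mul_pow, cut_sq, div_pow, invSq, div_eq_mul_inv]
            ring
        _ ≤ _ := mul_le_mul_of_nonneg_right h3 h4
    exact h1.trans (mul_le_mul_of_nonneg_left (by linarith) hM0)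
  have vE : ∀ {b : ℤ → ℝ}, (∀ n, |b n| ≤ M) → normE (smulSeq (fun n => b n) w) ≤ M * (2 * q) :=
    fun hb => (normE_smulSeq_le hM0 hb w).trans (mul_le_mul_of_nonneg_left wE hM0)
  have vH : ∀ {b : ℤ → ℝ}, (∀ n, |b n| ≤ M) → normH (smulSeq (fun n => b n) w) ≤ M * t :=
    fun hb => (normH_smulSeq_le hM0 hb w).trans (mul_le_mul_of_nonneg_left wH hM0)
  have vL : ∀ {b : ℤ → ℝ}, (∀ n, |b n| ≤ M) →
      normL (smulSeq (fun n => b n) w) ≤ M * (4 * Real.sqrt t) :=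
    fun hb => (normL_smulSeq_le hb w).trans (mul_le_mul_of_nonneg_left wL hM0)
  -- With `μ = 2q` and `L = 4√t` the numerical factors become `9 · 4 = 36` and `7 · 2 · 16 = 224`.
  have main := norm_quadForm_add_le hM ht (by positivity : 0 ≤ 2 * q)
    (by positivity : 0 ≤ 4 * Real.sqrt t) hb (yE h₁) (yE h₂) (yE h₃) (yE h₄) (vE h₂)
    (vH h₁) (vH h₂) (vH h₃) (vH h₄) (vL h₂) (vL h₃) (vL h₄)
  rw [smulSeq_freqWeight K b₁ x y, smulSeq_freqWeight K b₂ x y, smulSeq_freqWeight K b₃ x y,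
    smulSeq_freqWeight K b₄ x y]
  refine main.trans (le_of_eq ?_)
  rw [mul_pow, Real.sq_sqrt ht]
  ring

/-- Young's inequality by completing squares. It is used with `s = √t`, so that `t^{3/2}` and `t`
are absorbed by a quarter of `t²`. -/
theorem cubic_add_quadratic_le (A B s : ℝ) :
    A * s ^ 3 + B * s ^ 2 ≤ s ^ 4 / 4 + (64 * A ^ 4 + 4 * B ^ 2) := by
  have h1 : A * s ^ 3 ≤ s ^ 4 / 16 + 4 * A ^ 2 * s ^ 2 := by
    nlinarith [sq_nonneg (s ^ 2 / 4 - 2 * A * s)]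
  have h2 : 4 * A ^ 2 * s ^ 2 ≤ s ^ 4 / 16 + 64 * A ^ 4 := by
    nlinarith [sq_nonneg (s ^ 2 / 4 - 8 * A ^ 2)]
  have h3 : B * s ^ 2 ≤ s ^ 4 / 16 + 4 * B ^ 2 := by
    nlinarith [sq_nonneg (s ^ 2 / 4 - 2 * B)]
  have h4 : 0 ≤ s ^ 4 := by positivity
  linarith

/-- The constant in the estimate of the exponent. -/
noncomputable def exponentConst (M p R : ℝ) : ℝ :=
  3 * p / 2 * R + (64 * (54 * p * M ^ 2 * R) ^ 4 + 4 * (6 * p * M * R) ^ 2)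

/-- Half of `t²` is available. One quarter absorbs the lower powers of `t`, the other the term `q
t²`, whose factor is `336 = (3/2) · 224`. -/
theorem exponent_le {M p R q t Q : ℝ} (hp : 0 ≤ p) (ht : 0 ≤ t)
    (hq : 336 * p * M ^ 4 * q ≤ 1 / 4)
    (hQ : Q ≤ R + 4 * (M * t * R) + 36 * (M ^ 2 * t * Real.sqrt t * R)
      + 224 * (M ^ 4 * q * t ^ 2)) :
    3 * p / 2 * Q ≤ t ^ 2 / 2 + exponentConst M p R := by
  have h := cubic_add_quadratic_le (54 * p * M ^ 2 * R) (6 * p * M * R) (Real.sqrt t)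
  have e2 : Real.sqrt t ^ 2 = t := Real.sq_sqrt ht
  have e3 : Real.sqrt t ^ 3 = t * Real.sqrt t := by rw [pow_succ, e2]
  have e4 : Real.sqrt t ^ 4 = t ^ 2 := by
    rw [show Real.sqrt t ^ 4 = (Real.sqrt t ^ 2) ^ 2 by ring, e2]
  rw [e2, e3, e4] at h
  have h1 := mul_le_mul_of_nonneg_left hQ (by positivity : 0 ≤ 3 * p / 2)
  have h2 := mul_le_mul_of_nonneg_right hq (sq_nonneg t)
  unfold exponentConst
  linarith

theorem measurable_quadForm (e₁ e₂ e₃ e₄ : Freq N → ℝ) :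
    Measurable fun x : Freq N → ℂ =>
      quadForm (smulSeq e₁ x) (smulSeq e₂ x) (smulSeq e₃ x) (smulSeq e₄ x) := by
  unfold quadForm smulSeq
  refine Finset.measurable_sum _ fun n₁ _ => Finset.measurable_sum _ fun n₂ _ =>
    Finset.measurable_sum _ fun n₃ _ => Finset.measurable_sum _ fun n₄ _ => ?_
  split_ifs
  · have hc : Measurable (starRingEnd ℂ : ℂ → ℂ) := Complex.continuous_conj.measurable
    have h : ∀ (e : Freq N → ℝ) (n : Freq N), Measurable fun x : Freq N → ℂ => (e n : ℂ) * x n :=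
      fun e n => (measurable_pi_apply n).const_mul _
    exact ((((h e₁ n₁).mul (h e₂ n₂)).mul (hc.comp (h e₃ n₃))).mul
      (hc.comp (h e₄ n₄))).const_mul _
  · exact measurable_const

theorem chaosTotal_nonneg (e₁ e₂ e₃ e₄ : Freq N → ℝ) (y : Freq N → ℂ) :
    0 ≤ chaosTotal e₁ e₂ e₃ e₄ y := by
  have w1 : ∀ k : ℤ, (0 : ℝ) ≤ (fun _ : ℤ => (1 : ℝ)) k := fun _ => zero_le_one
  have w2 : ∀ k : ℤ, 0 ≤ invSq k := fun k => (invSq_pos k).le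
  have w3 : ∀ k : ℤ, (0 : ℝ) ≤ if k = 0 then 1 else 0 := fun k => by split_ifs <;> norm_num
  have d : 0 ≤ diagonal (derivWeight e₁) e₂ e₃ e₄ y :=
    Finset.sum_nonneg fun n _ => mul_nonneg (abs_nonneg _) (by positivity)
  unfold chaosTotal
  refine add_nonneg (add_nonneg (add_nonneg (add_nonneg (add_nonneg (add_nonneg (add_nonneg
    (add_nonneg (add_nonneg (add_nonneg (add_nonneg (add_nonneg (add_nonneg ?_ ?_) ?_) ?_) ?_) ?_)
    ?_) ?_) ?_) ?_) ?_) (sq_nonneg _)) (sq_nonneg _)) d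
  · exact chaosNorm_nonneg w1 y
  · exact chaosNorm_nonneg w1 y
  · exact chaosNorm_nonneg w1 y
  · exact chaosNorm_nonneg w2 y
  · exact chaosNorm_nonneg w2 y
  · exact chaosNorm_nonneg w2 y
  · exact chaosNorm_nonneg w1 y
  · exact chaosNorm_nonneg w2 y
  · exact chaosNorm_nonneg w2 y
  · exact chaosNorm_nonneg w2 y
  · exact chaosNorm_nonneg w3 y

/-- Two events of large probability for nonnegative functions of bounded expectation. -/
theorem half_le_measure_le_and_le {α : Type*} [MeasurableSpace α] (μ : Measure α)
    [IsProbabilityMeasure μ] {f g : α → ℝ} (hf : Integrable f μ) (hg : Integrable g μ)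
    (f0 : ∀ x, 0 ≤ f x) (g0 : ∀ x, 0 ≤ g x) {a b : ℝ} (ha : 0 < a) (hb : 0 < b)
    (hfa : 4 * ∫ x, f x ∂μ ≤ a) (hgb : 4 * ∫ x, g x ∂μ ≤ b) :
    ENNReal.ofReal (1 / 2) ≤ μ {x | f x ≤ a ∧ g x ≤ b} := by
  have markov : ∀ {f : α → ℝ}, Integrable f μ → (∀ x, 0 ≤ f x) → ∀ {a : ℝ}, 0 < a →
      4 * ∫ x, f x ∂μ ≤ a → μ.real {x | a ≤ f x} ≤ 1 / 4 := fun {f} hf f0 {a} ha h => by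
    have := mul_meas_ge_le_integral_of_nonneg (Filter.Eventually.of_forall f0) hf a
    nlinarith
  have h1 := markov hf f0 ha hfa
  have h2 := markov hg g0 hb hgb
  have h3 : μ.real ({x | f x ≤ a ∧ g x ≤ b} ∪ ({x | a ≤ f x} ∪ {x | b ≤ g x})) = 1 := by
    rw [show ({x | f x ≤ a ∧ g x ≤ b} ∪ ({x | a ≤ f x} ∪ {x | b ≤ g x})) = Set.univ from ?_]
    · simp
    · refine Set.eq_univ_of_forall fun x => ?_
      rcases le_total (f x) a with h | h
      · rcases le_total (g x) b with h' | h'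
        · exact Or.inl ⟨h, h'⟩
        · exact Or.inr (Or.inr h')
      · exact Or.inr (Or.inl h)
  have h4 := measureReal_union_le (μ := μ) {x | f x ≤ a ∧ g x ≤ b} ({x | a ≤ f x} ∪ {x | b ≤ g x})
  have h5 := measureReal_union_le (μ := μ) {x | a ≤ f x} {x | b ≤ g x}
  rw [ENNReal.ofReal_le_iff_le_toReal (measure_ne_top _ _)]
  change 1 / 2 ≤ μ.real _
  linarith

end Estimate

/-- The transport bound, applied to the truncated exponential and to the indicator of an event of
probability at least `1/2`, turns the integral into a pointwise comparison. All constants are fixed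
before `N` and the multipliers. -/
theorem exists_lintegral_exp_quadForm_le {M p : ℝ} (hM : 1 ≤ M) (hp : 1 ≤ p) :
    ∃ m₀ : ℝ, 0 < m₀ ∧ ∃ C : ℝ≥0∞, C ≠ ∞ ∧ ∀ (N : ℕ) (b₁ b₂ b₃ b₄ : ℤ → ℝ),
      (∀ n, |b₁ n| ≤ M) → (∀ n, |b₂ n| ≤ M) → (∀ n, |b₃ n| ≤ M) → (∀ n, |b₄ n| ≤ M) →
      (∀ n, b₁ n = b₁ (-n)) → (∀ n, b₂ n = b₂ (-n)) → (∀ n, b₃ n = b₃ (-n)) →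
      (∀ n, b₄ n = b₄ (-n)) →
      ∫⁻ x, {x : Freq N → ℂ | ∑ n : Freq N, invSq n * ‖x n‖ ^ 2 < m₀}.indicator
        (fun x => ENNReal.ofReal (Real.exp (3 * p / 2 * ‖quadForm (smulSeq (freqWeight b₁) x)
          (smulSeq (freqWeight b₂) x) (smulSeq (freqWeight b₃) x) (smulSeq (freqWeight b₄) x)‖))) x
        ∂(gaussianPi (Freq N)) ≤ C := by
  have hM4 : 1 ≤ M ^ 4 := one_le_pow₀ hM
  have hpM : 1 ≤ p * M ^ 4 := one_le_mul_of_one_le_of_one_le hp hM4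
  -- Here `1344 = 4 · 336`, which makes the factor of `t²` equal to `1/4`.
  set q : ℝ := (1344 * (p * M ^ 4))⁻¹ with hq
  have hq0 : 0 < q := by positivity
  have hqe : 1344 * (p * M ^ 4) * q = 1 := mul_inv_cancel₀ (by positivity)
  have hq1 : 2 * q ≤ 1 := by nlinarith
  -- Markov's inequality with `56 = 4 · 14`: the bound on `chaosTotal` fails with probability at
  -- most `1/4`. The summand `1` only makes `r` positive.
  set r : ℝ := 56 * totalConst M + 1 with hr
  have hr0 : 0 < r := by have := totalConst_nonneg hM; positivity
  set R : ℝ := 16 * M ^ 6 * (r + 1) with hR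
  set σ : ℝ := ∫ z, ‖z‖ ^ 2 ∂stdComplexGaussian with hσ
  have hσ0 : 0 ≤ σ := integral_nonneg fun z => by positivity
  -- The high frequencies then have expected squared `L²` norm at most `q² / 4`, so they leave the
  -- ball of radius `q` with probability at most `1/4`, uniformly in `N`.
  obtain ⟨K, hK⟩ := exists_sum_cut_mul_invSq_le (ε := q ^ 2 / (4 * (σ + 1))) (by positivity)
  set E : ℝ := Real.exp ((1 + (K : ℝ) ^ 2) * q ^ 2 / 2 + exponentConst M p R) with hE
  refine ⟨q ^ 2, by positivity, 2 * ENNReal.ofReal E,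
    ENNReal.mul_ne_top (by simp) ENNReal.ofReal_ne_top, ?_⟩
  intro N b₁ b₂ b₃ b₄ h₁ h₂ h₃ h₄ s₁ s₂ s₃ s₄
  have k₁ := isWeight_cutWeight (N := N) K h₁ s₁
  have k₂ := isWeight_cutWeight (N := N) K h₂ s₂
  have k₃ := isWeight_cutWeight (N := N) K h₃ s₃
  have k₄ := isWeight_cutWeight (N := N) K h₄ s₄
  set F : (Freq N → ℂ) → ℝ :=
    chaosTotal (cutWeight K b₁) (cutWeight K b₂) (cutWeight K b₃) (cutWeight K b₄) with hF
  set G : (Freq N → ℂ) → ℝ := fun y => ∑ n : Freq N, cut K n * invSq n * ‖y n‖ ^ 2 with hG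
  have iF : Integrable F (gaussianPi (Freq N)) := integrable_chaosTotal _ _ _ _
  have iG' : ∀ n : Freq N, Integrable (fun y : Freq N → ℂ => cut K n * invSq n * ‖y n‖ ^ 2)
      (gaussianPi (Freq N)) := fun n => (integrable_eval_norm_pow n 2).const_mul _
  have iG : Integrable G (gaussianPi (Freq N)) := integrable_finsetSum _ fun n _ => iG' n
  have G0 : ∀ y, 0 ≤ G y := fun y => Finset.sum_nonneg fun n _ =>
    mul_nonneg (mul_nonneg (cut_nonneg _ _) (invSq_pos _).le) (sq_nonneg _)
  have eF : 4 * ∫ y, F y ∂(gaussianPi (Freq N)) ≤ r := by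
    have := integral_chaosTotal_le hM k₁ k₂ k₃ k₄
    linarith
  have eG : 4 * ∫ y, G y ∂(gaussianPi (Freq N)) ≤ q ^ 2 := by
    have e : ∫ y, G y ∂(gaussianPi (Freq N)) = (∑ n : Freq N, cut K n * invSq n) * σ := by
      rw [hG, integral_finsetSum _ fun n _ => iG' n, Finset.sum_mul]
      exact Finset.sum_congr rfl fun n _ => by
        rw [integral_const_mul, integral_eval_norm_pow]
    rw [e]
    have h1 := mul_le_mul_of_nonneg_right (hK N) hσ0
    have h2 : q ^ 2 / (4 * (σ + 1)) * σ ≤ q ^ 2 / 4 := by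
      rw [div_mul_eq_mul_div, div_le_div_iff₀ (by positivity) (by norm_num)]
      nlinarith [sq_nonneg q]
    linarith
  set A : Set (Freq N → ℂ) := {y | F y ≤ r ∧ G y ≤ q ^ 2} with hA
  have mF : Measurable F := measurable_chaosTotal _ _ _ _
  have mG : Measurable G := by rw [hG]; fun_prop
  have mA : MeasurableSet A :=
    (measurableSet_le mF measurable_const).inter (measurableSet_le mG measurable_const)
  have pA : ENNReal.ofReal (1 / 2) ≤ gaussianPi (Freq N) A :=
    half_le_measure_le_and_le _ iF iG (fun y => chaosTotal_nonneg _ _ _ _ y) G0 hr0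
      (by positivity) eF eG
  set U : (Freq N → ℂ) → ℝ≥0∞ :=
    {x : Freq N → ℂ | ∑ n : Freq N, invSq n * ‖x n‖ ^ 2 < q ^ 2}.indicator
        (fun x => ENNReal.ofReal (Real.exp (3 * p / 2 * ‖quadForm (smulSeq (freqWeight b₁) x)
          (smulSeq (freqWeight b₂) x) (smulSeq (freqWeight b₃) x) (smulSeq (freqWeight b₄) x)‖)))
    with hU
  have mU : Measurable U := by
    refine Measurable.indicator ?_ (measurableSet_lt (by fun_prop) measurable_const)
    exact (((measurable_quadForm _ _ _ _).norm.const_mul _).exp).ennreal_ofReal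
  -- The remaining goal is the pointwise comparison for `x` in the small ball and `y` in the event;
  -- elsewhere the product vanishes.
  have key := (transportBound_pi (ι := Freq N)).le (K := ENNReal.ofReal E)
    (ENNReal.ofReal_pos.2 (Real.exp_pos _)).ne' ENNReal.ofReal_ne_top mU
    (v := A.indicator 1) (measurable_one.indicator mA) ?_
  · rw [lintegral_indicator_one mA] at key
    have h1 : (∫⁻ x, U x ∂(gaussianPi (Freq N))) * ENNReal.ofReal (1 / 2) ≤ ENNReal.ofReal E :=
      (mul_le_mul' le_rfl pA).trans key
    calc ∫⁻ x, U x ∂(gaussianPi (Freq N))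
        = 2 * ((∫⁻ x, U x ∂(gaussianPi (Freq N))) * ENNReal.ofReal (1 / 2)) := by
          rw [mul_left_comm, ← ENNReal.ofReal_ofNat, ← ENNReal.ofReal_mul (by norm_num)]
          norm_num
      _ ≤ 2 * ENNReal.ofReal E := mul_le_mul' le_rfl h1
  · intro x y
    by_cases hx : ∑ n : Freq N, invSq n * ‖x n‖ ^ 2 < q ^ 2
    swap
    · rw [hU, Set.indicator_of_notMem (by exact hx), zero_mul]
      exact zero_le
    by_cases hy : y ∈ A
    swap
    · rw [Set.indicator_of_notMem hy, mul_zero]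
      exact zero_le
    rw [Set.indicator_of_mem hy, Pi.one_apply, mul_one, hU, Set.indicator_of_mem (by exact hx),
      ← ENNReal.ofReal_mul (Real.exp_pos _).le, ← Real.exp_add]
    refine ENNReal.ofReal_le_ofReal (Real.exp_le_exp.2 ?_)
    have hq2 : q ^ 2 ≤ 1 := pow_le_one₀ hq0.le (by linarith)
    have hb := randomNormBounds_of_chaosTotal_le hM k₁ k₂ k₃ k₄ hy.1 (hy.2.trans hq2)
    have hs : 0 ≤ ∑ n : Freq N, ‖x n - y n‖ ^ 2 + (1 + (K : ℝ) ^ 2) * q ^ 2 := by positivity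
    have hQ := norm_quadForm_le hM hq0.le hq1 (Real.sqrt_nonneg _) h₁ h₂ h₃ h₄ hx.le hy.2 hb
      (Real.sq_sqrt hs).ge
    have hfin := exponent_le (M := M) (p := p) (q := q) (by linarith) (Real.sqrt_nonneg _) (by linarith) hQ
    rw [Real.sq_sqrt hs] at hfin
    linarith

end DNLS

namespace DNLS

/-! ### Trigonometric polynomials -/

/-- The trigonometric polynomial with frequencies in `s` and coefficients `a`. -/
noncomputable def trigPoly (s : Finset ℤ) (a : ℤ → ℂ) (x : Torus) : ℂ :=
  ∑ n ∈ s, a n * fourier n x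

theorem integral_fourier_torus (k : ℤ) :
    ∫ x : Torus, fourier k x ∂torusMeasure = if k = 0 then 1 else 0 := by
  have h := (orthonormal_iff_ite.1 (orthonormal_fourier (T := 2 * π))) 0 k
  rw [ContinuousMap.inner_toLp] at h
  simp only [fourier_zero, map_one, mul_one] at h
  rw [h]
  simp only [eq_comm]

theorem fourierCoeff_trigPoly (s : Finset ℤ) (a : ℤ → ℂ) (k : ℤ) :
    fourierCoeff (trigPoly s a) k = if k ∈ s then a k else 0 := by
  have h : ∀ x : Torus, fourier (-k) x • trigPoly s a x
      = ∑ n ∈ s, a n * fourier (-k + n) x := fun x => by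
    rw [trigPoly, smul_eq_mul, Finset.mul_sum]
    exact Finset.sum_congr rfl fun n _ => by rw [fourier_add]; ring
  rw [fourierCoeff]
  simp_rw [h]
  rw [integral_finsetSum _ fun n _ => ((fourier (-k + n)).continuous.integrable_of_hasCompactSupport
    (HasCompactSupport.of_compactSpace _)).const_mul _]
  simp_rw [integral_const_mul, integral_fourier_torus, mul_ite, mul_one, mul_zero]
  have e : ∀ n : ℤ, -k + n = 0 ↔ n = k := fun n => by omega
  simp_rw [e]
  simp

theorem lowFreq_eq_trigPoly (N : ℕ) (f : Torus → ℂ) :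
    lowFreq N f = trigPoly (Finset.Icc (-(N : ℤ)) N) (fourierCoeff f) := rfl

theorem freqProj_trigPoly (Q : Set ℤ) (s : Finset ℤ) (a : ℤ → ℂ) :
    freqProj Q (trigPoly s a) = trigPoly s (Q.indicator a) := by
  classical
  funext x
  rw [freqProj, tsum_eq_sum (s := s)]
  · refine Finset.sum_congr rfl fun n hn => ?_
    by_cases hQ : n ∈ Q
    · rw [Set.indicator_of_mem hQ, Set.indicator_of_mem hQ, fourierCoeff_trigPoly, if_pos hn]
    · rw [Set.indicator_of_notMem hQ, Set.indicator_of_notMem hQ, zero_mul]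
  · intro n hn
    rw [Set.indicator_apply_eq_zero]
    intro _
    rw [fourierCoeff_trigPoly, if_neg hn, zero_mul]

theorem conj_trigPoly {s : Finset ℤ} (hs : ∀ n, n ∈ s → -n ∈ s) (a : ℤ → ℂ) (x : Torus) :
    starRingEnd ℂ (trigPoly s a x) = trigPoly s (fun n => starRingEnd ℂ (a (-n))) x := by
  rw [trigPoly, map_sum, trigPoly]
  refine Finset.sum_nbij' (fun n => -n) (fun n => -n) hs hs (by simp) (by simp) fun n _ => ?_
  rw [map_mul, neg_neg, fourier_neg]

/-- Conjugation reflects the frequencies, so it commutes with the projection to an even set. -/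
theorem freqProj_conj_trigPoly {Q : Set ℤ} (hQ : IsEvenSet Q) {s : Finset ℤ}
    (hs : ∀ n, n ∈ s → -n ∈ s) (a : ℤ → ℂ) :
    freqProj Q (fun y => starRingEnd ℂ (trigPoly s a y))
      = fun x => starRingEnd ℂ (trigPoly s (Q.indicator a) x) := by
  classical
  simp_rw [conj_trigPoly hs]
  rw [freqProj_trigPoly]
  congr 1
  funext n
  by_cases h : n ∈ Q
  · rw [Set.indicator_of_mem h, Set.indicator_of_mem ((hQ n).1 h)]
  · rw [Set.indicator_of_notMem h, Set.indicator_of_notMem (mt (hQ n).2 h), map_zero]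

theorem torusDeriv_trigPoly (s : Finset ℤ) (a : ℤ → ℂ) :
    torusDeriv (trigPoly s a) = trigPoly s fun n => Complex.I * ((n : ℂ) * a n) := by
  funext x
  rw [torusDeriv, trigPoly]
  refine HasDerivAt.deriv ?_
  unfold trigPoly
  refine HasDerivAt.fun_sum fun n _ => ?_
  have e : ∀ t : ℝ, (fourier n (x + (t : Torus)) : ℂ) = fourier n x * fourier n (t : Torus) :=
    fun t => by simp [fourier_apply, smul_add, AddCircle.toCircle_add]
  have h := ((hasDerivAt_fourier (2 * π) n 0).const_mul (fourier n x)).const_mul (a n)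
  refine (h.congr_of_eventuallyEq (Filter.Eventually.of_forall fun t => ?_)).congr_deriv ?_
  · exact congrArg (a n * ·) (e t)
  have hpi : (π : ℂ) ≠ 0 := by exact_mod_cast Real.pi_ne_zero
  simp only [AddCircle.coe_zero, fourier_eval_zero]
  push_cast
  field_simp

/-- The derivative produces the factor `i n₁`, and integration of the exponentials selects `n₁ + n₂
= n₃ + n₄`. -/
theorem quarticIntegral_lowFreq {Q₁ Q₂ Q₃ Q₄ : Set ℤ} (h₃ : IsEvenSet Q₃) (h₄ : IsEvenSet Q₄)
    (N : ℕ) (f : Torus → ℂ) :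
    quarticIntegral Q₁ Q₂ Q₃ Q₄ (lowFreq N f) = Complex.I * quadForm
      (fun n : Freq N => Q₁.indicator (fourierCoeff f) n)
      (fun n : Freq N => Q₂.indicator (fourierCoeff f) n)
      (fun n : Freq N => Q₃.indicator (fourierCoeff f) n)
      (fun n : Freq N => Q₄.indicator (fourierCoeff f) n) := by
  classical
  set s := Finset.Icc (-(N : ℤ)) N with hs
  have hsym : ∀ n, n ∈ s → -n ∈ s := fun n hn => by
    rw [hs, Finset.mem_Icc] at hn ⊢; omega
  rw [quarticIntegral, lowFreq_eq_trigPoly, freqProj_conj_trigPoly h₃ hsym,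
    freqProj_conj_trigPoly h₄ hsym, freqProj_trigPoly, freqProj_trigPoly, torusDeriv_trigPoly]
  set A := Q₁.indicator (fourierCoeff f)
  set B := Q₂.indicator (fourierCoeff f)
  set C := Q₃.indicator (fourierCoeff f)
  set D := Q₄.indicator (fourierCoeff f)
  have e : ∀ x : Torus, trigPoly s (fun n => Complex.I * ((n : ℂ) * A n)) x * trigPoly s B x
      * starRingEnd ℂ (trigPoly s C x) * starRingEnd ℂ (trigPoly s D x)
      = ∑ n₁ ∈ s, ∑ n₂ ∈ s, ∑ n₃ ∈ s, ∑ n₄ ∈ s,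
        (Complex.I * ((n₁ : ℂ) * (A n₁ * B n₂ * starRingEnd ℂ (C n₃) * starRingEnd ℂ (D n₄))))
          * fourier (n₁ + n₂ + -n₃ + -n₄) x := fun x => by
    rw [trigPoly, trigPoly, trigPoly, trigPoly, map_sum, map_sum]
    have e' : ∀ n₁ n₂ n₃ n₄ : ℤ,
        (Complex.I * ((n₁ : ℂ) * (A n₁ * B n₂ * starRingEnd ℂ (C n₃) * starRingEnd ℂ (D n₄))))
          * (fourier (n₁ + n₂ + -n₃ + -n₄) x : ℂ)
        = Complex.I * ((n₁ : ℂ) * A n₁) * fourier n₁ x * (B n₂ * fourier n₂ x)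
          * starRingEnd ℂ (C n₃ * fourier n₃ x) * starRingEnd ℂ (D n₄ * fourier n₄ x) :=
      fun n₁ n₂ n₃ n₄ => by
        rw [map_mul, map_mul, ← fourier_neg, ← fourier_neg, fourier_add, fourier_add, fourier_add]
        ring
    simp only [e', ← Finset.mul_sum, ← Finset.sum_mul]
  have hi : ∀ (c : ℂ) (k : ℤ), Integrable (fun x : Torus => c * fourier k x) torusMeasure :=
    fun c k => ((fourier k).continuous.integrable_of_hasCompactSupport
      (HasCompactSupport.of_compactSpace _)).const_mul _
  refine (integral_congr_ae (Filter.Eventually.of_forall e)).trans ?_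
  rw [integral_finsetSum _ fun n₁ _ => integrable_finsetSum _ fun n₂ _ =>
    integrable_finsetSum _ fun n₃ _ => integrable_finsetSum _ fun n₄ _ => hi _ _]
  simp_rw [integral_finsetSum s fun n₂ _ =>
    integrable_finsetSum s fun n₃ _ => integrable_finsetSum s fun n₄ _ => hi _ _]
  simp_rw [integral_finsetSum s fun n₃ _ => integrable_finsetSum s fun n₄ _ => hi _ _]
  simp_rw [integral_finsetSum s fun n₄ _ => hi _ _]
  simp_rw [integral_const_mul, integral_fourier_torus]
  unfold quadForm
  simp only [Finset.mul_sum]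
  rw [← Finset.sum_coe_sort s]
  refine Finset.sum_congr rfl fun n₁ _ => ?_
  rw [← Finset.sum_coe_sort s]
  refine Finset.sum_congr rfl fun n₂ _ => ?_
  rw [← Finset.sum_coe_sort s]
  refine Finset.sum_congr rfl fun n₃ _ => ?_
  rw [← Finset.sum_coe_sort s]
  refine Finset.sum_congr rfl fun n₄ _ => ?_
  have e' : (n₁ : ℤ) + n₂ + -n₃ + -n₄ = 0 ↔ (n₁ : ℤ) + n₂ = n₃ + n₄ := by omega
  simp only [e', mul_ite, mul_one, mul_zero]

end DNLS

namespace DNLS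

/-! ### The weight in terms of the Fourier coefficients -/

theorem hasSum_sq_norm_fourierCoeff (u : L2) :
    HasSum (fun n => ‖fourierCoeff u n‖ ^ 2) (‖u‖ ^ 2) := by
  have h := lp.hasSum_norm (p := 2) (by norm_num) (fourierBasis.repr u)
  simpa [fourierBasis_repr] using h

theorem fourierCoeff_scaled {M : ℝ} {c : ℤ → ℝ} (hc : ∀ n, |c n| ≤ M) (u : L2) (n : ℤ) :
    fourierCoeff (scaled c u) n = c n * fourierCoeff u n := by
  classical
  rw [scaled, fourierCoeff_tsum, if_pos]
  refine ((hasSum_sq_norm_fourierCoeff u).summable.mul_left (M ^ 2)).of_nonneg_of_le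
    (fun n => by positivity) fun n => ?_
  rw [norm_mul, mul_pow, Complex.norm_real]
  exact mul_le_mul_of_nonneg_right (pow_le_pow_left₀ (norm_nonneg _) (hc n) 2) (sq_nonneg _)

/-- The Fourier coefficients of frequency `|n| ≤ N`, normalized by the bracket. -/
noncomputable def normalizedCoeff (N : ℕ) (u : L2) (n : Freq N) : ℂ :=
  (bracket n : ℂ) * fourierCoeff u n

theorem indicator_fourierCoeff_scaled {M : ℝ} {c : ℤ → ℝ} (hc : ∀ n, |c n| ≤ M) (Q : Set ℤ)
    (N : ℕ) (u : L2) :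
    (fun n : Freq N => Q.indicator (fourierCoeff (scaled c u)) n)
      = smulSeq (freqWeight (Q.indicator c)) (normalizedCoeff N u) := by
  classical
  funext n
  have hb : (bracket n : ℂ) ≠ 0 := Complex.ofReal_ne_zero.2 (bracket_pos n).ne'
  simp only [smulSeq, freqWeight, normalizedCoeff]
  by_cases h : (n : ℤ) ∈ Q
  · rw [Set.indicator_of_mem h, Set.indicator_of_mem h, fourierCoeff_scaled hc]
    push_cast
    field_simp
  · simp [Set.indicator_of_notMem h]

theorem quarticIntegral_lowFreq_scaled {M : ℝ} {c : ℤ → ℝ} (hc : ∀ n, |c n| ≤ M)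
    {Q₁ Q₂ Q₃ Q₄ : Set ℤ} (h₃ : IsEvenSet Q₃) (h₄ : IsEvenSet Q₄) (N : ℕ) (u : L2) :
    quarticIntegral Q₁ Q₂ Q₃ Q₄ (lowFreq N (scaled c u)) = Complex.I * quadForm
      (smulSeq (freqWeight (Q₁.indicator c)) (normalizedCoeff N u))
      (smulSeq (freqWeight (Q₂.indicator c)) (normalizedCoeff N u))
      (smulSeq (freqWeight (Q₃.indicator c)) (normalizedCoeff N u))
      (smulSeq (freqWeight (Q₄.indicator c)) (normalizedCoeff N u)) := by
  simp only [quarticIntegral_lowFreq h₃ h₄, indicator_fourierCoeff_scaled hc]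

theorem sum_normalizedCoeff_le (N : ℕ) (u : L2) :
    ∑ n : Freq N, invSq n * ‖normalizedCoeff N u n‖ ^ 2 ≤ ‖u‖ ^ 2 := by
  have e : ∀ n : Freq N, invSq n * ‖normalizedCoeff N u n‖ ^ 2 = ‖fourierCoeff u n‖ ^ 2 :=
    fun n => by
      rw [normalizedCoeff, norm_mul, mul_pow, Complex.norm_real, Real.norm_eq_abs, sq_abs, invSq,
        ← mul_assoc, inv_mul_cancel₀ (pow_pos (bracket_pos n) 2).ne', one_mul]
  simp_rw [e]
  rw [Finset.sum_coe_sort (Finset.Icc (-(N : ℤ)) N) fun n => ‖fourierCoeff u n‖ ^ 2]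
  exact sum_le_hasSum _ (fun n _ => sq_nonneg _) (hasSum_sq_norm_fourierCoeff u)

/-- The majorant of the weight, as a function of the normalized Fourier coefficients. -/
noncomputable def majorant (p m : ℝ) {N : ℕ} (b₁ b₂ b₃ b₄ : ℤ → ℝ) (x : Freq N → ℂ) : ℝ≥0∞ :=
  {x : Freq N → ℂ | ∑ n : Freq N, invSq n * ‖x n‖ ^ 2 < m}.indicator
    (fun x => ENNReal.ofReal (Real.exp (3 * p / 2 * ‖quadForm (smulSeq (freqWeight b₁) x)
      (smulSeq (freqWeight b₂) x) (smulSeq (freqWeight b₃) x) (smulSeq (freqWeight b₄) x)‖))) x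

theorem measurable_majorant (p m : ℝ) {N : ℕ} (b₁ b₂ b₃ b₄ : ℤ → ℝ) :
    Measurable (majorant p m b₁ b₂ b₃ b₄ : (Freq N → ℂ) → ℝ≥0∞) :=
  (((measurable_quadForm _ _ _ _).norm.const_mul _).exp).ennreal_ofReal.indicator
    (measurableSet_lt (by fun_prop) measurable_const)

theorem majorant_zero_le (p m : ℝ) {N : ℕ} (b₁ b₂ b₃ b₄ : ℤ → ℝ) :
    majorant p m b₁ b₂ b₃ b₄ (0 : Freq N → ℂ) ≤ 1 := by
  refine (Set.indicator_le_self _ _ _).trans ?_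
  have h : quadForm (smulSeq (freqWeight b₁) (0 : Freq N → ℂ)) (smulSeq (freqWeight b₂) 0)
      (smulSeq (freqWeight b₃) 0) (smulSeq (freqWeight b₄) 0) = 0 := by
    simp [quadForm, smulSeq]
  rw [h]
  simp

/-- The phase of the exponent is given away by `Re z ≤ |z|`, and the constraint on `u` is relaxed to
its frequencies `|n| ≤ N`. What remains is a function of finitely many coefficients. -/
theorem enorm_truncatedWeight_le {M p m m₀ : ℝ} (hp : 0 ≤ p) (hm : m ≤ m₀) {c : ℤ → ℝ}
    (hc : ∀ n, |c n| ≤ M) {Q₁ Q₂ Q₃ Q₄ : Set ℤ} (h₃ : IsEvenSet Q₃) (h₄ : IsEvenSet Q₄) (N : ℕ)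
    (u : HalfMinus) :
    ‖truncatedWeight p m c Q₁ Q₂ Q₃ Q₄ N u‖ₑ ≤ majorant p m₀ (Q₁.indicator c) (Q₂.indicator c)
      (Q₃.indicator c) (Q₄.indicator c) (normalizedCoeff N u.1) := by
  rw [truncatedWeight]
  split_ifs with hu
  swap
  · rw [enorm_zero]; exact zero_le
  have hmem : normalizedCoeff N u.1 ∈
      {x : Freq N → ℂ | ∑ n : Freq N, invSq n * ‖x n‖ ^ 2 < m₀} :=
    (sum_normalizedCoeff_le N u.1).trans_lt (hu.trans_le hm)
  rw [majorant, Set.indicator_of_mem hmem, ← ofReal_norm, Complex.norm_exp,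
    quarticIntegral_lowFreq_scaled hc h₃ h₄]
  refine ENNReal.ofReal_le_ofReal (Real.exp_le_exp.2 ((Complex.re_le_norm _).trans (le_of_eq ?_)))
  rw [norm_mul, norm_mul, norm_mul, norm_div, norm_mul]
  simp only [Complex.norm_real, Complex.norm_I, Real.norm_eq_abs, abs_of_nonneg hp, norm_neg,
    Complex.norm_ofNat, mul_one, one_mul]
  ring

theorem measurable_fourierCoeff (n : ℤ) : Measurable fun u : HalfMinus => fourierCoeff u.1 n :=
  (measurable_pi_apply n).comp (comap_measurable fun (u : HalfMinus) (n : ℤ) => fourierCoeff u.1 n)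

theorem measurable_normalizedCoeff (N : ℕ) :
    Measurable fun u : HalfMinus => normalizedCoeff N u.1 :=
  measurable_pi_iff.2 fun n => (measurable_fourierCoeff n).const_mul _

theorem measurable_truncatedWeight {M p m : ℝ} (hm : 0 < m) {c : ℤ → ℝ}
    (hc : ∀ n, |c n| ≤ M) {Q₁ Q₂ Q₃ Q₄ : Set ℤ} (h₃ : IsEvenSet Q₃) (h₄ : IsEvenSet Q₄) (N : ℕ) :
    Measurable (truncatedWeight p m c Q₁ Q₂ Q₃ Q₄ N) := by
  classical
  have hs : MeasurableSet {u : HalfMinus | ‖u.1‖ ^ 2 < m} := by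
    -- The `σ`-algebra knows only the Fourier coefficients, so the norm is rewritten by Parseval's
    -- identity.
    have e : {u : HalfMinus | ‖u.1‖ ^ 2 < m}
        = {u : HalfMinus | ∑' n, ENNReal.ofReal (‖fourierCoeff u.1 n‖ ^ 2) < ENNReal.ofReal m} := by
      ext u
      have h := hasSum_sq_norm_fourierCoeff u.1
      rw [Set.mem_ofPred_eq, Set.mem_ofPred_eq,
        ← ENNReal.ofReal_tsum_of_nonneg (fun n => sq_nonneg _) h.summable, h.tsum_eq,
        ENNReal.ofReal_lt_ofReal_iff hm]
    rw [e]
    exact measurableSet_lt (Measurable.tsum fun n =>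
      ((measurable_fourierCoeff n).norm.pow_const 2).ennreal_ofReal) measurable_const
  have hq : Measurable fun u : HalfMinus =>
      quarticIntegral Q₁ Q₂ Q₃ Q₄ (lowFreq N (scaled c u.1)) := by
    simp_rw [quarticIntegral_lowFreq_scaled hc h₃ h₄]
    exact ((measurable_quadForm _ _ _ _).comp (measurable_normalizedCoeff N)).const_mul _
  exact Measurable.ite hs (Complex.measurable_exp.comp (hq.const_mul _)) measurable_const

/-! ### The random series -/

/-- When the series does not converge or its sum is not in the space, the function is zero.
Retaining this alternative makes a proof of almost sure convergence unnecessary. -/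
theorem fourierCoeff_randomSeries {Ω : Type*} (g : ℤ → Ω → ℂ) (ω : Ω) :
    (∀ n, fourierCoeff (randomSeries g ω).1 n = 0) ∨
      ∀ n, fourierCoeff (randomSeries g ω).1 n = g n ω / bracket n := by
  classical
  have h0 : ∀ n : ℤ, fourierCoeff (0 : L2) n = 0 := fun n => by
    rw [← fourierBasis_repr]; simp
  by_cases h : MemHalfMinus (∑' n : ℤ, (g n ω / (bracket n : ℂ)) • (fourierLp 2 n : L2))
  · have e : randomSeries g ω = ⟨_, h⟩ := dif_pos h
    rw [e]
    simp only [fourierCoeff_tsum]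
    split_ifs
    · exact Or.inr fun n => rfl
    · exact Or.inl fun n => rfl
  · have e : randomSeries g ω = ⟨0, memHalfMinus_zero⟩ := dif_neg h
    rw [e]
    exact Or.inl h0

theorem normalizedCoeff_randomSeries {Ω : Type*} (g : ℤ → Ω → ℂ) (ω : Ω) (N : ℕ) :
    normalizedCoeff N (randomSeries g ω).1 = 0 ∨
      normalizedCoeff N (randomSeries g ω).1 = fun n : Freq N => g n ω := by
  refine (fourierCoeff_randomSeries g ω).imp (fun h => funext fun n => ?_)
    fun h => funext fun n => ?_
  · rw [normalizedCoeff, h, mul_zero]; rfl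
  · have hb : (bracket n : ℂ) ≠ 0 := Complex.ofReal_ne_zero.2 (bracket_pos n).ne'
    rw [normalizedCoeff, h, mul_div_cancel₀ _ hb]

section Random

variable {Ω : Type*} [MeasurableSpace Ω]

theorem IsGaussianFamily.map_freq {P : Measure Ω} [IsProbabilityMeasure P] {g : ℤ → Ω → ℂ}
    (hg : IsGaussianFamily P g) (N : ℕ) :
    P.map (fun ω (n : Freq N) => g n ω) = gaussianPi (Freq N) := by
  have h := hg.indep.precomp (g := fun n : Freq N => (n : ℤ)) Subtype.val_injective
  rw [(iIndepFun_iff_map_fun_eq_pi_map fun n : Freq N => (hg.measurable n).aemeasurable).1 h]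
  simp_rw [hg.law]

/-- The summand `1` covers the outcomes at which the random function is replaced by zero, where the
majorant is at most `1`. -/
theorem lintegral_enorm_truncatedWeight_le {M p m m₀ : ℝ} (hp : 0 ≤ p) (hm0 : 0 < m) (hm : m ≤ m₀)
    {c : ℤ → ℝ} (hc : ∀ n, |c n| ≤ M) {Q₁ Q₂ Q₃ Q₄ : Set ℤ} (h₃ : IsEvenSet Q₃)
    (h₄ : IsEvenSet Q₄) (N : ℕ) {P : Measure Ω} [IsProbabilityMeasure P] {g : ℤ → Ω → ℂ}
    (hg : IsGaussianFamily P g) :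
    ∫⁻ u, ‖truncatedWeight p m c Q₁ Q₂ Q₃ Q₄ N u‖ₑ ∂(mu P g)
      ≤ 1 + ∫⁻ x, majorant p m₀ (Q₁.indicator c) (Q₂.indicator c)
        (Q₃.indicator c) (Q₄.indicator c) x ∂(gaussianPi (Freq N)) := by
  have hgm : Measurable fun ω (n : Freq N) => g n ω :=
    measurable_pi_iff.2 fun n => hg.measurable n
  rw [mu, lintegral_map (measurable_truncatedWeight hm0 hc h₃ h₄ N).enorm
    (measurable_randomSeries hg.measurable), ← hg.map_freq N,
    lintegral_map (measurable_majorant ..) hgm]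
  calc _ ≤ ∫⁻ ω, (1 + majorant p m₀ (Q₁.indicator c) (Q₂.indicator c)
        (Q₃.indicator c) (Q₄.indicator c) fun n : Freq N => g n ω) ∂P := by
        refine lintegral_mono fun ω => (enorm_truncatedWeight_le hp hm hc h₃ h₄ N _).trans ?_
        rcases normalizedCoeff_randomSeries g ω N with h | h
        · rw [h]
          exact (majorant_zero_le ..).trans le_self_add
        · rw [h]
          exact le_add_self
    _ = _ := by
        rw [lintegral_add_left measurable_const, lintegral_const, measure_univ, mul_one]

end Random

theorem abs_indicator_le {M : ℝ} {c : ℤ → ℝ} (hc : ∀ n, |c n| ≤ M) (Q : Set ℤ) (n : ℤ) :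
    |Q.indicator c n| ≤ M := by
  classical
  rw [Set.indicator_apply]
  split_ifs
  · exact hc n
  · rw [abs_zero]
    exact (abs_nonneg _).trans (hc n)

theorem IsEvenSet.indicator_neg {c : ℤ → ℝ} (hc : ∀ n, c n = c (-n)) {Q : Set ℤ}
    (hQ : IsEvenSet Q) (n : ℤ) : Q.indicator c n = Q.indicator c (-n) := by
  classical
  rw [Set.indicator_apply, Set.indicator_apply, ← hc n]
  simp only [hQ n]

end DNLS

theorem proposition552 (M p : ℝ) (hp : 1 ≤ p) :
    ∃ m₀ : ℝ, 0 < m₀ ∧ ∃ C : ℝ, ∀ m : ℝ, 0 < m → m ≤ m₀ →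
      ∀ (Ω : Type*) [MeasurableSpace Ω] (P : Measure Ω) [IsProbabilityMeasure P] (g : ℤ → Ω → ℂ),
        DNLS.IsGaussianFamily P g →
      ∀ c : ℤ → ℝ, (∀ n, |c n| ≤ M) → (∀ n, c n = c (-n)) →
      ∀ Q₁ Q₂ Q₃ Q₄ : Set ℤ, DNLS.IsEvenSet Q₁ → DNLS.IsEvenSet Q₂ → DNLS.IsEvenSet Q₃ →
        DNLS.IsEvenSet Q₄ →
      ∀ N : ℕ, (N = 0 ∨ ∃ k : ℕ, N = 2 ^ k) →
        Integrable (DNLS.truncatedWeight p m c Q₁ Q₂ Q₃ Q₄ N) (DNLS.mu P g) ∧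
        ∫ u, ‖DNLS.truncatedWeight p m c Q₁ Q₂ Q₃ Q₄ N u‖ ∂(DNLS.mu P g) ≤ C := by
  -- The Gaussian estimate needs a bound of at least `1` for the multipliers, whence the maximum.
  obtain ⟨m₀, hm₀, C, hC, hbound⟩ :=
    DNLS.exists_lintegral_exp_quadForm_le (le_max_right M 1) hp
  refine ⟨m₀, hm₀, (1 + C).toReal, ?_⟩
  intro m hm hmm Ω _ P _ g hg c hc hc' Q₁ Q₂ Q₃ Q₄ h₁ h₂ h₃ h₄ N _
  have hcM : ∀ n, |c n| ≤ max M 1 := fun n => (hc n).trans (le_max_left _ _)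
  have hle : ∫⁻ u, ‖DNLS.truncatedWeight p m c Q₁ Q₂ Q₃ Q₄ N u‖ₑ ∂(DNLS.mu P g) ≤ 1 + C :=
    (DNLS.lintegral_enorm_truncatedWeight_le (by linarith) hm hmm hc h₃ h₄ N hg).trans
      (add_le_add le_rfl (hbound N _ _ _ _ (DNLS.abs_indicator_le hcM Q₁)
        (DNLS.abs_indicator_le hcM Q₂) (DNLS.abs_indicator_le hcM Q₃)
        (DNLS.abs_indicator_le hcM Q₄) (h₁.indicator_neg hc') (h₂.indicator_neg hc')
        (h₃.indicator_neg hc') (h₄.indicator_neg hc')))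
  have htop : 1 + C ≠ ∞ := ENNReal.add_ne_top.2 ⟨ENNReal.one_ne_top, hC⟩
  have hmeas := DNLS.measurable_truncatedWeight (p := p) (Q₁ := Q₁) (Q₂ := Q₂) hm hc h₃ h₄ N
  refine ⟨⟨hmeas.aestronglyMeasurable, hle.trans_lt htop.lt_top⟩, ?_⟩
  rw [integral_norm_eq_lintegral_enorm hmeas.aestronglyMeasurable]
  exact ENNReal.toReal_mono htop hle
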